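/- Let $\mathcal G$ be a (finite-dimensional) complex simple Lie algebra with a fixed invariant scalar product $\langle\ ,\ \rangle$ (an invariant nondegenerate symmetric bilinear form), let $\{T_a\}$, $\{T^a\}$ be dual bases of $\mathcal G$, so $\langle T_a,T^b\rangle=\delta_a^b$, put $[T_a,T_b]=f_{ab}^cT_c$ and $f=f_{ab}^c\,T^a\otimes T^b\otimes T_c$, and let $G$ be a connected complex Lie group with Lie algebra $\mathcal G$. Let $\check{\mathcal G}\subset\mathcal G$ be an open neighbourhood of $0$ which the exponential map sends diffeomorphically onto an open set $\check G=\exp(\check{\mathcal G})\subset G$. Let $F$ be a complex function that is holomorphic in a neighbourhood of $0$ and odd, such that for all $\omega\in\check{\mathcal G}$ the Taylor series of $F$ at $0$ converges at $\mathrm{ad}_\omega$ (this holds if $\check{\mathcal G}$ is small enough), and let $R:\check G\to\mathrm{End}(\mathcal G)$ be given by $R(e^\omega)=F(\mathrm{ad}_\omega)$, the sum of that series. Write $\mathcal D^+_XR(\Omega)=\frac{d}{dt}\big|_{t=0}R(e^{tX}\Omega e^{tX})$ and $\mathcal D^+_a=\mathcal D^+_{T_a}$. For a constant $\mu\in\mathbb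 C$, the PL-CDYBE with constant $\mu$ is the requirement that for all $\Omega\in\check G$ and $X,Y,Z\in\mathcal G$ $$\big\langle [R(\Omega)X,R(\Omega)Y]-\tfrac12(\mathcal D^+_XR)(\Omega)Y,\,Z\big\rangle+\text{cycl. perm. of }(X,Y,Z)=\mu\,\langle[X,Y],Z\rangle .$$ Then: 1. $R$ solves the PL-CDYBE on $\check G$ with some constant $\mu\in\mathbb C$ if and only if there is a $\nu\in\mathbb C$ such that, near $0$, $F=F_\nu$, where $$F_\nu(z)=\nu\coth(\nu z)-\tfrac12\coth(\tfrac z2),\qquad F_\nu(0)=0$$ (with $\nu\coth(\nu z)$ read as $1/z$ for $\nu=0$). 2. If $F=F_\nu$ near $0$, then $R$ solves the PL-CDYBE with constant $\mu$ if and only if $\mu=\tfrac14-\nu^2$. 3. The PL-CDYBE in this form is equivalent to its tensor form: identifying $\mathrm{End}(\mathcal G)$ with $\mathcal G\otimes\mathcal G$ by the scalar product, and for any constant $\mathcal I\in\mathcal G\otimes\mathcal G\otimes\mathcal G$, one has $$[R_{12},R_{13}]+\tfrac12T^a_3\,\mathcal D^+_aR_{12}+\text{cycl. perm.}=\mathcal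 I\quad\text{on }\check G$$ if and only if $\mathcal I=\mu f$ for some $\mu\in\mathbb C$ for which $R$ solves the PL-CDYBE with constant $\mu$. -/

import Mathlib

open Filter Topology TensorProduct

attribute [local instance 100] LieRing.ofAssociativeRing

noncomputable section

namespace PLDyn

/-- The meromorphic function `z ↦ ν coth (ν z)`, which is `1 / z` for `ν = 0`. -/
def nuCoth (ν z : ℂ) : ℂ :=
  if ν = 0 then 1 / z else ν * (Complex.cosh (ν * z) / Complex.sinh (ν * z))

/-- `F_ν(z) = ν coth (ν z) - (1/2) coth (z/2)`, with its regular value `0` at `z = 0`. -/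
def Fnu (ν z : ℂ) : ℂ :=
  if z = 0 then 0 else nuCoth ν z - nuCoth (1 / 2) z

/-- The derivative of the curve `c` with respect to its complex parameter exists at `0` and
equals `v`. -/
def HasVelocity {E : Type*} [AddCommGroup E] [Module ℂ E] [TopologicalSpace E]
    (c : ℂ → E) (v : E) : Prop :=
  Tendsto (fun t : ℂ => t⁻¹ • (c t - c 0)) (𝓝[≠] 0) (𝓝 v)

section Group

variable {𝔤 : Type*} [LieRing 𝔤] [LieAlgebra ℂ 𝔤] {n : ℕ}

/-- The matrix exponential `e^{ρ(ω)}` as an invertible matrix. -/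
def expGL (ρ : 𝔤 →ₗ⁅ℂ⁆ Matrix (Fin n) (Fin n) ℂ) (ω : 𝔤) : GL (Fin n) ℂ :=
  (Matrix.isUnit_exp (ρ ω)).unit

/-- The connected linear group with Lie algebra `ρ(𝔤)`: the subgroup of `GL(n, ℂ)` generated by
the exponentials of the elements of `ρ(𝔤)`. -/
def linGroup (ρ : 𝔤 →ₗ⁅ℂ⁆ Matrix (Fin n) (Fin n) ℂ) : Subgroup (GL (Fin n) ℂ) :=
  Subgroup.closure (Set.range (expGL ρ))

/-- The exponential map `ω ↦ e^ω` from the Lie algebra to the group. -/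
def expG (ρ : 𝔤 →ₗ⁅ℂ⁆ Matrix (Fin n) (Fin n) ℂ) (ω : 𝔤) : linGroup ρ :=
  ⟨expGL ρ ω, Subgroup.subset_closure ⟨ω, rfl⟩⟩

variable [TopologicalSpace 𝔤]

/-- `U` is an open neighbourhood of `0` in the Lie algebra which the exponential map sends
diffeomorphically onto an open subset of the group: the restricted exponential map is an open
embedding whose differential is injective at every point of `U`. -/
structure IsExpDomain (ρ : 𝔤 →ₗ⁅ℂ⁆ Matrix (Fin n) (Fin n) ℂ) (U : Set 𝔤) : Prop where
  isOpen : IsOpen U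
  zero_mem : (0 : 𝔤) ∈ U
  isOpenEmbedding : IsOpenEmbedding (fun ω : U => expG ρ (ω : 𝔤))
  immersion : ∀ ω ∈ U, ∀ X : 𝔤,
    HasVelocity (fun t : ℂ => NormedSpace.exp (ρ (ω + t • X))) 0 → X = 0

/-- `R(e^ω) = F(ad_ω)` for all `ω ∈ U`, where `F(ad_ω)` is the sum of the Taylor series of `F`
at `0`, evaluated at `ad_ω`; the convergence of this series is part of the condition. -/
def IsAnsatz (ρ : 𝔤 →ₗ⁅ℂ⁆ Matrix (Fin n) (Fin n) ℂ) (U : Set 𝔤) (F : ℂ → ℂ)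
    (R : linGroup ρ → Module.End ℂ 𝔤) : Prop :=
  ∀ ω ∈ U, ∀ Y : 𝔤,
    HasSum (fun k : ℕ => (iteratedDeriv k F 0 / (k.factorial : ℂ)) •
      ((LieAlgebra.ad ℂ 𝔤 ω) ^ k) Y) (R (expG ρ ω) Y)

/-- `D` is the derivative `𝓓⁺_X R (Ω) = d/dt R(e^{tX} Ω e^{tX})` at `t = 0`. -/
def IsDPlus (ρ : 𝔤 →ₗ⁅ℂ⁆ Matrix (Fin n) (Fin n) ℂ)
    (R : linGroup ρ → Module.End ℂ 𝔤) (Ω : linGroup ρ) (X : 𝔤) (D : Module.End ℂ 𝔤) : Prop :=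
  ∀ Y : 𝔤, HasVelocity (fun t : ℂ => R (expG ρ (t • X) * Ω * expG ρ (t • X)) Y) (D Y)

/-- The PL-CDYBE in operator form, with constant `μ`, on the domain `exp U`:
`⟨[R(Ω) X, R(Ω) Y] - ½ (𝓓⁺_X R)(Ω) Y, Z⟩ + cycl. perm. = μ ⟨[X, Y], Z⟩`
for all `X, Y, Z`, the derivatives `𝓓⁺_X R (Ω)` being required to exist. -/
def SolvesPLCDYBE (B : LinearMap.BilinForm ℂ 𝔤) (ρ : 𝔤 →ₗ⁅ℂ⁆ Matrix (Fin n) (Fin n) ℂ)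
    (U : Set 𝔤) (R : linGroup ρ → Module.End ℂ 𝔤) (μ : ℂ) : Prop :=
  ∀ Ω ∈ expG ρ '' U, ∃ D : 𝔤 → Module.End ℂ 𝔤, (∀ X, IsDPlus ρ R Ω X (D X)) ∧
    ∀ X Y Z : 𝔤,
      B (⁅R Ω X, R Ω Y⁆ - (1 / 2 : ℂ) • D X Y) Z +
      B (⁅R Ω Y, R Ω Z⁆ - (1 / 2 : ℂ) • D Y Z) X +
      B (⁅R Ω Z, R Ω X⁆ - (1 / 2 : ℂ) • D Z X) Y = μ * B ⁅X, Y⁆ Z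

end Group

section Tensor

variable {𝔤 : Type*} [LieRing 𝔤] [LieAlgebra ℂ 𝔤] {ι : Type*} [Fintype ι]

/-- The invariant tensor `f = f_{ab}^c T^a ⊗ T^b ⊗ T_c` with `[T_a, T_b] = f_{ab}^c T_c`, for
dual bases `T a = T_a` and `T' a = T^a`. -/
def structureTensor (T T' : Module.Basis ι ℂ 𝔤) : 𝔤 ⊗[ℂ] (𝔤 ⊗[ℂ] 𝔤) :=
  ∑ a, ∑ b, T' a ⊗ₜ[ℂ] (T' b ⊗ₜ[ℂ] ⁅T a, T b⁆)

/-- The cyclic permutation `x ⊗ y ⊗ z ↦ y ⊗ z ⊗ x` of the three tensor factors. -/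
def cyc : 𝔤 ⊗[ℂ] (𝔤 ⊗[ℂ] 𝔤) →ₗ[ℂ] 𝔤 ⊗[ℂ] (𝔤 ⊗[ℂ] 𝔤) :=
  (TensorProduct.assoc ℂ 𝔤 𝔤 𝔤).toLinearMap ∘ₗ
    (TensorProduct.comm ℂ 𝔤 (𝔤 ⊗[ℂ] 𝔤)).toLinearMap

/-- `[R₁₂, R₁₃] + ½ T^a₃ 𝓓⁺_a R₁₂`, where `A` is the value of `R` and `D X` that of `𝓓⁺_X R`.
An operator `A` is identified with the tensor `∑ a, A T_a ⊗ T^a`, that is, `x ⊗ y` with the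
operator `v ↦ ⟨y, v⟩ x`. -/
def plTensor (T T' : Module.Basis ι ℂ 𝔤) (A : Module.End ℂ 𝔤) (D : 𝔤 → Module.End ℂ 𝔤) :
    𝔤 ⊗[ℂ] (𝔤 ⊗[ℂ] 𝔤) :=
  (∑ a, ∑ b, ⁅A (T a), A (T b)⁆ ⊗ₜ[ℂ] (T' a ⊗ₜ[ℂ] T' b)) +
    (1 / 2 : ℂ) • ∑ a, ∑ c, D (T a) (T c) ⊗ₜ[ℂ] (T' c ⊗ₜ[ℂ] T' a)

variable [TopologicalSpace 𝔤] {n : ℕ}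

/-- The PL-CDYBE in tensor form, with constant right-hand side `I`, on the domain `exp U`:
`[R₁₂, R₁₃] + ½ T^a₃ 𝓓⁺_a R₁₂ + cycl. perm. = I`. -/
def SolvesTensorPLCDYBE (T T' : Module.Basis ι ℂ 𝔤)
    (ρ : 𝔤 →ₗ⁅ℂ⁆ Matrix (Fin n) (Fin n) ℂ)
    (U : Set 𝔤) (R : linGroup ρ → Module.End ℂ 𝔤) (I : 𝔤 ⊗[ℂ] (𝔤 ⊗[ℂ] 𝔤)) : Prop :=
  ∀ Ω ∈ expG ρ '' U, ∃ D : 𝔤 → Module.End ℂ 𝔤, (∀ X, IsDPlus ρ R Ω X (D X)) ∧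
    plTensor T T' (R Ω) D + cyc (plTensor T T' (R Ω) D) +
      cyc (cyc (plTensor T T' (R Ω) D)) = I

end Tensor

end PLDyn

end

/-! Put `A = ad_ω` and `σ(z) = sinh (z/2) / (z/2)`. With `L`, `R` the left and right multiplications
by `ω`, the derivative of `exp` at `ω` is `e^{(L+R)/2} σ(L - R)`, while `e^ω X + X e^ω = 2
e^{(L+R)/2} cosh ((L - R)/2) X`. So for `X = σ(A) W` the logarithm of `e^{tX} e^ω e^{tX}` has
velocity `2 cosh(A/2) W` at `t = 0`. As `exp` is an immersion, `σ(A)` is invertible and every `X`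
has this form.

The derivative of `F(A)` in a direction `ad V` is a divided difference of `F`. By invariance, the
powers of `A` inside it act on the three arguments of `⟨[X, Y], Z⟩`. With `x, y, z` the actions of
`A` on these arguments, `x + y + z = 0` on this form, and the equation reads, after division by
`σ(x) σ(y) σ(z)`, `F(x)F(y) + ½ coth(x/2) (F(y) + F(z)) + cycl. = μ`. For `G = F + ½ coth(z/2)` this
says `G(x)G(y) + cycl. - (½ coth(x/2) ½ coth(y/2) + cycl.) = μ`. The addition theorem of `coth`
gives `-ν²` and `-1/4` for the cyclic sums of `ν coth(νz)` and `½ coth(z/2)`, whence sufficiency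
with `μ = 1/4 - ν²` (`plSeries_eq_zero`, `plForm_eq_zero`).

For necessity, an element `ω₀` with a nonzero adjoint eigenvalue allows the specialization `(x, y,
z) = (z, -z, 0)`, which is the Riccati equation `F' + F² + coth(z/2) F + μ = 0`. Its solution
regular at `0` is unique (`riccati_of_plSeries`, `isFnuSeries_of_riccati`, `isFnuSeries_of_plForm`).
The constant `μ` is unique because `⟨[X, Y], Z⟩` is not identically zero.

For the tensor form, `F` being odd makes `𝓓⁺_X R` skew, so that pairing with `X, Y, Z` gives the
operator form; at `Ω = 1` the left-hand side is `-3 F'(0) f`, which forces the shape of a constant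
right-hand side (`solvesTensor_iff`).

The functional identities are proved for formal power series in `t` over a polynomial ring, where
cancellation is possible, and are then evaluated at commuting operators and `t = 1`. -/

noncomputable section

namespace PLDyn

open PowerSeries

/-! ### Formal power series for exp, sinh, cosh and their addition theorems. -/

section Formal

/-- The formal power series of `z ↦ exp (ν z)`. -/
def expS (ν : ℂ) : ℂ⟦X⟧ := rescale ν (exp ℂ)

/-- The formal power series of `z ↦ sinh (ν z) / ν`, which is `z` for `ν = 0`. -/
def sinhS (ν : ℂ) : ℂ⟦X⟧ :=
  if ν = 0 then X else C (1 / (2 * ν)) * (expS ν - expS (-ν))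

/-- The formal power series of `z ↦ cosh (ν z)`. -/
def coshS (ν : ℂ) : ℂ⟦X⟧ := C (1 / 2) * (expS ν + expS (-ν))

/-- The quotient of a formal power series without constant term by the variable. -/
def divX (f : ℂ⟦X⟧) : ℂ⟦X⟧ := mk fun k => coeff (k + 1) f

/-- The formal power series of `z ↦ sinh (z / 2) / (z / 2)`. -/
def sigmaS : ℂ⟦X⟧ := divX (sinhS (1 / 2))

lemma sub_mul_sum_antidiagonal {S : Type*} [CommRing S] (x y : S) (k : ℕ) :
    (x - y) * ∑ ij ∈ Finset.HasAntidiagonal.antidiagonal k, x ^ ij.1 * y ^ ij.2 =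
      x ^ (k + 1) - y ^ (k + 1) := by
  rw [Finset.Nat.sum_antidiagonal_eq_sum_range_succ (f := fun i j => x ^ i * y ^ j), mul_comm,
    ← (Commute.all x y).geom_sum₂_mul (k + 1)]
  simp

section Series

variable {S : Type*} [CommRing S] [Algebra ℂ S]

/-- The formal power series `f (x t)` in the variable `t`. -/
def ser (x : S) : ℂ⟦X⟧ →+* S⟦X⟧ := (rescale x).comp (PowerSeries.map (algebraMap ℂ S))

/-- The divided difference `(f (x t) - f (y t)) / (x t - y t)` as a formal power series in `t`. -/
def del (f : ℂ⟦X⟧) (x y : S) : S⟦X⟧ :=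
  mk fun k => algebraMap ℂ S (coeff (k + 1) f) *
    ∑ ij ∈ Finset.HasAntidiagonal.antidiagonal k, x ^ ij.1 * y ^ ij.2

lemma coeff_ser (f : ℂ⟦X⟧) (x : S) (k : ℕ) :
    coeff k (ser x f) = algebraMap ℂ S (coeff k f) * x ^ k := by
  simp [ser, coeff_rescale, mul_comm]

lemma coeff_del (f : ℂ⟦X⟧) (x y : S) (k : ℕ) :
    coeff k (del f x y) = algebraMap ℂ S (coeff (k + 1) f) *
      ∑ ij ∈ Finset.HasAntidiagonal.antidiagonal k, x ^ ij.1 * y ^ ij.2 := by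
  simp [del]

lemma X_mul_del (f : ℂ⟦X⟧) (x y : S) :
    X * C (x - y) * del f x y = ser x f - ser y f := by
  ext k
  rw [mul_assoc]
  cases k with
  | zero => rw [map_sub (coeff 0), coeff_ser, coeff_ser]; simp
  | succ k =>
    rw [coeff_succ_X_mul, coeff_C_mul, coeff_del, map_sub, coeff_ser, coeff_ser, ← mul_sub,
      ← sub_mul_sum_antidiagonal]
    ring

lemma ser_X (x : S) : ser x X = X * C x := by
  simp [ser, rescale_X, mul_comm]

lemma ser_C (x : S) (a : ℂ) : ser x (C a) = C (algebraMap ℂ S a) := by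
  ext k
  rw [coeff_ser, coeff_C, coeff_C]
  split_ifs with h <;> simp [h]

lemma ser_neg_of_odd {f : ℂ⟦X⟧} (hf : ∀ k, Even k → coeff k f = 0) (x : S) :
    ser (-x) f = -ser x f := by
  ext k
  rw [map_neg, coeff_ser, coeff_ser]
  rcases Nat.even_or_odd k with hk | hk
  · simp [hf k hk]
  · rw [hk.neg_pow]; ring

lemma ser_neg_of_even {f : ℂ⟦X⟧} (hf : ∀ k, Odd k → coeff k f = 0) (x : S) :
    ser (-x) f = ser x f := by
  ext k
  rw [coeff_ser, coeff_ser]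
  rcases Nat.even_or_odd k with hk | hk
  · rw [hk.neg_pow]
  · simp [hf k hk]

lemma ser_zero (f : ℂ⟦X⟧) : ser (0 : S) f = C (algebraMap ℂ S (constantCoeff f)) := by
  ext k
  rw [coeff_ser, coeff_C]
  split_ifs with h <;> simp [h]

lemma ser_one_complex (f : ℂ⟦X⟧) : ser (1 : ℂ) f = f := by
  simp [ser]

lemma map_ser {S' : Type*} [CommRing S'] [Algebra ℂ S'] (g : S →ₐ[ℂ] S') (f : ℂ⟦X⟧) (x : S) :
    PowerSeries.map (g : S →+* S') (ser x f) = ser (g x) f := by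
  ext k
  rw [coeff_map, coeff_ser, coeff_ser]
  simp

lemma map_del {S' : Type*} [CommRing S'] [Algebra ℂ S'] (g : S →ₐ[ℂ] S') (f : ℂ⟦X⟧) (x y : S) :
    PowerSeries.map (g : S →+* S') (del f x y) = del f (g x) (g y) := by
  ext k
  rw [coeff_map, coeff_del, coeff_del]
  simp

lemma ser_rescale (a : ℂ) (x : S) (f : ℂ⟦X⟧) :
    ser x (rescale a f) = ser (algebraMap ℂ S a * x) f := by
  ext k
  rw [coeff_ser, coeff_ser, coeff_rescale, map_mul, map_pow, mul_pow]
  ring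

lemma ser_exp_add (x y : S) : ser (x + y) (exp ℂ) = ser x (exp ℂ) * ser y (exp ℂ) := by
  let _ : Algebra ℚ S := Algebra.compHom S (algebraMap ℚ ℂ)
  have h : ∀ z : S, ser z (exp ℂ) = rescale z (exp S) := fun z => by
    simp only [ser, RingHom.comp_apply]
    rw [map_exp]
  rw [h, h, h, exp_mul_exp_eq_exp_add]

lemma ser_expS (ν : ℂ) (x : S) : ser x (expS ν) = ser (algebraMap ℂ S ν * x) (exp ℂ) :=
  ser_rescale ν x _

lemma ser_expS_add (ν : ℂ) (x y : S) :
    ser (x + y) (expS ν) = ser x (expS ν) * ser y (expS ν) := by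
  simp only [ser_expS, mul_add, ser_exp_add]

lemma ser_exp_zero : ser (0 : S) (exp ℂ) = 1 := by
  simp [ser_zero]

lemma ser_expS_neg_right (ν : ℂ) (x : S) : ser x (expS (-ν)) = ser (-x) (expS ν) := by
  simp only [ser_expS, map_neg, neg_mul, mul_neg]

lemma ser_expS_mul_neg (ν : ℂ) (x : S) : ser x (expS ν) * ser (-x) (expS ν) = 1 := by
  rw [← ser_expS_add, add_neg_cancel, ser_expS, mul_zero, ser_exp_zero]

lemma ser_coshS (ν : ℂ) (x : S) : ser x (coshS ν) =
    C (algebraMap ℂ S (1 / 2)) * (ser x (expS ν) + ser (-x) (expS ν)) := by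
  rw [coshS, map_mul, map_add, ser_C, ser_expS_neg_right]

lemma ser_sinhS {ν : ℂ} (hν : ν ≠ 0) (x : S) : ser x (sinhS ν) =
    C (algebraMap ℂ S (1 / (2 * ν))) * (ser x (expS ν) - ser (-x) (expS ν)) := by
  rw [sinhS, if_neg hν, map_mul, map_sub, ser_C, ser_expS_neg_right]

end Series

lemma X_mul_divX {f : ℂ⟦X⟧} (hf : constantCoeff f = 0) : X * divX f = f := by
  ext k
  cases k with
  | zero => simp [hf]
  | succ k => simp [divX, coeff_succ_X_mul]

lemma coshS_zero : coshS 0 = 1 := by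
  rw [coshS, expS, neg_zero]
  ext k
  rw [expS, coeff_C_mul]
  simp only [rescale_zero_apply, map_add, coeff_C, coeff_one]
  split_ifs <;> norm_num

lemma constantCoeff_expS (ν : ℂ) : constantCoeff (expS ν) = 1 := by
  rw [← coeff_zero_eq_constantCoeff_apply, expS, coeff_rescale]; simp

lemma constantCoeff_sinhS (ν : ℂ) : constantCoeff (sinhS ν) = 0 := by
  unfold sinhS
  split_ifs
  · simp
  · simp [constantCoeff_expS]

lemma coeff_one_sinhS (ν : ℂ) : coeff 1 (sinhS ν) = 1 := by
  unfold sinhS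
  split_ifs with h
  · simp
  · rw [coeff_C_mul]
    simp only [expS, map_sub, coeff_rescale, coeff_exp]
    simp
    field_simp
    norm_num

lemma constantCoeff_coshS (ν : ℂ) : constantCoeff (coshS ν) = 1 := by
  simp [coshS, constantCoeff_expS]; norm_num

lemma coeff_coshS_odd (ν : ℂ) {k : ℕ} (hk : Odd k) : coeff k (coshS ν) = 0 := by
  rw [coshS, coeff_C_mul]
  simp only [expS, map_add, coeff_rescale, hk.neg_pow]
  ring

lemma coeff_sinhS_even (ν : ℂ) {k : ℕ} (hk : Even k) : coeff k (sinhS ν) = 0 := by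
  unfold sinhS
  split_ifs with h
  · rw [coeff_X, if_neg]
    rintro rfl
    simp at hk
  · rw [coeff_C_mul]
    simp only [expS, map_sub, coeff_rescale, hk.neg_pow]
    ring

lemma X_mul_sigmaS : X * sigmaS = sinhS (1 / 2) := X_mul_divX (constantCoeff_sinhS _)

lemma constantCoeff_sigmaS : constantCoeff sigmaS = 1 := by
  rw [← coeff_zero_eq_constantCoeff_apply, sigmaS, divX, coeff_mk, coeff_one_sinhS]

lemma coeff_sigmaS_odd {k : ℕ} (hk : Odd k) : coeff k sigmaS = 0 := by
  rw [sigmaS, divX, coeff_mk, coeff_sinhS_even _ hk.add_one]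

lemma derivative_expS (ν : ℂ) : d⁄dX ℂ (expS ν) = C ν * expS ν := by
  ext k
  rw [coeff_derivative, coeff_C_mul, expS, coeff_rescale, coeff_rescale, coeff_exp, coeff_exp,
    Nat.factorial_succ]
  have h1 : (k.factorial : ℂ) ≠ 0 := by exact_mod_cast k.factorial_ne_zero
  have h2 : (k + 1 : ℂ) ≠ 0 := by exact_mod_cast k.succ_ne_zero
  simp
  field_simp
  ring

lemma derivative_coshS (ν : ℂ) : d⁄dX ℂ (coshS ν) = C (ν ^ 2) * sinhS ν := by
  by_cases hν : ν = 0
  · subst hν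
    rw [coshS_zero]
    simp
  · rw [coshS, sinhS, if_neg hν, Derivation.leibniz, map_add, derivative_expS, derivative_expS]
    simp only [derivative_C, smul_eq_mul, mul_zero, add_zero]
    rw [map_neg, ← mul_assoc (C (ν ^ 2)), ← map_mul]
    have : ν ^ 2 * (1 / (2 * ν)) = 1 / 2 * ν := by field_simp
    rw [this, map_mul]
    ring

lemma derivative_sinhS (ν : ℂ) : d⁄dX ℂ (sinhS ν) = coshS ν := by
  by_cases hν : ν = 0
  · subst hν
    rw [coshS_zero, sinhS, if_pos rfl, derivative_X]
  · rw [coshS, sinhS, if_neg hν, Derivation.leibniz, map_sub, derivative_expS, derivative_expS]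
    simp only [derivative_C, smul_eq_mul, mul_zero, add_zero]
    rw [map_neg]
    have : (C (1 / 2) : ℂ⟦X⟧) = C (1 / (2 * ν)) * C ν := by
      rw [← map_mul]; congr 1; field_simp
    rw [this]
    ring

section Laws

variable {S : Type*} [CommRing S] [Algebra ℂ S]

lemma ser_sinhS_add (ν : ℂ) (x y : S) : ser (x + y) (sinhS ν) =
    ser x (sinhS ν) * ser y (coshS ν) + ser x (coshS ν) * ser y (sinhS ν) := by
  by_cases hν : ν = 0
  · subst hν
    rw [coshS_zero, sinhS, if_pos rfl, ser_X, ser_X, ser_X, map_add, map_one, map_one]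
    ring
  · have h3 : (C (algebraMap ℂ S (1 / 2)) : S⟦X⟧) * 2 = 1 := by
      have : (2 : S⟦X⟧) = C (algebraMap ℂ S 2) := by rw [map_ofNat, map_ofNat]
      rw [this, ← map_mul, ← map_mul]; norm_num
    rw [ser_sinhS hν, ser_sinhS hν, ser_sinhS hν, ser_coshS, ser_coshS, neg_add, ser_expS_add,
      ser_expS_add]
    linear_combination (-C (algebraMap ℂ S (1 / (2 * ν))) *
      (ser x (expS ν) * ser y (expS ν) - ser (-x) (expS ν) * ser (-y) (expS ν))) * h3

lemma ser_coshS_add (ν : ℂ) (x y : S) : ser (x + y) (coshS ν) =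
    ser x (coshS ν) * ser y (coshS ν) +
      C (algebraMap ℂ S (ν ^ 2)) * (ser x (sinhS ν) * ser y (sinhS ν)) := by
  by_cases hν : ν = 0
  · subst hν
    simp [coshS_zero]
  · have h3 : (C (algebraMap ℂ S (1 / 2)) : S⟦X⟧) * 2 = 1 := by
      have : (2 : S⟦X⟧) = C (algebraMap ℂ S 2) := by rw [map_ofNat, map_ofNat]
      rw [this, ← map_mul, ← map_mul]; norm_num
    have h2 : (C (algebraMap ℂ S (ν ^ 2)) : S⟦X⟧) * C (algebraMap ℂ S (1 / (2 * ν))) ^ 2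
        = C (algebraMap ℂ S (1 / 2)) ^ 2 := by
      simp only [← map_pow, ← map_mul]; congr 2; field_simp
    rw [ser_sinhS hν, ser_sinhS hν, ser_coshS, ser_coshS, ser_coshS, neg_add, ser_expS_add,
      ser_expS_add]
    linear_combination (-(ser x (expS ν) - ser (-x) (expS ν)) *
      (ser y (expS ν) - ser (-y) (expS ν))) * h2 - C (algebraMap ℂ S (1 / 2)) *
      (ser x (expS ν) * ser y (expS ν) + ser (-x) (expS ν) * ser (-y) (expS ν)) * h3

lemma ser_sinhS_neg (ν : ℂ) (x : S) : ser (-x) (sinhS ν) = -ser x (sinhS ν) :=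
  ser_neg_of_odd (fun _ => coeff_sinhS_even ν) x

lemma ser_coshS_neg (ν : ℂ) (x : S) : ser (-x) (coshS ν) = ser x (coshS ν) :=
  ser_neg_of_even (fun _ => coeff_coshS_odd ν) x

/-- The addition theorem of `coth`, for three arguments with sum zero. -/
lemma coth_sum_rule (ν : ℂ) (x y : S) :
    ser x (coshS ν) * ser y (coshS ν) * ser (-x - y) (sinhS ν) +
      ser y (coshS ν) * ser (-x - y) (coshS ν) * ser x (sinhS ν) +
      ser (-x - y) (coshS ν) * ser x (coshS ν) * ser y (sinhS ν) =
    -C (algebraMap ℂ S (ν ^ 2)) *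
      (ser x (sinhS ν) * ser y (sinhS ν) * ser (-x - y) (sinhS ν)) := by
  rw [← neg_add', ser_sinhS_neg, ser_coshS_neg, ser_sinhS_add, ser_coshS_add]
  ring

lemma ser_sinhS_ne_zero (ν : ℂ) [Nontrivial S] {x : S} (hx : x ≠ 0) : ser x (sinhS ν) ≠ 0 := by
  intro h
  have := congrArg (coeff 1) h
  rw [coeff_ser, coeff_one_sinhS] at this
  simp [hx] at this

lemma ser_sinhS_half (x : S) : ser x (sinhS (1 / 2)) = X * C x * ser x sigmaS := by
  rw [← X_mul_sigmaS, map_mul, ser_X]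

/-- The left-hand side minus the right-hand side of the PL-CDYBE as a formal power series, after
substituting `σ(ad_ω)` of the three arguments, where `σ(z) = sinh (z/2) / (z/2)`. -/
def plSeries (f : ℂ⟦X⟧) (μ : ℂ) (x y z : S) : S⟦X⟧ :=
  (ser x f * ser x sigmaS) * (ser y f * ser y sigmaS) * ser z sigmaS -
      del f y (-z) * (ser x (coshS (1 / 2)) * (ser y sigmaS * ser z sigmaS)) +
    ((ser y f * ser y sigmaS) * (ser z f * ser z sigmaS) * ser x sigmaS -
      del f z (-x) * (ser y (coshS (1 / 2)) * (ser z sigmaS * ser x sigmaS))) +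
    ((ser z f * ser z sigmaS) * (ser x f * ser x sigmaS) * ser y sigmaS -
      del f x (-y) * (ser z (coshS (1 / 2)) * (ser x sigmaS * ser y sigmaS))) -
    C (algebraMap ℂ S μ) * (ser x sigmaS * ser y sigmaS * ser z sigmaS)

lemma map_plSeries {S' : Type*} [CommRing S'] [Algebra ℂ S'] (g : S →ₐ[ℂ] S') (f : ℂ⟦X⟧)
    (μ : ℂ) (x y z : S) :
    PowerSeries.map (g : S →+* S') (plSeries f μ x y z) = plSeries f μ (g x) (g y) (g z) := by
  simp only [plSeries, map_sub, map_add, map_mul, map_ser, map_del, map_neg, map_C]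
  simp

lemma rescale_ser (c x : S) (f : ℂ⟦X⟧) : rescale c (ser x f) = ser (c * x) f := by
  ext k
  rw [coeff_rescale, coeff_ser, coeff_ser, mul_pow]
  ring

lemma rescale_del (c x y : S) (f : ℂ⟦X⟧) :
    rescale c (del f x y) = del f (c * x) (c * y) := by
  ext k
  rw [coeff_rescale, coeff_del, coeff_del, mul_left_comm (c ^ k),
    Finset.mul_sum]
  congr 1
  refine Finset.sum_congr rfl fun ij hij => ?_
  rw [← Finset.HasAntidiagonal.mem_antidiagonal.mp hij, mul_pow, mul_pow, pow_add]
  ring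

end Laws

end Formal

/-! ### The functional equation and the Riccati equation for formal series. -/

section Formal

/-- Here `c / s` is `ν coth`, `h / k` is `½ coth` of the half argument, `u` is the argument, `g = k
/ u` is `σ`, and `d` is a divided difference. The left-hand side is `g 0 * g 1 * g 2` times `F₀F₁ +
F₁F₂ + F₂F₀ + ∑ (hᵢ/kᵢ)(Fᵢ₊₁ + Fᵢ₊₂) - m`. As `F + h/k = c/s`, the second factor is the cyclic sum
of products of the `c/s` minus that of the `h/k`, minus `m`, that is `-n + q - m`. -/
lemma sum_mul_eq_of_coth {K : Type*} [Field K] {s c k h F u g d : Fin 3 → K} {n q m : K}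
    (hs : ∀ i, s i ≠ 0) (hk : ∀ i, k i ≠ 0) (hu : ∀ i, u i ≠ 0)
    (hF : ∀ i, F i * s i * k i = c i * k i - h i * s i) (hg : ∀ i, k i = u i * g i)
    (hd : ∀ i, u i * d i = -(F (i + 1) + F (i + 2)))
    (hsum : c 0 * c 1 * s 2 + c 1 * c 2 * s 0 + c 2 * c 0 * s 1 = -n * (s 0 * s 1 * s 2))
    (hsum' : h 0 * h 1 * k 2 + h 1 * h 2 * k 0 + h 2 * h 0 * k 1 = -q * (k 0 * k 1 * k 2))
    (hm : m = q - n) :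
    (F 0 * g 0) * (F 1 * g 1) * g 2 - d 0 * (h 0 * (g 1 * g 2)) +
      ((F 1 * g 1) * (F 2 * g 2) * g 0 - d 1 * (h 1 * (g 2 * g 0))) +
      ((F 2 * g 2) * (F 0 * g 0) * g 1 - d 2 * (h 2 * (g 0 * g 1))) -
      m * (g 0 * g 1 * g 2) = 0 := by
  have hF' : ∀ i, F i = c i / s i - h i / k i := fun i => by
    have := hs i; have := hk i
    field_simp
    linear_combination hF i
  have hg' : ∀ i, g i = k i / u i := fun i => by
    have := hu i
    field_simp
    linear_combination -hg i
  have hd' : ∀ i, d i = -(F (i + 1) + F (i + 2)) / u i := fun i => by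
    have := hu i
    field_simp
    linear_combination hd i
  have e1 : c 0 / s 0 * (c 1 / s 1) + c 1 / s 1 * (c 2 / s 2) + c 2 / s 2 * (c 0 / s 0) = -n := by
    have := hs 0; have := hs 1; have := hs 2
    field_simp
    linear_combination hsum
  have e2 : h 0 / k 0 * (h 1 / k 1) + h 1 / k 1 * (h 2 / k 2) + h 2 / k 2 * (h 0 / k 0) = -q := by
    have := hk 0; have := hk 1; have := hk 2
    field_simp
    linear_combination hsum'
  have hh : ∀ i, h i = h i / k i * k i := fun i => by have := hk i; field_simp
  have key : F 0 * F 1 + F 1 * F 2 + F 2 * F 0 + h 0 / k 0 * (F 1 + F 2) +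
      h 1 / k 1 * (F 2 + F 0) + h 2 / k 2 * (F 0 + F 1) - m = 0 := by
    rw [hF' 0, hF' 1, hF' 2, hm]
    linear_combination e1 - e2
  have d0 := hd' 0
  have d1 := hd' 1
  have d2 := hd' 2
  simp only [Fin.isValue, zero_add, Fin.reduceAdd] at d0 d1 d2
  rw [d0, d1, d2, hg' 0, hg' 1, hg' 2]
  have h0 := hu 0; have h1 := hu 1; have h2 := hu 2
  have k0 := hk 0; have k1 := hk 1; have k2 := hk 2
  field_simp at key ⊢
  linear_combination key

/-- The formal version of the condition `F = F_ν`. -/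
def IsFnuSeries (f : ℂ⟦X⟧) (ν : ℂ) : Prop :=
  f * sinhS ν * sinhS (1 / 2) = coshS ν * sinhS (1 / 2) - coshS (1 / 2) * sinhS ν

variable {S : Type*} [CommRing S] [Algebra ℂ S]

/-- `plSeries` has no denominators, but the argument through `coth` needs them. It takes place in
the fraction field of `S⟦X⟧`, where `x, y, z ≠ 0` makes all of them invertible. -/
theorem plSeries_eq_zero [IsDomain S] {f : ℂ⟦X⟧} {ν : ℂ} (hf : ∀ k, Even k → coeff k f = 0)
    (hν : IsFnuSeries f ν) {x y : S} (hx : x ≠ 0) (hy : y ≠ 0) (hz : -x - y ≠ 0) :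
    plSeries f (1 / 4 - ν ^ 2) x y (-x - y) = 0 := by
  set z := -x - y with hzdef
  let K := FractionRing S⟦X⟧
  have hinj : Function.Injective (algebraMap S⟦X⟧ K) := IsFractionRing.injective _ _
  apply hinj
  let w : Fin 3 → S := ![x, y, z]
  have hw : ∀ i, w i ≠ 0 := by intro i; fin_cases i <;> assumption
  have hne : ∀ p : S⟦X⟧, p ≠ 0 → algebraMap S⟦X⟧ K p ≠ 0 := fun p hp =>
    (map_ne_zero_iff _ hinj).mpr hp
  have := sum_mul_eq_of_coth (K := K)
    (s := fun i => algebraMap _ K (ser (w i) (sinhS ν)))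
    (c := fun i => algebraMap _ K (ser (w i) (coshS ν)))
    (k := fun i => algebraMap _ K (ser (w i) (sinhS (1 / 2))))
    (h := fun i => algebraMap _ K (ser (w i) (coshS (1 / 2))))
    (F := fun i => algebraMap _ K (ser (w i) f))
    (u := fun i => algebraMap _ K (X * C (w i)))
    (g := fun i => algebraMap _ K (ser (w i) sigmaS))
    (d := fun i => algebraMap _ K (del f (w (i + 1)) (-w (i + 2))))
    (n := algebraMap _ K (C (algebraMap ℂ S (ν ^ 2))))
    (q := algebraMap _ K (C (algebraMap ℂ S ((1 / 2) ^ 2))))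
    (m := algebraMap _ K (C (algebraMap ℂ S (1 / 4 - ν ^ 2))))
    (fun i => hne _ (ser_sinhS_ne_zero ν (hw i)))
    (fun i => hne _ (ser_sinhS_ne_zero _ (hw i)))
    (fun i => hne _ (mul_ne_zero X_ne_zero fun h => hw i (by simpa using congrArg (coeff 0) h)))
    (fun i => by simp only [← map_mul, ← map_sub]; rw [hν])
    (fun i => by rw [ser_sinhS_half, map_mul])
    (fun i => by
      -- The indices are cyclic modulo 3. The divided difference has denominator `w (i + 1) + w (i +
      -- 2) = -w i`, and its numerator is a sum because `f` is odd.
      have h := X_mul_del f (w (i + 1)) (-w (i + 2))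
      rw [ser_neg_of_odd hf] at h
      have e : w (i + 1) - -w (i + 2) = -w i := by
        fin_cases i <;> simp [w, hzdef] <;> ring
      rw [e, map_neg] at h
      rw [← map_mul, ← map_add, ← map_neg]
      congr 1
      linear_combination -h)
    (by
      have := congrArg (algebraMap _ K) (coth_sum_rule ν x y)
      simp only [map_add, map_mul, map_neg] at this
      exact this)
    (by
      have := congrArg (algebraMap _ K) (coth_sum_rule (1 / 2) x y)
      simp only [map_add, map_mul, map_neg] at this
      exact this)
    (by
      have : (1 / 4 - ν ^ 2 : ℂ) = (1 / 2) ^ 2 - ν ^ 2 := by norm_num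
      rw [this]; simp only [map_sub])
  rw [map_zero, ← this, plSeries]
  simp only [map_sub, map_add, map_mul]
  rfl

lemma coeff_del_self (f : ℂ⟦X⟧) : del f (1 : ℂ) 1 = d⁄dX ℂ f := by
  ext k
  rw [coeff_del, coeff_derivative]
  simp

lemma del_comm (f : ℂ⟦X⟧) (x y : S) : del f x y = del f y x := by
  ext k
  rw [coeff_del, coeff_del, ← Finset.Nat.sum_antidiagonal_swap]
  simp [mul_comm]

lemma X_mul_del_neg {f : ℂ⟦X⟧} (hf : ∀ k, Even k → coeff k f = 0) :
    X * del f (-1 : ℂ) 0 = f := by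
  have := X_mul_del f (-1 : ℂ) 0
  rw [sub_zero, map_neg, map_one, ser_neg_of_odd hf, ser_one_complex, ser_zero] at this
  have h0 : constantCoeff f = 0 := by simpa using hf 0 (by simp)
  rw [h0] at this
  simp only [map_zero, sub_zero] at this
  linear_combination -this

/-- The Riccati equation that the PL-CDYBE implies. -/
lemma riccati_of_plSeries {f : ℂ⟦X⟧} {μ : ℂ} (hf : ∀ k, Even k → coeff k f = 0)
    (h : plSeries f μ (1 : ℂ) (-1) 0 = 0) :
    sinhS (1 / 2) * (d⁄dX ℂ f + f ^ 2 + C μ) + 2 * coshS (1 / 2) * f = 0 := by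
  have h0 : constantCoeff f = 0 := by simpa using hf 0 (by simp)
  have hk : sinhS (1 / 2) ≠ 0 := fun h => by
    have := coeff_one_sinhS (1 / 2); rw [h] at this; simp at this
  have hsig := X_mul_sigmaS
  rw [plSeries, neg_zero, neg_neg, coeff_del_self, ser_neg_of_odd hf,
    ser_neg_of_even (fun _ => coeff_sigmaS_odd), ser_coshS_neg] at h
  simp only [ser_one_complex, ser_zero, h0, constantCoeff_sigmaS, constantCoeff_coshS,
    Algebra.algebraMap_self, RingHom.id_apply, map_one, map_zero] at h
  rw [del_comm f 0 (-1)] at h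
  have h1 := X_mul_del_neg hf
  -- At `(1, -1, 0)` the products containing `f(z)` vanish, two of the divided differences are `f /
  -- X`, and the third is `f'`. Multiplication by `-X²` turns `X * sigmaS` into `sinhS (1 / 2)` and
  -- leaves one such factor too many, which is cancelled.
  apply mul_left_cancel₀ hk
  rw [mul_zero, ← hsig]
  linear_combination (-X ^ 2 : ℂ⟦X⟧) * h - 2 * X * coshS (1 / 2) * sigmaS * h1

/-- The coefficient of `X ^ k` in the equation expresses `(k + 1) d_{k+1}` through `d_0, …, d_k`. -/
lemma eq_zero_of_derivative_eq_mul {d q : ℂ⟦X⟧} (h : d⁄dX ℂ d = d * q)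
    (h0 : constantCoeff d = 0) : d = 0 := by
  ext k
  induction k using Nat.strong_induction_on with
  | _ k ih =>
    cases k with
    | zero => simpa using h0
    | succ k =>
      have := congrArg (coeff k) h
      rw [coeff_derivative, coeff_mul, Finset.sum_eq_zero] at this
      · rw [map_zero]
        exact (mul_eq_zero.mp this).resolve_right (by exact_mod_cast k.succ_ne_zero)
      · intro ij hij
        have : ij.1 ≤ k := by
          rw [← Finset.HasAntidiagonal.mem_antidiagonal.mp hij]; exact Nat.le_add_right _ _
        rw [ih ij.1 (by omega), map_zero, zero_mul]

/-- The odd solutions of the Riccati equation. -/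
theorem isFnuSeries_of_riccati {f : ℂ⟦X⟧} {μ ν : ℂ}
    (hμ : μ = 1 / 4 - ν ^ 2)
    (h : sinhS (1 / 2) * (d⁄dX ℂ f + f ^ 2 + C μ) + 2 * coshS (1 / 2) * f = 0) :
    IsFnuSeries f ν := by
  set s := sinhS ν with hs
  set c := coshS ν with hc
  set k := sinhS (1 / 2) with hk
  set g := coshS (1 / 2) with hg
  have ds : d⁄dX ℂ s = c := derivative_sinhS ν
  have dc : d⁄dX ℂ c = C (ν ^ 2) * s := derivative_coshS ν
  have dk : d⁄dX ℂ k = g := derivative_sinhS _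
  have dg : d⁄dX ℂ g = C ((1 / 2) ^ 2) * k := derivative_coshS _
  set M := s * k with hM
  set N := c * k - g * s with hN
  set d := N - f * M with hd
  have hμ' : (C μ : ℂ⟦X⟧) = C ((1 / 2) ^ 2) - C (ν ^ 2) := by
    rw [← map_sub, hμ]; norm_num
  have hM0 : M ≠ 0 := by
    have : ∀ a, sinhS a ≠ 0 := fun a h => by
      have := coeff_one_sinhS a; rw [h] at this; simp at this
    exact mul_ne_zero (this _) (this _)
  -- Formally `d = (F_ν - f) M`. The difference of the Riccati equations of `F_ν` and `f` is linear
  -- in `F_ν - f`, and the factor `M` removes its poles: `d' = -f d`.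
  have hd0 : d = 0 := by
    apply eq_zero_of_derivative_eq_mul (q := -f)
    · apply mul_right_cancel₀ hM0
      rw [hd, hN, hM]
      simp only [map_sub, Derivation.leibniz, smul_eq_mul, ds, dc, dk, dg]
      rw [hμ'] at h
      linear_combination (-s ^ 2 * k) * h
    · simp [hd, hN, hM, hs, hk, constantCoeff_sinhS]
  rw [IsFnuSeries]
  linear_combination -hd0

end Formal

/-! ### Evaluation of formal series in a normed algebra. -/

section Evaluation

variable {S : Type*} [CommRing S] [Algebra ℂ S] {𝓑 : Type*} [NormedRing 𝓑] [NormedAlgebra ℂ 𝓑]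

/-- The value `b` of a formal power series at `t = 1`, after mapping the coefficients to a normed
algebra: the series of the images of the coefficients converges absolutely and has the sum `b`. -/
def Ev (e : S →ₐ[ℂ] 𝓑) (P : S⟦X⟧) (b : 𝓑) : Prop :=
  (Summable fun k => ‖e (coeff k P)‖) ∧ HasSum (fun k => e (coeff k P)) b

variable {e : S →ₐ[ℂ] 𝓑} {P Q : S⟦X⟧} {b c : 𝓑}

lemma Ev.unique (h : Ev e P b) (h' : Ev e P c) : b = c := h.2.unique h'.2

lemma Ev.add (h : Ev e P b) (h' : Ev e Q c) : Ev e (P + Q) (b + c) := by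
  refine ⟨(h.1.add h'.1).of_nonneg_of_le (fun _ => norm_nonneg _) fun k => ?_, ?_⟩
  · rw [map_add, map_add]; exact norm_add_le _ _
  · simpa only [map_add] using h.2.add h'.2

lemma Ev.neg (h : Ev e P b) : Ev e (-P) (-b) :=
  ⟨by simpa only [map_neg, norm_neg] using h.1, by simpa only [map_neg] using h.2.neg⟩

lemma Ev.sub (h : Ev e P b) (h' : Ev e Q c) : Ev e (P - Q) (b - c) := by
  rw [sub_eq_add_neg, sub_eq_add_neg]; exact h.add h'.neg

/-- This is the Cauchy product theorem, and the reason why `Ev` includes absolute convergence. -/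
lemma Ev.mul [CompleteSpace 𝓑] (h : Ev e P b) (h' : Ev e Q c) : Ev e (P * Q) (b * c) := by
  have hs := summable_norm_sum_mul_antidiagonal_of_summable_norm h.1 h'.1
  have he : ∀ k, e (coeff k (P * Q)) = ∑ kl ∈ Finset.HasAntidiagonal.antidiagonal k,
      e (coeff kl.1 P) * e (coeff kl.2 Q) := fun k => by
    rw [coeff_mul, map_sum]; simp only [map_mul]
  refine ⟨by simpa only [he] using hs, ?_⟩
  rw [← h.2.tsum_eq, ← h'.2.tsum_eq,
    tsum_mul_tsum_eq_tsum_sum_antidiagonal_of_summable_norm h.1 h'.1]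
  simp only [he]
  exact hs.of_norm.hasSum

lemma ev_C (s : S) : Ev e (C s) (e s) := by
  have h : ∀ k, k ≠ 0 → e (coeff k (C s : S⟦X⟧)) = 0 := fun k hk => by simp [coeff_C, hk]
  refine ⟨summable_of_ne_finset_zero (s := {0}) fun k hk => ?_, ?_⟩
  · rw [h k (by simpa using hk), norm_zero]
  · convert hasSum_single 0 h using 1
    simp

lemma ev_const (a : ℂ) : Ev e (C (algebraMap ℂ S a)) (algebraMap ℂ 𝓑 a) := by
  simpa using ev_C (e := e) (algebraMap ℂ S a)

end Evaluation

/-! ### Analytic functions near zero and their Taylor series. -/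

section Scalar

/-- The function `φ` is near `0` the sum of the power series `p`. -/
def Rep (φ : ℂ → ℂ) (p : ℂ⟦X⟧) : Prop :=
  ∀ᶠ z in 𝓝 (0 : ℂ), Ev (AlgHom.id ℂ ℂ) (ser z p) (φ z)

variable {φ ψ : ℂ → ℂ} {p q : ℂ⟦X⟧}

lemma Rep.mul (h : Rep φ p) (h' : Rep ψ q) : Rep (fun z => φ z * ψ z) (p * q) := by
  filter_upwards [h, h'] with z h h'
  rw [map_mul]; exact h.mul h'

lemma Rep.add (h : Rep φ p) (h' : Rep ψ q) : Rep (fun z => φ z + ψ z) (p + q) := by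
  filter_upwards [h, h'] with z h h'
  rw [map_add]; exact h.add h'

lemma Rep.sub (h : Rep φ p) (h' : Rep ψ q) : Rep (fun z => φ z - ψ z) (p - q) := by
  filter_upwards [h, h'] with z h h'
  rw [map_sub]; exact h.sub h'

lemma rep_const (a : ℂ) : Rep (fun _ => a) (C a) := by
  refine Eventually.of_forall fun z => ?_
  rw [ser_C]
  exact ev_const a

lemma rep_iff_hasSum : Rep φ p ↔ ∀ᶠ z in 𝓝 (0 : ℂ), HasSum (fun k => coeff k p * z ^ k) (φ z) := by
  refine eventually_congr (Eventually.of_forall fun z => ?_)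
  simp only [Ev, coeff_ser, AlgHom.coe_id, id_eq, Algebra.algebraMap_self, RingHom.id_apply]
  exact ⟨fun h => h.2, fun h => ⟨h.summable.norm, h⟩⟩

lemma Rep.hasFPowerSeriesAt (h : Rep φ p) :
    HasFPowerSeriesAt φ (FormalMultilinearSeries.ofScalars ℂ fun k => coeff k p) 0 := by
  rw [hasFPowerSeriesAt_iff]
  filter_upwards [rep_iff_hasSum.mp h] with z hz
  simpa [mul_comm] using hz

lemma Rep.congr (h : Rep φ p) (hφ : ∀ᶠ z in 𝓝 (0 : ℂ), φ z = ψ z) : Rep ψ p := by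
  filter_upwards [h, hφ] with z h1 h2
  rwa [← h2]

lemma Rep.unique (h : Rep φ p) (h' : Rep φ q) : p = q := by
  have := h.hasFPowerSeriesAt.eq_formalMultilinearSeries h'.hasFPowerSeriesAt
  rw [FormalMultilinearSeries.ofScalars_series_eq_iff] at this
  ext k
  exact congrFun this k

lemma Rep.eventually_eq (h : Rep φ p) (h' : Rep ψ p) : ∀ᶠ z in 𝓝 (0 : ℂ), φ z = ψ z := by
  filter_upwards [h, h'] with z h1 h2
  exact h1.unique h2

/-- The Taylor series at `0`. -/
def taylor (F : ℂ → ℂ) : ℂ⟦X⟧ := mk fun k => iteratedDeriv k F 0 / (k.factorial : ℂ)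

lemma rep_taylor {F : ℂ → ℂ} (hF : AnalyticAt ℂ F 0) : Rep F (taylor F) := by
  rw [rep_iff_hasSum]
  filter_upwards [hasFPowerSeriesAt_iff.mp hF.hasFPowerSeriesAt] with z hz
  simpa [taylor, mul_comm] using hz

lemma rep_expS (ν : ℂ) : Rep (fun z => Complex.exp (ν * z)) (expS ν) := by
  rw [rep_iff_hasSum]
  refine Eventually.of_forall fun z => ?_
  have := NormedSpace.expSeries_div_hasSum_exp (ν * z)
  rw [← Complex.exp_eq_exp_ℂ] at this
  have hc : ∀ k, coeff k (expS ν) * z ^ k = (ν * z) ^ k / (k.factorial : ℂ) := fun k => by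
    rw [expS, coeff_rescale, coeff_exp, mul_pow]
    simp
    ring
  simpa only [hc] using this

/-- The function `z ↦ sinh (ν z) / ν`, which is `z` for `ν = 0`. -/
def sinhDiv (ν z : ℂ) : ℂ := if ν = 0 then z else Complex.sinh (ν * z) / ν

lemma rep_X : Rep (fun z => z) X := by
  rw [rep_iff_hasSum]
  refine Eventually.of_forall fun z => ?_
  convert hasSum_single 1 fun k hk => ?_ using 1
  · simp
  · simp [coeff_X, hk]

lemma rep_sinhS (ν : ℂ) : Rep (sinhDiv ν) (sinhS ν) := by
  unfold sinhS
  split_ifs with h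
  · refine rep_X.congr (Eventually.of_forall fun z => ?_)
    simp [sinhDiv, h]
  · refine ((rep_const _).mul ((rep_expS ν).sub (rep_expS (-ν)))).congr
      (Eventually.of_forall fun z => ?_)
    simp only [sinhDiv, h, if_false, Complex.sinh, neg_mul]
    field_simp

lemma rep_coshS (ν : ℂ) : Rep (fun z => Complex.cosh (ν * z)) (coshS ν) := by
  refine ((rep_const _).mul ((rep_expS ν).add (rep_expS (-ν)))).congr
    (Eventually.of_forall fun z => ?_)
  simp only [Complex.cosh, neg_mul]
  ring

lemma nuCoth_eq (ν z : ℂ) : nuCoth ν z = Complex.cosh (ν * z) / sinhDiv ν z := by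
  unfold nuCoth sinhDiv
  split_ifs with h
  · simp [h]
  · field_simp

lemma sinhDiv_zero (ν : ℂ) : sinhDiv ν 0 = 0 := by simp [sinhDiv]

lemma eventually_sinhDiv_ne_zero (ν : ℂ) : ∀ᶠ z in 𝓝[≠] (0 : ℂ), sinhDiv ν z ≠ 0 := by
  have h : HasDerivAt (sinhDiv ν) 1 0 := by
    unfold sinhDiv
    split_ifs with h
    · exact hasDerivAt_id 0
    · have := ((hasDerivAt_id (0 : ℂ)).const_mul ν).csinh.div_const ν
      simpa [h] using this
  exact h.eventually_ne one_ne_zero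

/-- Clearing denominators gives an identity between analytic functions, hence between their series.
The denominators vanish near `0` only at `0` itself, where `F` and `F_ν` are both `0`. -/
lemma eventually_eq_Fnu_iff {F : ℂ → ℂ} (hF : AnalyticAt ℂ F 0) (h0 : F 0 = 0) (ν : ℂ) :
    (∀ᶠ z in 𝓝 (0 : ℂ), F z = Fnu ν z) ↔ IsFnuSeries (taylor F) ν := by
  have hl := ((rep_taylor hF).mul (rep_sinhS ν)).mul (rep_sinhS (1 / 2))
  have hr := ((rep_coshS ν).mul (rep_sinhS (1 / 2))).sub ((rep_coshS (1 / 2)).mul (rep_sinhS ν))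
  have h1 : IsFnuSeries (taylor F) ν ↔ ∀ᶠ z in 𝓝 (0 : ℂ),
      F z * sinhDiv ν z * sinhDiv (1 / 2) z = Complex.cosh (ν * z) * sinhDiv (1 / 2) z -
        Complex.cosh (1 / 2 * z) * sinhDiv ν z := by
    constructor
    · intro h
      rw [IsFnuSeries] at h
      rw [h] at hl
      exact hl.eventually_eq hr
    · intro h
      exact (hl.congr h).unique hr
  rw [h1]
  have hn := eventually_nhdsWithin_iff.mp
    ((eventually_sinhDiv_ne_zero ν).and (eventually_sinhDiv_ne_zero (1 / 2)))
  refine eventually_congr ?_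
  filter_upwards [hn] with z hz
  by_cases hz0 : z = 0
  · subst hz0
    simp [h0, Fnu, sinhDiv_zero]
  · obtain ⟨hz1, hz2⟩ := hz hz0
    rw [Fnu, if_neg hz0, nuCoth_eq, nuCoth_eq]
    rw [div_sub_div _ _ hz1 hz2, eq_div_iff (mul_ne_zero hz1 hz2)]
    constructor <;> intro h <;> linear_combination h

lemma coeff_taylor_even {F : ℂ → ℂ} (hF : AnalyticAt ℂ F 0)
    (hodd : ∀ᶠ z in 𝓝 (0 : ℂ), F (-z) = -F z) : ∀ k, Even k → coeff k (taylor F) = 0 := by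
  intro k hk
  have h1 : Rep (fun z => F (-z)) (rescale (-1) (taylor F)) := by
    have ht : Tendsto (fun z : ℂ => -z) (𝓝 0) (𝓝 0) := by
      simpa using (continuous_neg.tendsto (0 : ℂ))
    filter_upwards [ht.eventually (rep_taylor hF)] with z hz
    rw [ser_rescale]
    simpa using hz
  have h2 : Rep (fun z => 0 - F z) (0 - taylor F) := by
    have := (rep_const 0).sub (rep_taylor hF)
    simpa only [map_zero] using this
  have h3 := (h1.congr (hodd.mono fun z hz => by rw [hz, zero_sub])).unique h2
  have h4 := congrArg (coeff k) h3
  rw [coeff_rescale, hk.neg_one_pow, one_mul, map_sub, map_zero, zero_sub] at h4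
  linear_combination h4 / 2

end Scalar

/-! ### Power series and their divided differences in a Banach algebra. -/

section Calculus

variable {𝓐 : Type*} [NormedRing 𝓐]

variable {f : ℂ⟦X⟧} {q q' C : ℝ}

/-- The powers of `a` are bounded by `C qᵏ`. -/
def PowBound (C q : ℝ) (a : 𝓐) : Prop := ∀ k : ℕ, ‖a ^ k‖ ≤ C * q ^ k

lemma PowBound.nonneg {a : 𝓐} (h : PowBound C q a) : 0 ≤ C := by
  have := (norm_nonneg _).trans (h 0)
  simpa using this

lemma PowBound.of_le {a : 𝓐} {C' : ℝ} (h : PowBound C q a) (hq : 0 ≤ q) (hC : C ≤ C') :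
    PowBound C' q a := fun k => (h k).trans (by gcongr)

lemma powBound_of_norm_le {a : 𝓐} (h : ‖a‖ ≤ q) : PowBound (max 1 ‖(1 : 𝓐)‖) q a := by
  intro k
  have hq : 0 ≤ q := (norm_nonneg _).trans h
  rcases Nat.eq_zero_or_pos k with rfl | hk
  · simp
  · calc ‖a ^ k‖ ≤ ‖a‖ ^ k := norm_pow_le' a hk
      _ ≤ q ^ k := by gcongr
      _ ≤ _ := le_mul_of_one_le_left (by positivity) (le_max_left _ _)

lemma eventually_powBound_of_norm_lt {a : 𝓐} (ha : ‖a‖ < q) :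
    ∀ᶠ N in 𝓝 a, PowBound (max 1 ‖(1 : 𝓐)‖) q N := by
  filter_upwards [continuous_norm.continuousAt.eventually (gt_mem_nhds ha)] with N hN
  exact powBound_of_norm_le hN.le

variable [NormedAlgebra ℂ 𝓐]

/-- The sum of the power series `f` at an element of a normed algebra. -/
def psum (f : ℂ⟦X⟧) (a : 𝓐) : 𝓐 := ∑' k, coeff k f • a ^ k

/-- The terms of the divided difference of the power series `f`. -/
def pdelTerm (f : ℂ⟦X⟧) (a b : 𝓐) (k : ℕ) : 𝓐 →L[ℂ] 𝓐 :=
  coeff (k + 1) f • ∑ ij ∈ Finset.HasAntidiagonal.antidiagonal k,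
    ContinuousLinearMap.mulLeftRight ℂ 𝓐 (a ^ ij.1) (b ^ ij.2)

/-- The divided difference of the power series `f` at `a`, `b`: a linear map which sends `a - b` to
`f(a) - f(b)`. -/
def pdel (f : ℂ⟦X⟧) (a b : 𝓐) : 𝓐 →L[ℂ] 𝓐 := ∑' k, pdelTerm f a b k

/-- The coefficients of `f` are bounded by a multiple of `q⁻ᵏ`. -/
def CoeffBound (f : ℂ⟦X⟧) (q : ℝ) : Prop := ∃ C, ∀ k, ‖coeff k f‖ * q ^ k ≤ C

lemma summable_coeff_mul_pow (hf : CoeffBound f q') (hq : 0 ≤ q) (hqq : q < q') :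
    Summable fun k => ‖coeff k f‖ * q ^ k := by
  obtain ⟨K, hK⟩ := hf
  have hq' : 0 < q' := hq.trans_lt hqq
  have hr : q / q' < 1 := (div_lt_one hq').mpr hqq
  refine ((summable_geometric_of_lt_one (div_nonneg hq hq'.le) hr).mul_left K).of_nonneg_of_le
    (fun k => by positivity) fun k => ?_
  rw [div_pow, mul_div_assoc', le_div_iff₀ (by positivity)]
  nlinarith [hK k, pow_nonneg hq k]

lemma summable_coeff_succ_mul_pow (hf : CoeffBound f q') (hq : 0 ≤ q) (hqq : q < q') :
    Summable fun k : ℕ => ‖coeff (k + 1) f‖ * ((k + 1) * q ^ k) := by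
  obtain ⟨K, hK⟩ := hf
  have hq' : 0 < q' := hq.trans_lt hqq
  have hr0 : 0 ≤ q / q' := div_nonneg hq hq'.le
  have hr : ‖q / q'‖ < 1 := by
    rw [Real.norm_of_nonneg hr0]; exact (div_lt_one hq').mpr hqq
  have h1 := (summable_pow_mul_geometric_of_norm_lt_one 1 hr).add
    (summable_pow_mul_geometric_of_norm_lt_one 0 hr)
  refine (h1.mul_left (K / q')).of_nonneg_of_le (fun k => by positivity) fun k => ?_
  have e : K / q' * ((k : ℝ) ^ 1 * (q / q') ^ k + (k : ℝ) ^ 0 * (q / q') ^ k)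
      = K * ((k + 1) * q ^ k) / q' ^ (k + 1) := by
    rw [div_pow]; field_simp; ring
  rw [e, le_div_iff₀ (by positivity)]
  have h2 : 0 ≤ ((k : ℝ) + 1) * q ^ k := by positivity
  nlinarith [hK (k + 1)]

lemma PowBound.summable {a : 𝓐} (ha : PowBound C q a) (hf : CoeffBound f q') (hq : 0 ≤ q)
    (hqq : q < q') : Summable fun k => ‖coeff k f • a ^ k‖ := by
  refine ((summable_coeff_mul_pow hf hq hqq).mul_left C).of_nonneg_of_le
    (fun _ => norm_nonneg _) fun k => ?_
  rw [norm_smul]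
  nlinarith [ha k, norm_nonneg (coeff k f)]

lemma PowBound.hasSum_psum [CompleteSpace 𝓐] {a : 𝓐} (ha : PowBound C q a)
    (hf : CoeffBound f q') (hq : 0 ≤ q) (hqq : q < q') :
    HasSum (fun k => coeff k f • a ^ k) (psum f a) :=
  (ha.summable hf hq hqq).of_norm.hasSum

lemma PowBound.ev_ser {S : Type*} [CommRing S] [Algebra ℂ S] [CompleteSpace 𝓐] {e : S →ₐ[ℂ] 𝓐}
    {x : S} (ha : PowBound C q (e x)) (hf : CoeffBound f q') (hq : 0 ≤ q) (hqq : q < q') :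
    Ev e (ser x f) (psum f (e x)) := by
  have h : ∀ k, e (coeff k (ser x f)) = coeff k f • (e x) ^ k := fun k => by
    rw [coeff_ser, map_mul, map_pow, AlgHom.commutes, Algebra.smul_def]
  unfold Ev
  simp only [h]
  exact ⟨ha.summable hf hq hqq, ha.hasSum_psum hf hq hqq⟩

lemma norm_sum_antidiagonal_le {E : Type*} [SeminormedAddCommGroup E] {g : ℕ × ℕ → E} {K : ℝ}
    (hg : ∀ i j, ‖g (i, j)‖ ≤ K * (q ^ i * q ^ j)) (k : ℕ) :
    ‖∑ ij ∈ Finset.HasAntidiagonal.antidiagonal k, g ij‖ ≤ K * ((k + 1) * q ^ k) := by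
  calc _ ≤ ∑ ij ∈ Finset.HasAntidiagonal.antidiagonal k, K * q ^ k := by
        refine norm_sum_le_of_le _ fun ij hij => ?_
        rw [← Finset.HasAntidiagonal.mem_antidiagonal.mp hij, pow_add]
        exact hg ij.1 ij.2
    _ = _ := by
        rw [Finset.sum_const, Finset.Nat.card_antidiagonal, nsmul_eq_mul]
        push_cast
        ring

lemma PowBound.norm_pdelTerm_le {a b : 𝓐} (ha : PowBound C q a) (hb : PowBound C q b)
    (hq : 0 ≤ q) (k : ℕ) :
    ‖pdelTerm f a b k‖ ≤ C ^ 2 * (‖coeff (k + 1) f‖ * ((k + 1) * q ^ k)) := by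
  have h : ∀ i j, ‖ContinuousLinearMap.mulLeftRight ℂ 𝓐 (a ^ i) (b ^ j)‖
      ≤ C ^ 2 * (q ^ i * q ^ j) := fun i j => by
    refine (ContinuousLinearMap.opNorm_mulLeftRight_apply_apply_le ℂ 𝓐 _ _).trans ?_
    have hC := ha.nonneg
    calc ‖a ^ i‖ * ‖b ^ j‖ ≤ (C * q ^ i) * (C * q ^ j) := by
          gcongr
          exacts [ha i, hb j]
      _ = _ := by ring
  rw [pdelTerm, norm_smul]
  calc _ ≤ ‖coeff (k + 1) f‖ * (C ^ 2 * ((k + 1) * q ^ k)) := by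
        gcongr
        exact norm_sum_antidiagonal_le (g := fun ij =>
          ContinuousLinearMap.mulLeftRight ℂ 𝓐 (a ^ ij.1) (b ^ ij.2)) h k
    _ = _ := by ring

lemma PowBound.hasSum_pdel [CompleteSpace 𝓐] {a b : 𝓐} (ha : PowBound C q a)
    (hb : PowBound C q b) (hf : CoeffBound f q') (hq : 0 ≤ q) (hqq : q < q') :
    HasSum (pdelTerm f a b) (pdel f a b) :=
  (((summable_coeff_succ_mul_pow hf hq hqq).mul_left (C ^ 2)).of_norm_bounded
    (ha.norm_pdelTerm_le hb hq)).hasSum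

lemma PowBound.exists_ev_del {S : Type*} [CommRing S] [Algebra ℂ S] [CompleteSpace 𝓐]
    {e : S →ₐ[ℂ] 𝓐} {x y : S} (hx : PowBound C q (e x)) (hy : PowBound C q (e y))
    (hf : CoeffBound f q') (hq : 0 ≤ q) (hqq : q < q') : ∃ b, Ev e (del f x y) b := by
  have h : Summable fun k => ‖e (coeff k (del f x y))‖ := by
    refine ((summable_coeff_succ_mul_pow hf hq hqq).mul_left (C ^ 2)).of_nonneg_of_le
      (fun _ => norm_nonneg _) fun k => ?_
    have hg : ∀ i j, ‖e x ^ i * e y ^ j‖ ≤ C ^ 2 * (q ^ i * q ^ j) := fun i j => by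
      have hC := hx.nonneg
      calc ‖e x ^ i * e y ^ j‖ ≤ ‖e x ^ i‖ * ‖e y ^ j‖ := norm_mul_le _ _
        _ ≤ (C * q ^ i) * (C * q ^ j) := by
          gcongr
          exacts [hx i, hy j]
        _ = _ := by ring
    rw [coeff_del, map_mul, AlgHom.commutes, ← Algebra.smul_def, norm_smul, map_sum]
    simp only [map_mul, map_pow]
    calc _ ≤ ‖coeff (k + 1) f‖ * (C ^ 2 * ((k + 1) * q ^ k)) := by
          gcongr
          exact norm_sum_antidiagonal_le (g := fun ij => e x ^ ij.1 * e y ^ ij.2) hg k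
      _ = _ := by ring
  exact ⟨_, h, h.of_norm.hasSum⟩

/-- The sum of `a ^ i * (a - b) * b ^ j` over `i + j = k` telescopes even when `a` and `b` do not
commute. -/
lemma pdelTerm_apply_sub (a b : 𝓐) (k : ℕ) :
    pdelTerm f a b k (a - b) = coeff (k + 1) f • a ^ (k + 1) - coeff (k + 1) f • b ^ (k + 1) := by
  rw [pdelTerm, ← smul_sub, _root_.smul_apply]
  congr 1
  rw [Finset.Nat.sum_antidiagonal_eq_sum_range_succ
    (f := fun i j => ContinuousLinearMap.mulLeftRight ℂ 𝓐 (a ^ i) (b ^ j))]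
  induction k with
  | zero => simp
  | succ k ih =>
    rw [Finset.sum_range_succ, _root_.add_apply]
    have : ∀ i ∈ Finset.range (k + 1),
        ContinuousLinearMap.mulLeftRight ℂ 𝓐 (a ^ i) (b ^ (k + 1 - i)) =
          (ContinuousLinearMap.mul ℂ 𝓐).flip b ∘L
            ContinuousLinearMap.mulLeftRight ℂ 𝓐 (a ^ i) (b ^ (k - i)) := fun i hi => by
      ext v
      have : k + 1 - i = k - i + 1 := by
        have := Finset.mem_range.mp hi; omega
      rw [this]
      simp [pow_succ, mul_assoc]
    rw [Finset.sum_congr rfl this, ← ContinuousLinearMap.comp_finsetSum,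
      ContinuousLinearMap.comp_apply, ih]
    simp [pow_succ]
    noncomm_ring

lemma PowBound.pdel_apply_sub [CompleteSpace 𝓐] {a b : 𝓐} (ha : PowBound C q a)
    (hb : PowBound C q b) (hf : CoeffBound f q') (hq : 0 ≤ q) (hqq : q < q') :
    pdel f a b (a - b) = psum f a - psum f b := by
  have h1 := (ha.hasSum_pdel hb hf hq hqq).mapL (ContinuousLinearMap.apply ℂ 𝓐 (a - b))
  simp only [ContinuousLinearMap.apply_apply, pdelTerm_apply_sub] at h1
  have h2 := (ha.hasSum_psum hf hq hqq).sub (hb.hasSum_psum hf hq hqq)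
  rw [← hasSum_nat_add_iff' 1] at h2
  simp only [Finset.range_one, Finset.sum_singleton, pow_zero, sub_self, sub_zero] at h2
  exact h1.unique h2

lemma tendsto_pdel [CompleteSpace 𝓐] {α : Type*} {l : Filter α} {N : α → 𝓐} {a : 𝓐}
    (hN : Tendsto N l (𝓝 a)) (hb : ∀ᶠ N in 𝓝 a, PowBound C q N)
    (hf : CoeffBound f q') (hq : 0 ≤ q) (hqq : q < q') :
    Tendsto (fun t => pdel f (N t) a) l (𝓝 (pdel f a a)) := by
  refine tendsto_tsum_of_dominated_convergence
    ((summable_coeff_succ_mul_pow hf hq hqq).mul_left (C ^ 2)) (fun k => ?_) ?_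
  · unfold pdelTerm
    refine tendsto_const_nhds.smul (tendsto_finsetSum _ fun ij _ => ?_)
    have : Continuous fun x : 𝓐 => ContinuousLinearMap.mulLeftRight ℂ 𝓐 (x ^ ij.1) (a ^ ij.2) := by
      fun_prop
    exact (this.tendsto a).comp hN
  · filter_upwards [hN.eventually hb] with t ht k
    exact ht.norm_pdelTerm_le hb.self_of_nhds hq k

/-- The derivative of a power series along a curve in a Banach algebra. -/
theorem tendsto_psum_slope [CompleteSpace 𝓐] {N : ℂ → 𝓐} {a v : 𝓐}
    (hv : Tendsto (fun t : ℂ => t⁻¹ • (N t - a)) (𝓝[≠] 0) (𝓝 v))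
    (hN : Tendsto N (𝓝[≠] 0) (𝓝 a)) (hb : ∀ᶠ N in 𝓝 a, PowBound C q N)
    (hf : CoeffBound f q') (hq : 0 ≤ q) (hqq : q < q') :
    Tendsto (fun t : ℂ => t⁻¹ • (psum f (N t) - psum f a)) (𝓝[≠] 0) (𝓝 (pdel f a a v)) := by
  -- The slope of `psum f (N t)` is exactly `pdel f (N t) a` applied to the slope of `N`, so joint
  -- continuity of evaluation suffices.
  have h1 : Tendsto (fun t => pdel f (N t) a (t⁻¹ • (N t - a))) (𝓝[≠] 0) (𝓝 (pdel f a a v)) :=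
    (isBoundedBilinearMap_apply.continuous.tendsto (pdel f a a, v)).comp
      ((tendsto_pdel hN hb hf hq hqq).prodMk_nhds hv)
  refine h1.congr' ?_
  filter_upwards [hN.eventually hb] with t ht
  rw [map_smul, ht.pdel_apply_sub hb.self_of_nhds hf hq hqq]

/-- Gelfand's formula, locally uniformly. -/
lemma eventually_powBound [CompleteSpace 𝓐] {a : 𝓐} (hq : 0 < q)
    (ha : spectralRadius ℂ a < ENNReal.ofReal q) : ∃ C, ∀ᶠ N in 𝓝 a, PowBound C q N := by
  -- Gelfand's formula is used for a single exponent `m`, since `‖N ^ m‖ < q ^ m` is an open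
  -- condition on `N`.
  obtain ⟨m, hm0, hm⟩ : ∃ m : ℕ, 0 < m ∧ ‖a ^ m‖ < q ^ m := by
    have h1 := (spectrum.pow_nnnorm_pow_one_div_tendsto_nhds_spectralRadius a).eventually
      (gt_mem_nhds ha)
    obtain ⟨m, hm, hm0⟩ := (h1.and (eventually_gt_atTop 0)).exists
    refine ⟨m, hm0, ?_⟩
    have hm' : (0 : ℝ) < m := by exact_mod_cast hm0
    have h2 := ENNReal.rpow_lt_rpow hm hm'
    rw [← ENNReal.rpow_mul, one_div, inv_mul_cancel₀ hm'.ne', ENNReal.rpow_one,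
      ENNReal.rpow_natCast, ← ENNReal.ofReal_pow hq.le] at h2
    rw [← enorm_eq_nnnorm, ← ofReal_norm, ENNReal.ofReal_lt_ofReal_iff (by positivity)] at h2
    exact h2
  -- `K` bounds `‖N‖` near `a`. Since `K / q ≥ 1`, the remainder power `k % m < m` costs at most the
  -- fixed factor `(K / q) ^ m`.
  set K := max q (‖a‖ + 1) with hK
  set K₁ := max 1 ‖(1 : 𝓐)‖ with hK₁
  have hK1 : 1 ≤ K / q := (one_le_div hq).mpr (le_max_left _ _)
  have hK₁0 : 0 ≤ K₁ := zero_le_one.trans (le_max_left _ _)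
  refine ⟨K₁ * (K₁ * (K / q) ^ m), ?_⟩
  have e1 : ∀ᶠ N in 𝓝 a, ‖N‖ < ‖a‖ + 1 :=
    continuous_norm.continuousAt.eventually (gt_mem_nhds (lt_add_one _))
  have e2 : ∀ᶠ N in 𝓝 a, ‖N ^ m‖ < q ^ m :=
    (continuous_norm.comp (continuous_pow m)).continuousAt.eventually (gt_mem_nhds hm)
  filter_upwards [e1, e2] with N h1 h2 k
  have b1 := powBound_of_norm_le (h1.le.trans (le_max_right q _)) (k % m)
  have b2 := powBound_of_norm_le h2.le (k / m)
  have b3 : K ^ (k % m) ≤ q ^ (k % m) * (K / q) ^ m := by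
    have : K ^ (k % m) = q ^ (k % m) * (K / q) ^ (k % m) := by
      rw [div_pow]; field_simp
    rw [this]
    gcongr
    exact (Nat.mod_lt k hm0).le
  have ek : k = m * (k / m) + k % m := (Nat.div_add_mod k m).symm
  calc ‖N ^ k‖ = ‖(N ^ m) ^ (k / m) * N ^ (k % m)‖ := by
        rw [← pow_mul, ← pow_add, ← ek]
    _ ≤ ‖(N ^ m) ^ (k / m)‖ * ‖N ^ (k % m)‖ := norm_mul_le _ _
    _ ≤ (K₁ * (q ^ m) ^ (k / m)) * (K₁ * (q ^ (k % m) * (K / q) ^ m)) := by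
        gcongr
        exact b1.trans (by gcongr)
    _ = K₁ * (K₁ * (K / q) ^ m) * q ^ (m * (k / m) + k % m) := by
        rw [pow_add, pow_mul]; ring
    _ = _ := by rw [← ek]

end Calculus

/-! ### Entire series. -/

section Entire

/-- The coefficients of `f` decay faster than every geometric sequence. -/
def IsEntire (f : ℂ⟦X⟧) : Prop := ∀ q : ℝ, 0 < q → CoeffBound f q

variable {f g : ℂ⟦X⟧}

lemma IsEntire.add (hf : IsEntire f) (hg : IsEntire g) : IsEntire (f + g) := fun q hq => by
  obtain ⟨C, hC⟩ := hf q hq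
  obtain ⟨D, hD⟩ := hg q hq
  refine ⟨C + D, fun k => ?_⟩
  rw [map_add]
  have := norm_add_le (coeff k f) (coeff k g)
  nlinarith [hC k, hD k, pow_pos hq k]

lemma IsEntire.C_mul (hf : IsEntire f) (a : ℂ) : IsEntire (C a * f) := fun q hq => by
  obtain ⟨K, hK⟩ := hf q hq
  refine ⟨‖a‖ * K, fun k => ?_⟩
  rw [coeff_C_mul, norm_mul, mul_assoc]
  exact mul_le_mul_of_nonneg_left (hK k) (norm_nonneg _)

lemma isEntire_expS (ν : ℂ) : IsEntire (expS ν) := fun q hq => by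
  refine ⟨Real.exp (‖ν‖ * q), fun k => ?_⟩
  rw [expS, coeff_rescale, coeff_exp]
  have h := Real.pow_div_factorial_le_exp (‖ν‖ * q) (by positivity) k
  convert h using 1
  simp [mul_pow]
  ring

lemma isEntire_coshS (ν : ℂ) : IsEntire (coshS ν) :=
  ((isEntire_expS ν).add (isEntire_expS (-ν))).C_mul _

lemma isEntire_sigmaS : IsEntire sigmaS := fun q hq => by
  have h : IsEntire (sinhS (1 / 2)) := by
    have e : sinhS (1 / 2) = C (1 / (2 * (1 / 2))) * (expS (1 / 2) + C (-1) * expS (-(1 / 2))) := by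
      rw [sinhS, if_neg (by norm_num), map_neg, map_one]
      ring
    rw [e]
    exact ((isEntire_expS _).add ((isEntire_expS _).C_mul _)).C_mul _
  obtain ⟨K, hK⟩ := h q hq
  refine ⟨K / q, fun k => ?_⟩
  rw [sigmaS, divX, coeff_mk, le_div_iff₀ hq, mul_assoc, ← pow_succ]
  exact hK (k + 1)

lemma isEntire_exp : IsEntire (exp ℂ) := by
  have := isEntire_expS 1
  rwa [expS, rescale_one] at this

variable {𝓐 : Type*} [NormedRing 𝓐] [NormedAlgebra ℂ 𝓐] [CompleteSpace 𝓐]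

lemma IsEntire.hasSum_psum (hf : IsEntire f) (a : 𝓐) :
    HasSum (fun k => coeff k f • a ^ k) (psum f a) :=
  (powBound_of_norm_le le_rfl).hasSum_psum (hf (‖a‖ + 1) (by positivity)) (norm_nonneg a)
    (lt_add_one _)

lemma IsEntire.ev_ser {S : Type*} [CommRing S] [Algebra ℂ S] (hf : IsEntire f) (e : S →ₐ[ℂ] 𝓐)
    (x : S) : Ev e (ser x f) (psum f (e x)) :=
  (powBound_of_norm_le le_rfl).ev_ser (hf (‖e x‖ + 1) (by positivity)) (norm_nonneg _)
    (lt_add_one _)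

lemma psum_exp (a : 𝓐) : psum (exp ℂ) a = NormedSpace.exp a := by
  refine (isEntire_exp.hasSum_psum a).unique ?_
  have := NormedSpace.exp_series_hasSum_exp' (𝕂 := ℂ) a
  simpa using this

end Entire

/-! ### A Banach algebra structure on endomorphisms. -/

section EndNorm

variable (V : Type*) [AddCommGroup V] [Module ℂ V] [FiniteDimensional ℂ V]

open scoped Matrix.Norms.Operator in
/-- A norm on the algebra of endomorphisms of a finite-dimensional complex vector space. -/
abbrev endNormedRing : NormedRing (Module.End ℂ V) :=
  NormedRing.induced (Module.End ℂ V)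
    (Matrix (Fin (Module.finrank ℂ V)) (Fin (Module.finrank ℂ V)) ℂ)
    (LinearMap.toMatrixAlgEquiv (Module.finBasis ℂ V)) (AlgEquiv.injective _)

attribute [local instance] endNormedRing

open scoped Matrix.Norms.Operator in
/-- The norm on the algebra of endomorphisms is compatible with scalars. -/
abbrev endNormedAlgebra : NormedAlgebra ℂ (Module.End ℂ V) :=
  NormedAlgebra.induced ℂ (Module.End ℂ V)
    (Matrix (Fin (Module.finrank ℂ V)) (Fin (Module.finrank ℂ V)) ℂ)
    (LinearMap.toMatrixAlgEquiv (Module.finBasis ℂ V))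

attribute [local instance] endNormedAlgebra

lemma completeSpace_end : CompleteSpace (Module.End ℂ V) :=
  FiniteDimensional.complete ℂ _

end EndNorm

attribute [local instance] endNormedRing endNormedAlgebra completeSpace_end

/-- `𝓑` need not be commutative, so the polynomials are evaluated in the commutative subalgebra
generated by the `t i`. -/
lemma exists_algHom_of_commute {σ 𝓑 : Type*} [Ring 𝓑] [Algebra ℂ 𝓑] (t : σ → 𝓑)
    (h : ∀ i j, t i * t j = t j * t i) :
    ∃ e : MvPolynomial σ ℂ →ₐ[ℂ] 𝓑, ∀ i, e (MvPolynomial.X i) = t i := by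
  let A := Algebra.adjoin ℂ (Set.range t)
  have hA : IsMulCommutative A := Algebra.isMulCommutative_adjoin ℂ (by
    rintro _ ⟨i, rfl⟩ _ ⟨j, rfl⟩
    exact h i j)
  let _ : CommRing A := { (inferInstance : Ring A) with mul_comm := hA.is_comm.comm }
  refine ⟨A.val.comp (MvPolynomial.aeval fun i => ⟨t i, Algebra.subset_adjoin ⟨i, rfl⟩⟩),
    fun i => ?_⟩
  simp

/-! ### The derivative of the exponential map. -/

section ExpDerivative

lemma X_mul_C_ne_zero {S : Type*} [CommRing S] [IsDomain S] {l r : S} (h : l ≠ r) :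
    (X * C (l - r) : S⟦X⟧) ≠ 0 :=
  mul_ne_zero X_ne_zero fun h' => sub_ne_zero.mpr h (by simpa using congrArg (coeff 0) h')

variable {S : Type*} [CommRing S] [Algebra ℂ S] {l r : S}

lemma ser_half_mul_self (x : S) : ser x (expS (1 / 2)) * ser x (expS (1 / 2)) = ser x (exp ℂ) := by
  rw [← ser_expS_add, ser_expS, mul_add, ← add_mul, ← map_add]
  norm_num

lemma X_mul_C_mul_sigmaS : X * C (l - r) * ser (l - r) sigmaS =
    ser l (expS (1 / 2)) * ser (-r) (expS (1 / 2)) -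
      ser (-l) (expS (1 / 2)) * ser r (expS (1 / 2)) := by
  have e : (1 / (2 * (1 / 2)) : ℂ) = 1 := by norm_num
  rw [← ser_sinhS_half, ser_sinhS (by norm_num), ← ser_expS_add, ← ser_expS_add, e, map_one,
    map_one, one_mul, neg_sub, ← sub_eq_add_neg, neg_add_eq_sub]

/-- `e^l - e^r = e^{(l+r)/2} · 2 sinh ((l - r)/2)`. The factor `l - r` is cancelled formally, for
independent variables; on operators it becomes the commutator, which is not invertible. -/
lemma del_exp_eq [IsDomain S] (h : l ≠ r) : del (exp ℂ) l r =
    ser l (expS (1 / 2)) * ser r (expS (1 / 2)) * ser (l - r) sigmaS := by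
  apply mul_left_cancel₀ (X_mul_C_ne_zero h)
  rw [X_mul_del, mul_left_comm, X_mul_C_mul_sigmaS, ← ser_half_mul_self, ← ser_half_mul_self]
  have h1 := ser_expS_mul_neg (1 / 2) l
  have h2 := ser_expS_mul_neg (1 / 2) r
  linear_combination ser r (expS (1 / 2)) ^ 2 * h1 - ser l (expS (1 / 2)) ^ 2 * h2

/-- `e^l + e^r = e^{(l+r)/2} · 2 cosh ((l - r)/2)`, with the factor `e^{(l+r)/2}` eliminated by
means of the divided difference of `exp`. -/
lemma del_exp_mul_cosh [IsDomain S] (h : l ≠ r) :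
    del (exp ℂ) l r * (2 * ser (l - r) (coshS (1 / 2))) =
    (ser l (exp ℂ) + ser r (exp ℂ)) * ser (l - r) sigmaS := by
  apply mul_left_cancel₀ (X_mul_C_ne_zero h)
  have h1 := ser_expS_mul_neg (1 / 2) l
  have h2 := ser_expS_mul_neg (1 / 2) r
  have h3 : (C (algebraMap ℂ S (1 / 2)) : S⟦X⟧) * 2 = 1 := by
    have : (2 : S⟦X⟧) = C (algebraMap ℂ S 2) := by rw [map_ofNat, map_ofNat]
    rw [this, ← map_mul, ← map_mul]; norm_num
  have h4 := X_mul_del (exp ℂ) l r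
  have h5 := X_mul_C_mul_sigmaS (l := l) (r := r)
  have h6 : ser (l - r) (coshS (1 / 2)) = C (algebraMap ℂ S (1 / 2)) *
      (ser l (expS (1 / 2)) * ser (-r) (expS (1 / 2)) +
        ser (-l) (expS (1 / 2)) * ser r (expS (1 / 2))) := by
    rw [ser_coshS, ← ser_expS_add, ← ser_expS_add, neg_sub, ← sub_eq_add_neg, neg_add_eq_sub]
  rw [← ser_half_mul_self, ← ser_half_mul_self] at h4
  rw [h6, ← ser_half_mul_self, ← ser_half_mul_self]
  set a := ser l (expS (1 / 2))
  set a' := ser (-l) (expS (1 / 2))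
  set b := ser r (expS (1 / 2))
  set b' := ser (-r) (expS (1 / 2))
  linear_combination (2 * C (algebraMap ℂ S (1 / 2)) * (a * b' + a' * b)) * h4 -
    (a * a + b * b) * h5 + ((a * a - b * b) * (a * b' + a' * b)) * h3 +
    2 * a * b * h1 - 2 * a * b * h2

section Operators

variable {𝓐 : Type*} [NormedRing 𝓐] [NormedAlgebra ℂ 𝓐]

/-- The operators of left and right multiplication by `M` turn formal identities in two
variables into identities of operators. -/
lemma exists_algHom_mul (M : 𝓐) : ∃ e : MvPolynomial (Fin 2) ℂ →ₐ[ℂ] 𝓐 →L[ℂ] 𝓐,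
    e (MvPolynomial.X 0) = ContinuousLinearMap.mul ℂ 𝓐 M ∧
    e (MvPolynomial.X 1) = (ContinuousLinearMap.mul ℂ 𝓐).flip M := by
  obtain ⟨e, he⟩ := exists_algHom_of_commute
    ![ContinuousLinearMap.mul ℂ 𝓐 M, (ContinuousLinearMap.mul ℂ 𝓐).flip M] (by
      intro i j
      ext v
      fin_cases i <;> fin_cases j <;> simp [mul_assoc])
  exact ⟨e, he 0, he 1⟩

/-- The commutator with `M` as a bounded operator. -/
def commL (M : 𝓐) : 𝓐 →L[ℂ] 𝓐 :=
  ContinuousLinearMap.mul ℂ 𝓐 M - (ContinuousLinearMap.mul ℂ 𝓐).flip M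

lemma commL_apply (M V : 𝓐) : commL M V = M * V - V * M := by simp [commL]

lemma mul_pow_apply (M V : 𝓐) (k : ℕ) : (ContinuousLinearMap.mul ℂ 𝓐 M ^ k) V = M ^ k * V := by
  induction k with
  | zero => simp
  | succ k ih => rw [pow_succ', mul_apply_eq_comp, ih, pow_succ']; simp [mul_assoc]

lemma flip_mul_pow_apply (M V : 𝓐) (k : ℕ) :
    ((ContinuousLinearMap.mul ℂ 𝓐).flip M ^ k) V = V * M ^ k := by
  induction k with
  | zero => simp
  | succ k ih => rw [pow_succ', mul_apply_eq_comp, ih, pow_succ]; simp [mul_assoc]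

variable [CompleteSpace 𝓐]

lemma IsEntire.map_psum_eq {f : ℂ⟦X⟧} (hf : IsEntire f) {𝓑 E : Type*} [NormedRing 𝓑]
    [NormedAlgebra ℂ 𝓑] [CompleteSpace 𝓑] [AddCommGroup E] [Module ℂ E] [TopologicalSpace E]
    [T2Space E] (u : 𝓐 →L[ℂ] E) (w : 𝓑 →L[ℂ] E) {a : 𝓐} {b : 𝓑}
    (h : ∀ k, u (a ^ k) = w (b ^ k)) : u (psum f a) = w (psum f b) := by
  have h1 := (hf.hasSum_psum a).mapL u
  have h2 := (hf.hasSum_psum b).mapL w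
  simp only [map_smul, h] at h1 h2
  exact h1.unique h2

lemma ev_del_exp {M : 𝓐} {e : MvPolynomial (Fin 2) ℂ →ₐ[ℂ] 𝓐 →L[ℂ] 𝓐}
    (h0 : e (MvPolynomial.X 0) = ContinuousLinearMap.mul ℂ 𝓐 M)
    (h1 : e (MvPolynomial.X 1) = (ContinuousLinearMap.mul ℂ 𝓐).flip M) :
    Ev e (del (exp ℂ) (MvPolynomial.X 0) (MvPolynomial.X 1)) (pdel (exp ℂ) M M) := by
  have hM := powBound_of_norm_le (le_refl ‖M‖)
  have hf := isEntire_exp (‖M‖ + 1) (by positivity)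
  have hc : ∀ k, e (coeff k (del (exp ℂ) (MvPolynomial.X 0) (MvPolynomial.X 1))) =
      pdelTerm (exp ℂ) M M k := fun k => by
    rw [coeff_del, map_mul, AlgHom.commutes, ← Algebra.smul_def, pdelTerm, map_sum]
    congr 1
    refine Finset.sum_congr rfl fun ij _ => ?_
    rw [map_mul, map_pow, map_pow, h0, h1]
    ext v
    rw [mul_apply_eq_comp, mul_pow_apply, flip_mul_pow_apply]
    simp [mul_assoc]
  unfold Ev
  simp only [hc]
  refine ⟨?_, hM.hasSum_pdel hM hf (norm_nonneg _) (lt_add_one _)⟩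
  exact ((summable_coeff_succ_mul_pow hf (norm_nonneg M) (lt_add_one _)).mul_left _).of_nonneg_of_le
    (fun _ => norm_nonneg _) (hM.norm_pdelTerm_le hM (norm_nonneg _))

lemma X_zero_ne_X_one : (MvPolynomial.X 0 : MvPolynomial (Fin 2) ℂ) ≠ MvPolynomial.X 1 := fun h =>
  absurd (MvPolynomial.X_injective h) (by decide)

/-- The kernel of the derivative of the exponential map. -/
lemma pdel_exp_eq_zero {M V : 𝓐} (h : psum sigmaS (commL M) V = 0) :
    pdel (exp ℂ) M M V = 0 := by
  obtain ⟨e, h0, h1⟩ := exists_algHom_mul M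
  have hc : e (MvPolynomial.X 0 - MvPolynomial.X 1) = commL M := by rw [map_sub, h0, h1, commL]
  have h3 := ((isEntire_expS (1 / 2)).ev_ser e (MvPolynomial.X 0)).mul
    ((isEntire_expS (1 / 2)).ev_ser e (MvPolynomial.X 1)) |>.mul
    (isEntire_sigmaS.ev_ser e (MvPolynomial.X 0 - MvPolynomial.X 1))
  rw [← del_exp_eq X_zero_ne_X_one] at h3
  rw [(ev_del_exp h0 h1).unique h3, mul_apply_eq_comp, hc, h, map_zero]

/-- The derivative of the exponential map in terms of the commutator. -/
lemma pdel_exp_two_cosh (M V : 𝓐) :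
    pdel (exp ℂ) M M ((2 : ℂ) • psum (coshS (1 / 2)) (commL M) V) =
      NormedSpace.exp M * psum sigmaS (commL M) V +
        psum sigmaS (commL M) V * NormedSpace.exp M := by
  obtain ⟨e, h0, h1⟩ := exists_algHom_mul M
  have hc : e (MvPolynomial.X 0 - MvPolynomial.X 1) = commL M := by rw [map_sub, h0, h1, commL]
  have hl : ∀ V, psum (exp ℂ) (ContinuousLinearMap.mul ℂ 𝓐 M) V = NormedSpace.exp M * V :=
    fun V => by
      rw [← psum_exp]
      exact isEntire_exp.map_psum_eq (ContinuousLinearMap.apply ℂ 𝓐 V)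
        ((ContinuousLinearMap.mul ℂ 𝓐).flip V) fun k => by
          rw [ContinuousLinearMap.apply_apply, mul_pow_apply]; rfl
  have hr : ∀ V, psum (exp ℂ) ((ContinuousLinearMap.mul ℂ 𝓐).flip M) V = V * NormedSpace.exp M :=
    fun V => by
      rw [← psum_exp]
      exact isEntire_exp.map_psum_eq (ContinuousLinearMap.apply ℂ 𝓐 V)
        (ContinuousLinearMap.mul ℂ 𝓐 V) fun k => by
          rw [ContinuousLinearMap.apply_apply, flip_mul_pow_apply]; rfl
  have h2 := ev_const (e := e) 2
  rw [map_ofNat, map_ofNat] at h2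
  have h3 := (ev_del_exp h0 h1).mul
    (h2.mul ((isEntire_coshS (1 / 2)).ev_ser e (MvPolynomial.X 0 - MvPolynomial.X 1)))
  have h4 := ((isEntire_exp.ev_ser e (MvPolynomial.X 0)).add
    (isEntire_exp.ev_ser e (MvPolynomial.X 1))).mul
    (isEntire_sigmaS.ev_ser e (MvPolynomial.X 0 - MvPolynomial.X 1))
  rw [← del_exp_mul_cosh X_zero_ne_X_one] at h4
  have h5 := congrArg (fun T => T V) (h3.unique h4)
  rw [hc, h0, h1] at h5
  simpa [hl, hr, Algebra.algebraMap_eq_smul_one] using h5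

end Operators

end ExpDerivative

/-! ### Symmetric translation in logarithmic coordinates. -/

section Curve

open scoped Matrix.Norms.Operator

variable {𝔤 : Type*} [LieRing 𝔤] [LieAlgebra ℂ 𝔤] {n : ℕ}
  (ρ : 𝔤 →ₗ⁅ℂ⁆ Matrix (Fin n) (Fin n) ℂ)

lemma val_expGL (ω : 𝔤) : (expGL ρ ω : Matrix (Fin n) (Fin n) ℂ) = NormedSpace.exp (ρ ω) := rfl

lemma expG_zero : expG ρ 0 = 1 := by
  apply Subtype.ext
  apply Units.ext
  change NormedSpace.exp (ρ 0) = 1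
  rw [map_zero, NormedSpace.exp_zero]

lemma expGL_neg_mul (ω : 𝔤) : expGL ρ (-ω) * expGL ρ ω = 1 := by
  apply Units.ext
  rw [Units.val_mul, val_expGL, val_expGL, map_neg, ← Matrix.exp_add_of_commute (-ρ ω) (ρ ω)
    (Commute.neg_left (Commute.refl _)), neg_add_cancel, NormedSpace.exp_zero, Units.val_one]

lemma val_inv_expGL (ω : 𝔤) :
    ((expGL ρ ω)⁻¹ : GL (Fin n) ℂ).val = NormedSpace.exp (ρ (-ω)) := by
  rw [← val_expGL, ← eq_inv_of_mul_eq_one_left (expGL_neg_mul ρ ω)]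

lemma commL_pow_apply (ω W : 𝔤) (k : ℕ) :
    (commL (ρ ω) ^ k) (ρ W) = ρ ((LieAlgebra.ad ℂ 𝔤 ω ^ k) W) := by
  induction k with
  | zero => simp
  | succ k ih =>
    rw [pow_succ', mul_apply_eq_comp, ih, commL_apply, pow_succ', Module.End.mul_apply,
      LieAlgebra.ad_apply, LieHom.map_lie, LieRing.of_associative_ring_bracket]

variable [FiniteDimensional ℂ 𝔤]

lemma IsEntire.psum_commL_apply {f : PowerSeries ℂ} (hf : IsEntire f) (ω W : 𝔤) :
    psum f (commL (ρ ω)) (ρ W) = ρ (psum f (LieAlgebra.ad ℂ 𝔤 ω) W) :=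
  hf.map_psum_eq (ContinuousLinearMap.apply ℂ _ (ρ W))
    (LinearMap.toContinuousLinearMap ((ρ : 𝔤 →ₗ[ℂ] Matrix (Fin n) (Fin n) ℂ) ∘ₗ
      LinearMap.applyₗ W)) fun k => commL_pow_apply ρ ω W k

variable [TopologicalSpace 𝔤] [IsTopologicalAddGroup 𝔤] [ContinuousSMul ℂ 𝔤] [T2Space 𝔤]

lemma continuous_rho : Continuous ρ :=
  (ρ : 𝔤 →ₗ[ℂ] Matrix (Fin n) (Fin n) ℂ).continuous_of_finiteDimensional

lemma continuous_expG : Continuous (expG ρ) := by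
  refine Continuous.subtype_mk ?_ _
  rw [Units.continuous_iff]
  refine ⟨NormedSpace.exp_continuous.comp (continuous_rho ρ), ?_⟩
  have : (fun ω => ((expGL ρ ω)⁻¹ : GL (Fin n) ℂ).val) =
      fun ω => NormedSpace.exp (ρ (-ω)) := funext (val_inv_expGL ρ)
  rw [this]
  exact NormedSpace.exp_continuous.comp ((continuous_rho ρ).comp continuous_neg)

variable {ρ} {U : Set 𝔤}

/-- The curve `e^{tX} e^ω e^{tX}` in logarithmic coordinates. -/
lemma IsExpDomain.exists_curve (hU : IsExpDomain ρ U) {ω : 𝔤} (hω : ω ∈ U) (X : 𝔤) :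
    ∃ u : ℂ → 𝔤, u 0 = ω ∧ Tendsto u (𝓝 0) (𝓝 ω) ∧ ∀ᶠ t in 𝓝 (0 : ℂ), u t ∈ U ∧
      expG ρ (u t) = expG ρ (t • X) * expG ρ ω * expG ρ (t • X) := by
  set γ : ℂ → linGroup ρ := fun t => expG ρ (t • X) * expG ρ ω * expG ρ (t • X) with hγ
  have hc : Continuous γ := by
    have : Continuous fun t : ℂ => expG ρ (t • X) :=
      (continuous_expG ρ).comp (continuous_id.smul continuous_const)
    exact (this.mul continuous_const).mul this
  have hγ0 : γ 0 = expG ρ ω := by simp [hγ, expG_zero]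
  have hev : ∀ᶠ t in 𝓝 (0 : ℂ), γ t ∈ Set.range fun w : U => expG ρ (w : 𝔤) :=
    hc.continuousAt.eventually (hU.isOpenEmbedding.isOpen_range.mem_nhds ⟨⟨ω, hω⟩, hγ0.symm⟩)
  classical
  -- The default value `ω` is not taken for `t` near `0`, where `γ t` stays in the open image of
  -- `U`.
  let u : ℂ → U := fun t => if h : ∃ w : U, expG ρ (w : 𝔤) = γ t then h.choose else ⟨ω, hω⟩
  have hu : ∀ᶠ t in 𝓝 (0 : ℂ), expG ρ (u t) = γ t := by
    filter_upwards [hev] with t ht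
    have ht' : ∃ w : U, expG ρ (w : 𝔤) = γ t := ht
    simp only [u, dif_pos ht']
    exact ht'.choose_spec
  have hu0 : u 0 = ⟨ω, hω⟩ := by
    apply hU.isOpenEmbedding.injective
    change expG ρ (u 0) = expG ρ ω
    rw [hu.self_of_nhds, hγ0]
  refine ⟨fun t => u t, by simp only [hu0], ?_, hu.mono fun t ht => ⟨(u t).2, ht⟩⟩
  have ht : Tendsto u (𝓝 0) (𝓝 ⟨ω, hω⟩) := by
    rw [hU.isOpenEmbedding.isInducing.tendsto_nhds_iff]
    have : Tendsto γ (𝓝 0) (𝓝 (expG ρ ω)) := hγ0 ▸ hc.tendsto 0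
    exact this.congr' (hu.mono fun t ht => ht.symm)
  exact (continuous_subtype_val.tendsto _).comp ht

lemma tendsto_exp_slope {𝓐 : Type*} [NormedRing 𝓐] [NormedAlgebra ℂ 𝓐] [CompleteSpace 𝓐]
    {N : ℂ → 𝓐} {M v : 𝓐} (hv : Tendsto (fun t : ℂ => t⁻¹ • (N t - M)) (𝓝[≠] 0) (𝓝 v))
    (hN : Tendsto N (𝓝[≠] 0) (𝓝 M)) :
    Tendsto (fun t : ℂ => t⁻¹ • (NormedSpace.exp (N t) - NormedSpace.exp M)) (𝓝[≠] 0)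
      (𝓝 (pdel (PowerSeries.exp ℂ) M M v)) := by
  have h := tendsto_psum_slope hv hN (eventually_powBound_of_norm_lt (lt_add_one ‖M‖))
    (isEntire_exp (‖M‖ + 1 + 1) (by positivity)) (by positivity) (lt_add_one _)
  simpa only [psum_exp] using h

/-- `pdel` of `exp` at `(ρ ω, ρ ω)` is the differential of the exponential map, which is injective
on `ρ(𝔤)` by the immersion condition. -/
lemma IsExpDomain.eq_zero_of_pdel (hU : IsExpDomain ρ U) {ω : 𝔤} (hω : ω ∈ U) {V : 𝔤}
    (h : pdel (PowerSeries.exp ℂ) (ρ ω) (ρ ω) (ρ V) = 0) : V = 0 := by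
  apply hU.immersion ω hω V
  rw [HasVelocity, zero_smul, add_zero, ← h]
  refine tendsto_exp_slope (𝓐 := Matrix (Fin n) (Fin n) ℂ) (N := fun t : ℂ => ρ (ω + t • V)) ?_ ?_
  · refine (tendsto_const_nhds (x := ρ V)).congr' ?_
    filter_upwards [self_mem_nhdsWithin] with t ht
    rw [map_add, add_sub_cancel_left, map_smul, smul_smul, inv_mul_cancel₀ ht, one_smul]
  · have : Continuous fun t : ℂ => ρ (ω + t • V) :=
      (continuous_rho ρ).comp (continuous_const.add (continuous_id.smul continuous_const))
    have h := this.tendsto 0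
    simp only [zero_smul, add_zero] at h
    exact h.mono_left nhdsWithin_le_nhds

/-- On the domain of the exponential map, `σ(ad_ω)` is bijective. -/
lemma IsExpDomain.surjective_sigma (hU : IsExpDomain ρ U) {ω : 𝔤} (hω : ω ∈ U) :
    Function.Surjective (psum sigmaS (LieAlgebra.ad ℂ 𝔤 ω) : Module.End ℂ 𝔤) := by
  rw [← LinearMap.injective_iff_surjective, injective_iff_map_eq_zero]
  intro V hV
  apply hU.eq_zero_of_pdel hω
  apply pdel_exp_eq_zero
  rw [isEntire_sigmaS.psum_commL_apply, hV, map_zero]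

lemma tendsto_exp_mul_exp_slope {𝓐 : Type*} [NormedRing 𝓐] [NormedAlgebra ℂ 𝓐] [CompleteSpace 𝓐]
    (X M : 𝓐) : Tendsto (fun t : ℂ => t⁻¹ • (NormedSpace.exp (t • X) * NormedSpace.exp M *
      NormedSpace.exp (t • X) - NormedSpace.exp M)) (𝓝[≠] 0)
      (𝓝 (NormedSpace.exp M * X + X * NormedSpace.exp M)) := by
  have h1 := hasDerivAt_exp_smul_const (𝕂 := ℂ) X (0 : ℂ)
  have h2 := (h1.mul_const (NormedSpace.exp M)).mul h1
  have h3 := hasDerivAt_iff_tendsto_slope_zero.mp h2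
  simpa [add_comm] using h3

/-- On the finite-dimensional range of `ι` the injective `T₀` is bounded below by some `c > 0`.
Operators within `c / 2` of `T₀` are bounded below there by `c / 2`, which controls `w t - w₀`. -/
lemma tendsto_of_tendsto_apply {𝓐 : Type*} [NormedAddCommGroup 𝓐] [NormedSpace ℂ 𝓐]
    {E : Type*} [AddCommGroup E] [Module ℂ E] [FiniteDimensional ℂ E] [TopologicalSpace E]
    [IsTopologicalAddGroup E] [ContinuousSMul ℂ E] [T2Space E]
    (ι : E →ₗ[ℂ] 𝓐) (hι : Function.Injective ι) {α : Type*} {l : Filter α} {T : α → 𝓐 →L[ℂ] 𝓐}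
    {T₀ : 𝓐 →L[ℂ] 𝓐} (hT : Tendsto T l (𝓝 T₀)) (hinj : ∀ x, T₀ (ι x) = 0 → x = 0)
    {w : α → E} {w₀ : E} (hw : Tendsto (fun t => T t (ι (w t))) l (𝓝 (T₀ (ι w₀)))) :
    Tendsto w l (𝓝 w₀) := by
  have hι' : IsInducing ι :=
    (LinearMap.isClosedEmbedding_of_injective (LinearMap.ker_eq_bot.mpr hι)).isInducing
  rw [hι'.tendsto_nhds_iff]
  obtain ⟨c, hc, hb⟩ : ∃ c : ℝ, 0 < c ∧ ∀ x, c * ‖ι x‖ ≤ ‖T₀ (ι x)‖ := by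
    obtain ⟨K, hK, hb⟩ := ((T₀ : 𝓐 →ₗ[ℂ] 𝓐) ∘ₗ (LinearMap.range ι).subtype).exists_antilipschitzWith
      (by
        rw [LinearMap.ker_eq_bot']
        rintro ⟨_, x, rfl⟩ hx
        have := hinj x hx
        simp [this])
    refine ⟨(K : ℝ)⁻¹, by positivity, fun x => ?_⟩
    have h := ZeroHomClass.bound_of_antilipschitz _ hb ⟨ι x, x, rfl⟩
    rw [inv_mul_le_iff₀ (by positivity)]
    exact h
  rw [tendsto_iff_norm_sub_tendsto_zero]
  have h1 : Tendsto (fun t => T t (ι (w t)) - T t (ι w₀)) l (𝓝 0) := by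
    have : Tendsto (fun t => T t (ι w₀)) l (𝓝 (T₀ (ι w₀))) :=
      ((ContinuousLinearMap.apply ℂ 𝓐 (ι w₀)).continuous.tendsto T₀).comp hT
    simpa using hw.sub this
  have h2 : ∀ᶠ t in l, ‖T t - T₀‖ < c / 2 :=
    (tendsto_iff_norm_sub_tendsto_zero.mp hT).eventually (gt_mem_nhds (by positivity))
  refine squeeze_zero' (Eventually.of_forall fun _ => norm_nonneg _) ?_
    (by simpa using (h1.norm.const_mul (2 / c)))
  filter_upwards [h2] with t ht
  rw [Function.comp_apply, ← map_sub, ← map_sub (T t), ← map_sub]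
  set x := ι (w t - w₀) with hx
  have h3 := hb (w t - w₀)
  rw [← hx] at h3
  have h4 : ‖T₀ x‖ ≤ ‖T t x‖ + ‖T t - T₀‖ * ‖x‖ := by
    have : T₀ x = T t x - (T t - T₀) x := by simp
    rw [this]
    exact (norm_sub_le _ _).trans (by gcongr; exact (T t - T₀).le_opNorm x)
  rw [div_mul_eq_mul_div, le_div_iff₀ hc]
  nlinarith [norm_nonneg x]

/-- The velocity in logarithmic coordinates of the curve `e^{tX} e^ω e^{tX}`, for
`X = σ(ad_ω) W`. -/
lemma IsExpDomain.tendsto_slope (hU : IsExpDomain ρ U) (hρ : Function.Injective ρ) {ω : 𝔤}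
    (hω : ω ∈ U) (W : 𝔤) {u : ℂ → 𝔤} (hu : Tendsto u (𝓝 0) (𝓝 ω))
    (hu' : ∀ᶠ t in 𝓝 (0 : ℂ), u t ∈ U ∧ expG ρ (u t) =
      expG ρ (t • psum sigmaS (LieAlgebra.ad ℂ 𝔤 ω) W) * expG ρ ω *
        expG ρ (t • psum sigmaS (LieAlgebra.ad ℂ 𝔤 ω) W)) :
    Tendsto (fun t : ℂ => t⁻¹ • (u t - ω)) (𝓝[≠] 0)
      (𝓝 ((2 : ℂ) • psum (coshS (1 / 2)) (LieAlgebra.ad ℂ 𝔤 ω) W)) := by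
  set X := psum sigmaS (LieAlgebra.ad ℂ 𝔤 ω) W with hX
  have hN : Tendsto (fun t => ρ (u t)) (𝓝 0) (𝓝 (ρ ω)) := ((continuous_rho ρ).tendsto ω).comp hu
  have hb := eventually_powBound_of_norm_lt (lt_add_one ‖ρ ω‖)
  have hf := isEntire_exp (‖ρ ω‖ + 1 + 1) (by positivity)
  have hT := tendsto_pdel (l := 𝓝[≠] (0 : ℂ)) (hN.mono_left nhdsWithin_le_nhds) hb hf
    (by positivity) (lt_add_one _)
  -- So far `u` is only known to be continuous at `0`. Its slope is recovered from that of `exp (ρ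
  -- (u t))`, which is `pdel` at `(ρ (u t), ρ ω)` applied to the slope of `ρ (u t)`.
  refine tendsto_of_tendsto_apply (ρ : 𝔤 →ₗ[ℂ] Matrix (Fin n) (Fin n) ℂ) hρ hT
    (fun V hV => hU.eq_zero_of_pdel hω hV) ?_
  have hval : pdel (PowerSeries.exp ℂ) (ρ ω) (ρ ω)
      (ρ ((2 : ℂ) • psum (coshS (1 / 2)) (LieAlgebra.ad ℂ 𝔤 ω) W)) =
      NormedSpace.exp (ρ ω) * ρ X + ρ X * NormedSpace.exp (ρ ω) := by
    rw [map_smul, ← (isEntire_coshS _).psum_commL_apply, pdel_exp_two_cosh,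
      isEntire_sigmaS.psum_commL_apply]
    rfl
  have hd' := tendsto_exp_mul_exp_slope (ρ X) (ρ ω)
  change Tendsto _ _ (𝓝 (pdel (PowerSeries.exp ℂ) (ρ ω) (ρ ω)
      (ρ ((2 : ℂ) • psum (coshS (1 / 2)) (LieAlgebra.ad ℂ 𝔤 ω) W))))
  rw [hval]
  refine hd'.congr' ?_
  filter_upwards [(hu'.and (hN.eventually hb)).filter_mono nhdsWithin_le_nhds] with t ht
  obtain ⟨⟨_, h2⟩, h3⟩ := ht
  have h4 := h3.pdel_apply_sub hb.self_of_nhds hf (by positivity) (lt_add_one _)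
  have h5 : NormedSpace.exp (ρ (u t)) = NormedSpace.exp (t • ρ X) * NormedSpace.exp (ρ ω) *
      NormedSpace.exp (t • ρ X) := by
    have := congrArg (fun g : linGroup ρ => ((g : GL (Fin n) ℂ) : Matrix (Fin n) (Fin n) ℂ)) h2
    rw [← map_smul]
    exact this
  change _ = pdel (PowerSeries.exp ℂ) (ρ (u t)) (ρ ω) (ρ (t⁻¹ • (u t - ω)))
  rw [map_smul, map_smul, map_sub, h4, psum_exp, psum_exp]
  exact congrArg (fun E => t⁻¹ • (E - NormedSpace.exp (ρ ω))) h5.symm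

end Curve

lemma coeffBound_of_summable {f : ℂ⟦X⟧} {z : ℂ} (h : Summable fun k => coeff k f * z ^ k) :
    CoeffBound f ‖z‖ := by
  obtain ⟨C, hC⟩ := h.tendsto_atTop_zero.norm.bddAbove_range
  refine ⟨C, fun k => ?_⟩
  rw [← norm_pow, ← norm_mul]
  exact hC ⟨k, rfl⟩

lemma Rep.exists_coeffBound {φ : ℂ → ℂ} {f : ℂ⟦X⟧} (h : Rep φ f) :
    ∃ q : ℝ, 0 < q ∧ CoeffBound f q := by
  have h1 := (rep_iff_hasSum.mp h).filter_mono (nhdsWithin_le_nhds (s := {0}ᶜ))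
  obtain ⟨z, hz, hz0⟩ := (h1.and self_mem_nhdsWithin).exists
  exact ⟨‖z‖, norm_pos_iff.mpr hz0, coeffBound_of_summable hz.summable⟩

/-! ### The ansatz: convergence near `ad_ω` and differentiability. -/

section Lie

variable {𝔤 : Type*} [LieRing 𝔤] [LieAlgebra ℂ 𝔤] {n : ℕ}
  {ρ : 𝔤 →ₗ⁅ℂ⁆ Matrix (Fin n) (Fin n) ℂ} [TopologicalSpace 𝔤]
  {U : Set 𝔤} {F : ℂ → ℂ} {R : linGroup ρ → Module.End ℂ 𝔤}

lemma IsAnsatz.hasSum (hR : IsAnsatz ρ U F R) {ω : 𝔤} (hω : ω ∈ U) (Y : 𝔤) :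
    HasSum (fun k : ℕ => coeff k (taylor F) • ((LieAlgebra.ad ℂ 𝔤 ω) ^ k) Y)
      (R (expG ρ ω) Y) := by
  simpa only [taylor, coeff_mk] using hR ω hω Y

variable [FiniteDimensional ℂ 𝔤] [IsTopologicalAddGroup 𝔤] [ContinuousSMul ℂ 𝔤] [T2Space 𝔤]

/-- The convergence of the Taylor series at `ad_ω` for all `ω` in an open set bounds the spectral
radius of `ad_ω` by a number less than the radius of convergence. -/
lemma IsAnsatz.exists_powBound [Nontrivial 𝔤] (hR : IsAnsatz ρ U F R) (hU : IsOpen U)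
    (hF : AnalyticAt ℂ F 0) {ω : 𝔤} (hω : ω ∈ U) :
    ∃ q q' C : ℝ, 0 ≤ q ∧ q < q' ∧ CoeffBound (taylor F) q' ∧
      ∀ᶠ N in 𝓝 (LieAlgebra.ad ℂ 𝔤 ω), PowBound C q N := by
  obtain ⟨z, hz, hzr⟩ := spectrum.exists_nnnorm_eq_spectralRadius (LieAlgebra.ad ℂ 𝔤 ω)
  obtain ⟨q', hq', hf⟩ : ∃ q' : ℝ, ‖z‖ < q' ∧ CoeffBound (taylor F) q' := by
    by_cases hz0 : z = 0
    · obtain ⟨q, hq, hf⟩ := (rep_taylor hF).exists_coeffBound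
      exact ⟨q, by simpa [hz0] using hq, hf⟩
    -- `z` is an eigenvalue of `ad_ω` of maximal modulus. `U` contains `(1 + t) ω` for some `t > 0`,
    -- and there the operator series on an eigenvector is the scalar series at `(1 + t) z`. So the
    -- series converges beyond `‖z‖`.
    · have hc : Continuous fun t : ℝ => ((1 + t : ℝ) : ℂ) • ω := by fun_prop
      have h0 : ∀ᶠ t in 𝓝 (0 : ℝ), ((1 + t : ℝ) : ℂ) • ω ∈ U :=
        hc.continuousAt.eventually (hU.mem_nhds (by simpa using hω))
      obtain ⟨t, ht, ht0⟩ := ((h0.filter_mono nhdsWithin_le_nhds).and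
        (self_mem_nhdsWithin (s := Set.Ioi (0 : ℝ)))).exists
      have ht0' : (0 : ℝ) < t := ht0
      obtain ⟨Y, hY⟩ := (Module.End.hasEigenvalue_iff_mem_spectrum.mpr hz).exists_hasEigenvector
      obtain ⟨φ, hφ⟩ : ∃ φ : Module.Dual ℂ 𝔤, φ Y ≠ 0 := by
        by_contra! h
        exact hY.2 ((Module.forall_dual_apply_eq_zero_iff ℂ Y).mp h)
      have hY1 : (LieAlgebra.ad ℂ 𝔤 (((1 + t : ℝ) : ℂ) • ω)) Y = (((1 + t : ℝ) : ℂ) * z) • Y := by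
        rw [map_smul, LinearMap.smul_apply, hY.apply_eq_smul, smul_smul]
      have hY2 : ∀ k : ℕ, ((LieAlgebra.ad ℂ 𝔤 (((1 + t : ℝ) : ℂ) • ω)) ^ k) Y =
          (((1 + t : ℝ) : ℂ) * z) ^ k • Y := fun k => by
        induction k with
        | zero => simp
        | succ k ih =>
          rw [pow_succ, Module.End.mul_apply, hY1, map_smul, ih, smul_smul, pow_succ, mul_comm]
      have h1 := (hR.hasSum ht Y).mapL (LinearMap.toContinuousLinearMap φ)
      have e : ∀ k, LinearMap.toContinuousLinearMap φ (coeff k (taylor F) •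
          ((LieAlgebra.ad ℂ 𝔤 (((1 + t : ℝ) : ℂ) • ω)) ^ k) Y) =
          coeff k (taylor F) * (((1 + t : ℝ) : ℂ) * z) ^ k * φ Y := fun k => by
        rw [hY2, LinearMap.coe_toContinuousLinearMap', map_smul, map_smul, smul_eq_mul,
          smul_eq_mul, mul_assoc]
      have h2 := coeffBound_of_summable ((summable_mul_right_iff hφ).mp (h1.summable.congr e))
      refine ⟨_, ?_, h2⟩
      rw [norm_mul, Complex.norm_real, Real.norm_of_nonneg (by positivity)]
      have := norm_pos_iff.mpr hz0
      nlinarith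
  obtain ⟨q, hq1, hq2⟩ := exists_between hq'
  have hq0 : 0 < q := (norm_nonneg z).trans_lt hq1
  obtain ⟨C, hC⟩ := eventually_powBound (𝓐 := Module.End ℂ 𝔤) (a := LieAlgebra.ad ℂ 𝔤 ω) hq0 (by
    rw [← hzr, ← enorm_eq_nnnorm, ← ofReal_norm]
    exact (ENNReal.ofReal_lt_ofReal_iff hq0).mpr hq1)
  exact ⟨q, q', C, hq0.le, hq2, hf, hC⟩

lemma IsAnsatz.eq_psum [Nontrivial 𝔤] (hR : IsAnsatz ρ U F R) (hU : IsOpen U)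
    (hF : AnalyticAt ℂ F 0) {ω : 𝔤} (hω : ω ∈ U) :
    R (expG ρ ω) = psum (taylor F) (LieAlgebra.ad ℂ 𝔤 ω) := by
  obtain ⟨q, q', C, hq, hqq, hf, hb⟩ := hR.exists_powBound hU hF hω
  ext Y
  refine (hR.hasSum hω Y).unique ?_
  have h := (hb.self_of_nhds.hasSum_psum hf hq hqq).mapL
    (LinearMap.toContinuousLinearMap (LinearMap.applyₗ Y : Module.End ℂ 𝔤 →ₗ[ℂ] 𝔤))
  exact h

/-- The derivative `𝓓⁺_X R` at `e^ω`, for `X = σ(ad_ω) W`. -/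
theorem IsAnsatz.isDPlus [Nontrivial 𝔤] (hR : IsAnsatz ρ U F R) (hU : IsExpDomain ρ U)
    (hρ : Function.Injective ρ) (hF : AnalyticAt ℂ F 0) {ω : 𝔤} (hω : ω ∈ U) (W : 𝔤) :
    IsDPlus ρ R (expG ρ ω) ((psum sigmaS (LieAlgebra.ad ℂ 𝔤 ω) : Module.End ℂ 𝔤) W)
      (pdel (taylor F) (LieAlgebra.ad ℂ 𝔤 ω) (LieAlgebra.ad ℂ 𝔤 ω) (LieAlgebra.ad ℂ 𝔤
        ((2 : ℂ) • (psum (coshS (1 / 2)) (LieAlgebra.ad ℂ 𝔤 ω) : Module.End ℂ 𝔤) W))) := by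
  obtain ⟨q, q', C, hq, hqq, hf, hb⟩ := hR.exists_powBound hU.isOpen hF hω
  obtain ⟨u, hu0, hu, hu'⟩ := hU.exists_curve hω
    ((psum sigmaS (LieAlgebra.ad ℂ 𝔤 ω) : Module.End ℂ 𝔤) W)
  have hs := hU.tendsto_slope hρ hω W hu hu'
  have had : Continuous (LieAlgebra.ad ℂ 𝔤) :=
    (LieAlgebra.ad ℂ 𝔤 : 𝔤 →ₗ[ℂ] Module.End ℂ 𝔤).continuous_of_finiteDimensional
  have h1 := tendsto_psum_slope (f := taylor F) (N := fun t => LieAlgebra.ad ℂ 𝔤 (u t))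
    (((had.tendsto _).comp hs).congr fun t => by rw [Function.comp_apply, map_smul, map_sub])
    ((had.tendsto ω).comp (hu.mono_left nhdsWithin_le_nhds)) hb hf hq hqq
  intro Y
  have h2 := ((LinearMap.toContinuousLinearMap
    (LinearMap.applyₗ Y : Module.End ℂ 𝔤 →ₗ[ℂ] 𝔤)).continuous.tendsto _).comp h1
  refine h2.congr' ?_
  have h0 := hu'.self_of_nhds
  filter_upwards [hu'.filter_mono nhdsWithin_le_nhds] with t ht
  rw [← ht.2, ← h0.2, hu0, hR.eq_psum hU.isOpen hF ht.1, hR.eq_psum hU.isOpen hF hω]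
  rfl

lemma HasVelocity.unique {E : Type*} [AddCommGroup E] [Module ℂ E] [TopologicalSpace E]
    [T2Space E] {c : ℂ → E} {v w : E} (hv : HasVelocity c v) (hw : HasVelocity c w) : v = w :=
  tendsto_nhds_unique hv hw

end Lie

/-! ### Polynomials acting on triple tensors and on invariant forms. -/

section Tensor

variable {V : Type*} [AddCommGroup V] [Module ℂ V]

/-- The action of an operator on the first tensor factor. -/
def op₁ : Module.End ℂ V →ₗ[ℂ] Module.End ℂ (V ⊗[ℂ] (V ⊗[ℂ] V)) :=
  LinearMap.rTensorHom (V ⊗[ℂ] V)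

/-- The action of an operator on the second tensor factor. -/
def op₂ : Module.End ℂ V →ₗ[ℂ] Module.End ℂ (V ⊗[ℂ] (V ⊗[ℂ] V)) :=
  LinearMap.lTensorHom V ∘ₗ LinearMap.rTensorHom V

/-- The action of an operator on the third tensor factor. -/
def op₃ : Module.End ℂ V →ₗ[ℂ] Module.End ℂ (V ⊗[ℂ] (V ⊗[ℂ] V)) :=
  LinearMap.lTensorHom V ∘ₗ LinearMap.lTensorHom V

lemma op₁_tmul (a : Module.End ℂ V) (X Y Z : V) :
    op₁ a (X ⊗ₜ[ℂ] (Y ⊗ₜ[ℂ] Z)) = a X ⊗ₜ[ℂ] (Y ⊗ₜ[ℂ] Z) := rfl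

lemma op₂_tmul (a : Module.End ℂ V) (X Y Z : V) :
    op₂ a (X ⊗ₜ[ℂ] (Y ⊗ₜ[ℂ] Z)) = X ⊗ₜ[ℂ] (a Y ⊗ₜ[ℂ] Z) := rfl

lemma op₃_tmul (a : Module.End ℂ V) (X Y Z : V) :
    op₃ a (X ⊗ₜ[ℂ] (Y ⊗ₜ[ℂ] Z)) = X ⊗ₜ[ℂ] (Y ⊗ₜ[ℂ] a Z) := rfl

lemma op₁_pow (a : Module.End ℂ V) (k : ℕ) : op₁ (a ^ k) = op₁ a ^ k :=
  (LinearMap.rTensor_pow a k).symm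

lemma op₂_pow (a : Module.End ℂ V) (k : ℕ) : op₂ (a ^ k) = op₂ a ^ k := by
  have h := LinearMap.lTensor_pow (M := V) (LinearMap.rTensor V a) k
  rw [LinearMap.rTensor_pow] at h
  exact h.symm

lemma op₃_pow (a : Module.End ℂ V) (k : ℕ) : op₃ (a ^ k) = op₃ a ^ k := by
  have h := LinearMap.lTensor_pow (M := V) (LinearMap.lTensor V a) k
  rw [LinearMap.lTensor_pow a k] at h
  exact h.symm

lemma tensor_ext {W : Type*} [AddCommGroup W] [Module ℂ W] {u v : V ⊗[ℂ] (V ⊗[ℂ] V) →ₗ[ℂ] W}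
    (h : ∀ X Y Z, u (X ⊗ₜ[ℂ] (Y ⊗ₜ[ℂ] Z)) = v (X ⊗ₜ[ℂ] (Y ⊗ₜ[ℂ] Z))) : u = v := by
  apply TensorProduct.ext
  ext X : 1
  apply TensorProduct.ext'
  exact h X

/-- Polynomials in three variables act on the triple tensor product through the actions of an
operator on the three factors. -/
lemma exists_algHom_tensor (a : Module.End ℂ V) :
    ∃ e : MvPolynomial (Fin 3) ℂ →ₐ[ℂ] Module.End ℂ (V ⊗[ℂ] (V ⊗[ℂ] V)),
      e (MvPolynomial.X 0) = op₁ a ∧ e (MvPolynomial.X 1) = op₂ a ∧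
        e (MvPolynomial.X 2) = op₃ a := by
  obtain ⟨e, he⟩ := exists_algHom_of_commute ![op₁ a, op₂ a, op₃ a] (by
    intro i j
    fin_cases i <;> fin_cases j <;> exact tensor_ext fun _ _ _ => rfl)
  exact ⟨e, he 0, he 1, he 2⟩

variable {e : MvPolynomial (Fin 3) ℂ →ₐ[ℂ] Module.End ℂ (V ⊗[ℂ] (V ⊗[ℂ] V))} {a : Module.End ℂ V}
  {φ : V ⊗[ℂ] (V ⊗[ℂ] V) →ₗ[ℂ] ℂ}

/-- The substitution of `-x - y` for the third variable `z`. -/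
def substSum : MvPolynomial (Fin 3) ℂ →ₐ[ℂ] MvPolynomial (Fin 3) ℂ :=
  MvPolynomial.aeval ![MvPolynomial.X 0, MvPolynomial.X 1, -MvPolynomial.X 0 - MvPolynomial.X 1]

/-- On an invariant form the sum of the three actions vanishes. -/
lemma apply_substSum (h0 : e (MvPolynomial.X 0) = op₁ a) (h1 : e (MvPolynomial.X 1) = op₂ a)
    (h2 : e (MvPolynomial.X 2) = op₃ a)
    (hφ : φ ∘ₗ (op₁ a + op₂ a + op₃ a) = 0) (p : MvPolynomial (Fin 3) ℂ)
    (t : V ⊗[ℂ] (V ⊗[ℂ] V)) : φ (e p t) = φ (e (substSum p) t) := by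
  induction p using MvPolynomial.induction_on generalizing t with
  | C c => simp [substSum]
  | add p q hp hq =>
    rw [map_add, map_add, map_add, LinearMap.add_apply, LinearMap.add_apply, map_add, map_add,
      hp, hq]
  | mul_X p i hp =>
    have hi : ∀ t, φ (e (MvPolynomial.X i) t) = φ (e (substSum (MvPolynomial.X i)) t) := by
      intro t
      fin_cases i
      · simp [substSum]
      · simp [substSum]
      · change φ (e (MvPolynomial.X 2) t) = φ (e (substSum (MvPolynomial.X 2)) t)
        have : substSum (MvPolynomial.X 2) = -MvPolynomial.X 0 - MvPolynomial.X 1 := by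
          simp [substSum]
        rw [this, map_sub, map_neg, h0, h1, h2]
        have h := LinearMap.congr_fun hφ t
        simp only [LinearMap.comp_apply, LinearMap.add_apply, map_add, LinearMap.zero_apply] at h
        simp only [LinearMap.sub_apply, LinearMap.neg_apply, map_sub, map_neg]
        linear_combination h
    -- Invariance applies only to the outermost operator, so `X i` and then `p` are brought
    -- outermost by commutativity.
    rw [mul_comm, map_mul, Module.End.mul_apply, hi, ← Module.End.mul_apply, ← map_mul, mul_comm,
      map_mul, Module.End.mul_apply, hp, ← Module.End.mul_apply, ← map_mul, map_mul substSum,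
      mul_comm (substSum _)]

/-- The action of polynomials on an invariant form evaluated at eigenvectors. -/
lemma apply_eigenvector (h0 : e (MvPolynomial.X 0) = op₁ a) (h1 : e (MvPolynomial.X 1) = op₂ a)
    (h2 : e (MvPolynomial.X 2) = op₃ a)
    (hφ : φ ∘ₗ (op₁ a + op₂ a + op₃ a) = 0) {X Z : V} {c : ℂ}
    (hX : a X = c • X) (hZ : a Z = 0) (p : MvPolynomial (Fin 3) ℂ) (Y : V) :
    φ (e p (X ⊗ₜ[ℂ] (Y ⊗ₜ[ℂ] Z))) =
      MvPolynomial.aeval ![c, -c, 0] p * φ (X ⊗ₜ[ℂ] (Y ⊗ₜ[ℂ] Z)) := by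
  induction p using MvPolynomial.induction_on generalizing Y with
  | C r =>
    rw [← MvPolynomial.algebraMap_eq, AlgHom.commutes, AlgHom.commutes]
    simp [Module.algebraMap_end_apply]
  | add p q hp hq => simp only [map_add, LinearMap.add_apply, hp, hq, add_mul]
  | mul_X p i hp =>
    rw [map_mul, map_mul, Module.End.mul_apply, MvPolynomial.aeval_X]
    fin_cases i
    · change φ (e p (e (MvPolynomial.X 0) _)) = _ * c * _
      rw [h0, op₁_tmul, hX, ← TensorProduct.smul_tmul', map_smul, map_smul, hp, smul_eq_mul]
      ring
    · change φ (e p (e (MvPolynomial.X 1) _)) = _ * -c * _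
      rw [h1, op₂_tmul, hp]
      -- `Y` need not be an eigenvector: since the three actions sum to zero under `φ`, the second
      -- one acts as `-c`.
      have h := LinearMap.congr_fun hφ (X ⊗ₜ[ℂ] (Y ⊗ₜ[ℂ] Z))
      simp only [LinearMap.comp_apply, LinearMap.add_apply, map_add, LinearMap.zero_apply,
        op₁_tmul, op₂_tmul, op₃_tmul, hX, hZ, TensorProduct.tmul_zero, map_zero,
        ← TensorProduct.smul_tmul', map_smul, smul_eq_mul] at h
      linear_combination (MvPolynomial.aeval ![c, -c, 0] p) * h
    · change φ (e p (e (MvPolynomial.X 2) _)) = _ * 0 * _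
      rw [h2, op₃_tmul, hZ, TensorProduct.tmul_zero, TensorProduct.tmul_zero, map_zero, map_zero]
      ring

end Tensor

lemma Ev.hasSum_apply {W : Type*} [AddCommGroup W] [Module ℂ W] [FiniteDimensional ℂ W]
    {S : Type*} [CommRing S] [Algebra ℂ S] {e : S →ₐ[ℂ] Module.End ℂ W}
    {P : S⟦X⟧} {b : Module.End ℂ W} (h : Ev e P b) (φ : W →ₗ[ℂ] ℂ) (t : W) :
    HasSum (fun k => φ (e (coeff k P) t)) (φ (b t)) :=
  h.2.mapL (LinearMap.toContinuousLinearMap (φ ∘ₗ LinearMap.applyₗ t : Module.End ℂ W →ₗ[ℂ] ℂ))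

/-! ### Evaluation of the formal equation at operators on tensors. -/

section Transfer

lemma PowBound.neg {𝓐 : Type*} [NormedRing 𝓐] {a : 𝓐} {C q : ℝ} (ha : PowBound C q a) :
    PowBound C q (-a) := fun k => by
  rcases Nat.even_or_odd k with hk | hk
  · rw [hk.neg_pow]; exact ha k
  · rw [hk.neg_pow, norm_neg]; exact ha k

variable {V W : Type*} [AddCommGroup V] [Module ℂ V] [FiniteDimensional ℂ V] [AddCommGroup W]
  [Module ℂ W] [FiniteDimensional ℂ W] {f : ℂ⟦X⟧} {a : Module.End ℂ V} {C q q' : ℝ}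
  {S : Type*} [CommRing S] [Algebra ℂ S] {e : S →ₐ[ℂ] Module.End ℂ W} {x : S}

lemma PowBound.map (ha : PowBound C q a) (T : Module.End ℂ V →ₗ[ℂ] Module.End ℂ W)
    (hT : ∀ k, T (a ^ k) = T a ^ k) : ∃ K, PowBound K q (T a) :=
  ⟨‖LinearMap.toContinuousLinearMap T‖ * C, fun k => by
    rw [← hT, mul_assoc]
    exact ((LinearMap.toContinuousLinearMap T).le_opNorm _).trans
      (mul_le_mul_of_nonneg_left (ha k) (norm_nonneg _))⟩

lemma PowBound.ev_ser_map (ha : PowBound C q a) (hf : CoeffBound f q') (hq : 0 ≤ q) (hqq : q < q')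
    (T : Module.End ℂ V →ₗ[ℂ] Module.End ℂ W) (hT : ∀ k, T (a ^ k) = T a ^ k) (hx : e x = T a) :
    Ev e (ser x f) (T (psum f a)) := by
  obtain ⟨K, hK⟩ := ha.map T hT
  have h1 : PowBound K q (e x) := hx ▸ hK
  have h2 := h1.ev_ser hf hq hqq
  have h3 : HasSum (fun k => T (coeff k f • a ^ k)) (T (psum f a)) :=
    (ha.hasSum_psum hf hq hqq).mapL (LinearMap.toContinuousLinearMap T)
  simp only [map_smul, hT] at h3
  rwa [hx, (hK.hasSum_psum hf hq hqq).unique h3] at h2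

lemma IsEntire.ev_ser_map (hf : IsEntire f) (T : Module.End ℂ V →ₗ[ℂ] Module.End ℂ W)
    (hT : ∀ k, T (a ^ k) = T a ^ k) (hx : e x = T a) : Ev e (ser x f) (T (psum f a)) :=
  (powBound_of_norm_le le_rfl).ev_ser_map (hf (‖a‖ + 1) (by positivity)) (norm_nonneg _)
    (lt_add_one _) T hT hx

/-- The values `b₁, b₂, b₃` of the divided differences stay unspecified, because each mixes two
tensor factors; `PowBound.triple_del` identifies them under the invariant form. -/
lemma PowBound.exists_ev_plSeries (ha : PowBound C q a) (hf : CoeffBound f q') (hq : 0 ≤ q)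
    (hqq : q < q') (μ : ℂ) {T₁ T₂ T₃ : Module.End ℂ V →ₗ[ℂ] Module.End ℂ W}
    (hT₁ : ∀ k, T₁ (a ^ k) = T₁ a ^ k) (hT₂ : ∀ k, T₂ (a ^ k) = T₂ a ^ k)
    (hT₃ : ∀ k, T₃ (a ^ k) = T₃ a ^ k) {y z : S}
    (hx : e x = T₁ a) (hy : e y = T₂ a) (hz : e z = T₃ a) :
    ∃ b₁ b₂ b₃, Ev e (del f y (-z)) b₁ ∧ Ev e (del f z (-x)) b₂ ∧ Ev e (del f x (-y)) b₃ ∧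
      Ev e (plSeries f μ x y z)
        ((T₁ (psum f a) * T₁ (psum sigmaS a)) * (T₂ (psum f a) * T₂ (psum sigmaS a)) *
            T₃ (psum sigmaS a) -
          b₁ * (T₁ (psum (coshS (1 / 2)) a) * (T₂ (psum sigmaS a) * T₃ (psum sigmaS a))) +
        ((T₂ (psum f a) * T₂ (psum sigmaS a)) * (T₃ (psum f a) * T₃ (psum sigmaS a)) *
            T₁ (psum sigmaS a) -
          b₂ * (T₂ (psum (coshS (1 / 2)) a) * (T₃ (psum sigmaS a) * T₁ (psum sigmaS a)))) +
        ((T₃ (psum f a) * T₃ (psum sigmaS a)) * (T₁ (psum f a) * T₁ (psum sigmaS a)) *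
            T₂ (psum sigmaS a) -
          b₃ * (T₃ (psum (coshS (1 / 2)) a) * (T₁ (psum sigmaS a) * T₂ (psum sigmaS a)))) -
        algebraMap ℂ (Module.End ℂ W) μ *
          (T₁ (psum sigmaS a) * T₂ (psum sigmaS a) * T₃ (psum sigmaS a))) := by
  obtain ⟨K, h1, h2, h3⟩ : ∃ K, PowBound K q (e x) ∧ PowBound K q (e y) ∧ PowBound K q (e z) := by
    rw [hx, hy, hz]
    obtain ⟨K₁, h1⟩ := ha.map T₁ hT₁
    obtain ⟨K₂, h2⟩ := ha.map T₂ hT₂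
    obtain ⟨K₃, h3⟩ := ha.map T₃ hT₃
    exact ⟨max K₁ (max K₂ K₃), h1.of_le hq (le_max_left _ _),
      h2.of_le hq ((le_max_left _ _).trans (le_max_right _ _)),
      h3.of_le hq ((le_max_right _ _).trans (le_max_right _ _))⟩
  have hneg : ∀ {u : S}, PowBound K q (e u) → PowBound K q (e (-u)) := fun h => by
    rw [map_neg]; exact h.neg
  obtain ⟨b₁, hb₁⟩ := h2.exists_ev_del (hneg h3) hf hq hqq
  obtain ⟨b₂, hb₂⟩ := h3.exists_ev_del (hneg h1) hf hq hqq
  obtain ⟨b₃, hb₃⟩ := h1.exists_ev_del (hneg h2) hf hq hqq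
  have r₁ : Ev e (ser x f) (T₁ (psum f a)) := ha.ev_ser_map hf hq hqq T₁ hT₁ hx
  have r₂ : Ev e (ser y f) (T₂ (psum f a)) := ha.ev_ser_map hf hq hqq T₂ hT₂ hy
  have r₃ : Ev e (ser z f) (T₃ (psum f a)) := ha.ev_ser_map hf hq hqq T₃ hT₃ hz
  have hs : ∀ {g : ℂ⟦X⟧}, IsEntire g → Ev e (ser x g) (T₁ (psum g a)) ∧
      Ev e (ser y g) (T₂ (psum g a)) ∧ Ev e (ser z g) (T₃ (psum g a)) := fun hg =>
    ⟨hg.ev_ser_map T₁ hT₁ hx, hg.ev_ser_map T₂ hT₂ hy, hg.ev_ser_map T₃ hT₃ hz⟩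
  obtain ⟨s₁, s₂, s₃⟩ := hs isEntire_sigmaS
  obtain ⟨c₁, c₂, c₃⟩ := hs (isEntire_coshS (1 / 2))
  exact ⟨b₁, b₂, b₃, hb₁, hb₂, hb₃,
    ((((((r₁.mul s₁).mul (r₂.mul s₂)).mul s₃).sub (hb₁.mul (c₁.mul (s₂.mul s₃)))).add
    ((((r₂.mul s₂).mul (r₃.mul s₃)).mul s₁).sub (hb₂.mul (c₂.mul (s₃.mul s₁))))).add
    ((((r₃.mul s₃).mul (r₁.mul s₁)).mul s₂).sub (hb₃.mul (c₃.mul (s₁.mul s₂))))).sub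
    ((ev_const (e := e) μ).mul ((s₁.mul s₂).mul s₃))⟩

end Transfer

/-! ### The invariant form and the PL-CDYBE as an evaluated series. -/

section Form

variable {𝔤 : Type*} [LieRing 𝔤] [LieAlgebra ℂ 𝔤] {B : LinearMap.BilinForm ℂ 𝔤}

/-- The functional `X ⊗ Y ⊗ Z ↦ ⟨[X, Y], Z⟩`. -/
def triple (B : LinearMap.BilinForm ℂ 𝔤) : 𝔤 ⊗[ℂ] (𝔤 ⊗[ℂ] 𝔤) →ₗ[ℂ] ℂ :=
  TensorProduct.lift ((TensorProduct.lift.equiv (RingHom.id ℂ) 𝔤 𝔤 ℂ).toLinearMap ∘ₗ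
    ((LieAlgebra.ad ℂ 𝔤 : 𝔤 →ₗ[ℂ] 𝔤 →ₗ[ℂ] 𝔤).compr₂ B))

lemma triple_tmul (X Y Z : 𝔤) : triple B (X ⊗ₜ[ℂ] (Y ⊗ₜ[ℂ] Z)) = B ⁅X, Y⁆ Z := rfl

lemma form_cyclic (hsymm : ∀ x y : 𝔤, B x y = B y x)
    (hinv : ∀ x y z : 𝔤, B ⁅x, y⁆ z = B x ⁅y, z⁆) (X Y Z : 𝔤) : B ⁅X, Y⁆ Z = B ⁅Y, Z⁆ X := by
  rw [hinv, hsymm]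

lemma form_ad_left (hinv : ∀ x y z : 𝔤, B ⁅x, y⁆ z = B x ⁅y, z⁆) (ω X Y : 𝔤) :
    B ⁅ω, X⁆ Y = -B X ⁅ω, Y⁆ := by
  rw [← lie_skew, map_neg, LinearMap.neg_apply, hinv]

lemma form_ad_pow (hinv : ∀ x y z : 𝔤, B ⁅x, y⁆ z = B x ⁅y, z⁆) (ω X Y : 𝔤) (k : ℕ) :
    B (((LieAlgebra.ad ℂ 𝔤 ω) ^ k) X) Y = B X (((-LieAlgebra.ad ℂ 𝔤 ω) ^ k) Y) := by
  induction k generalizing X Y with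
  | zero => rfl
  | succ k ih =>
    rw [pow_succ', Module.End.mul_apply, LieAlgebra.ad_apply, form_ad_left hinv, ih, pow_succ,
      Module.End.mul_apply, LinearMap.neg_apply, LieAlgebra.ad_apply, map_neg, map_neg]

lemma triple_invariant (hinv : ∀ x y z : 𝔤, B ⁅x, y⁆ z = B x ⁅y, z⁆) (ω : 𝔤) :
    triple B ∘ₗ (op₁ (LieAlgebra.ad ℂ 𝔤 ω) + op₂ (LieAlgebra.ad ℂ 𝔤 ω) +
      op₃ (LieAlgebra.ad ℂ 𝔤 ω)) = 0 := by
  refine tensor_ext fun X Y Z => ?_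
  simp only [LinearMap.comp_apply, LinearMap.add_apply, map_add, op₁_tmul, op₂_tmul, op₃_tmul,
    triple_tmul, LieAlgebra.ad_apply, LinearMap.zero_apply]
  have h := form_ad_left hinv ω ⁅X, Y⁆ Z
  rw [leibniz_lie, map_add, LinearMap.add_apply] at h
  rw [h]
  ring

variable [FiniteDimensional ℂ 𝔤]

/-- `pdel` is a series in `A ^ i * ad W * A ^ j`. The right power acts on `Y`, and the left one
moves to `Z` with a sign as `A` is skew. This is why `plSeries` has divided differences at `(y,
-z)`. -/
lemma PowBound.triple_del {ω : 𝔤} {C q q' : ℝ} {f : ℂ⟦X⟧}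
    (ha : PowBound C q (LieAlgebra.ad ℂ 𝔤 ω)) (hf : CoeffBound f q') (hq : 0 ≤ q) (hqq : q < q')
    (hinv : ∀ x y z : 𝔤, B ⁅x, y⁆ z = B x ⁅y, z⁆)
    {S : Type*} [CommRing S] [Algebra ℂ S] {e : S →ₐ[ℂ] Module.End ℂ (𝔤 ⊗[ℂ] (𝔤 ⊗[ℂ] 𝔤))} {x y : S}
    {b : Module.End ℂ (𝔤 ⊗[ℂ] (𝔤 ⊗[ℂ] 𝔤))} (hb : Ev e (del f x y) b) {t : 𝔤 ⊗[ℂ] (𝔤 ⊗[ℂ] 𝔤)}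
    {W Y Z : 𝔤} (h : ∀ i j, triple B (e (x ^ i * y ^ j) t) =
      B ⁅W, ((LieAlgebra.ad ℂ 𝔤 ω) ^ i) Y⁆ (((-LieAlgebra.ad ℂ 𝔤 ω) ^ j) Z)) :
    triple B (b t) = B (pdel f (LieAlgebra.ad ℂ 𝔤 ω) (LieAlgebra.ad ℂ 𝔤 ω)
      (LieAlgebra.ad ℂ 𝔤 W) Y) Z := by
  have h1 := (ha.hasSum_pdel ha hf hq hqq).mapL ((LinearMap.toContinuousLinearMap
    (B.flip Z ∘ₗ LinearMap.applyₗ Y : Module.End ℂ 𝔤 →ₗ[ℂ] ℂ)).comp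
      (ContinuousLinearMap.apply ℂ (Module.End ℂ 𝔤) (LieAlgebra.ad ℂ 𝔤 W)))
  refine (hb.hasSum_apply (triple B) t).unique (h1.congr_fun fun k => ?_)
  rw [coeff_del, map_mul, AlgHom.commutes, ← Algebra.smul_def, map_sum, LinearMap.smul_apply,
    LinearMap.sum_apply, map_smul, map_sum]
  simp only [h]
  have h2 : pdelTerm f (LieAlgebra.ad ℂ 𝔤 ω) (LieAlgebra.ad ℂ 𝔤 ω) k (LieAlgebra.ad ℂ 𝔤 W) =
      coeff (k + 1) f • ∑ ij ∈ Finset.HasAntidiagonal.antidiagonal k,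
        (LieAlgebra.ad ℂ 𝔤 ω) ^ ij.2 * LieAlgebra.ad ℂ 𝔤 W * (LieAlgebra.ad ℂ 𝔤 ω) ^ ij.1 := by
    rw [← Finset.Nat.sum_antidiagonal_swap]
    simp [pdelTerm]
  change _ = B ((pdelTerm f (LieAlgebra.ad ℂ 𝔤 ω) (LieAlgebra.ad ℂ 𝔤 ω) k
    (LieAlgebra.ad ℂ 𝔤 W)) Y) Z
  rw [h2, LinearMap.smul_apply, LinearMap.sum_apply, map_smul, map_sum, LinearMap.smul_apply,
    LinearMap.sum_apply]
  simp only [Module.End.mul_apply, form_ad_pow hinv, LieAlgebra.ad_apply]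

/-- The left-hand side of the PL-CDYBE minus its right-hand side, in terms of the preimages
`X, Y, Z` of the arguments under `σ(ad_ω)`. -/
def plForm (B : LinearMap.BilinForm ℂ 𝔤) (f : ℂ⟦X⟧) (μ : ℂ) (ω X Y Z : 𝔤) : ℂ :=
  let A := LieAlgebra.ad ℂ 𝔤 ω
  let r : Module.End ℂ 𝔤 := psum f A
  let s : Module.End ℂ 𝔤 := psum sigmaS A
  let c : Module.End ℂ 𝔤 := psum (coshS (1 / 2)) A
  (B ⁅r (s X), r (s Y)⁆ (s Z) - B (pdel f A A (LieAlgebra.ad ℂ 𝔤 (c X)) (s Y)) (s Z)) +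
    (B ⁅r (s Y), r (s Z)⁆ (s X) - B (pdel f A A (LieAlgebra.ad ℂ 𝔤 (c Y)) (s Z)) (s X)) +
    (B ⁅r (s Z), r (s X)⁆ (s Y) - B (pdel f A A (LieAlgebra.ad ℂ 𝔤 (c Z)) (s X)) (s Y)) -
    μ * B ⁅s X, s Y⁆ (s Z)

/-- The value of the formal equation at the three actions of `ad_ω` on the form `⟨[X, Y], Z⟩`. -/
theorem PowBound.hasSum_plSeries {ω : 𝔤} {C q q' : ℝ} {f : ℂ⟦X⟧}
    (ha : PowBound C q (LieAlgebra.ad ℂ 𝔤 ω)) (hf : CoeffBound f q') (hq : 0 ≤ q) (hqq : q < q')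
    (hsymm : ∀ x y : 𝔤, B x y = B y x)
    (hinv : ∀ x y z : 𝔤, B ⁅x, y⁆ z = B x ⁅y, z⁆) (μ : ℂ)
    {S : Type*} [CommRing S] [Algebra ℂ S] {e : S →ₐ[ℂ] Module.End ℂ (𝔤 ⊗[ℂ] (𝔤 ⊗[ℂ] 𝔤))}
    {x y z : S} (hx : e x = op₁ (LieAlgebra.ad ℂ 𝔤 ω)) (hy : e y = op₂ (LieAlgebra.ad ℂ 𝔤 ω))
    (hz : e z = op₃ (LieAlgebra.ad ℂ 𝔤 ω)) (X Y Z : 𝔤) :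
    HasSum (fun k => triple B (e (coeff k (plSeries f μ x y z)) (X ⊗ₜ[ℂ] (Y ⊗ₜ[ℂ] Z))))
      (plForm B f μ ω X Y Z) := by
  set A := LieAlgebra.ad ℂ 𝔤 ω with hA
  obtain ⟨b₁, b₂, b₃, hb₁, hb₂, hb₃, key⟩ :=
    ha.exists_ev_plSeries hf hq hqq μ (op₁_pow A) (op₂_pow A) (op₃_pow A) hx hy hz
  have hx' : ∀ i, e (x ^ i) = op₁ (A ^ i) := fun i => by rw [map_pow, hx, op₁_pow]
  have hy' : ∀ i, e (y ^ i) = op₂ (A ^ i) := fun i => by rw [map_pow, hy, op₂_pow]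
  have hz' : ∀ i, e (z ^ i) = op₃ (A ^ i) := fun i => by rw [map_pow, hz, op₃_pow]
  have hx'' : ∀ i, e ((-x) ^ i) = op₁ ((-A) ^ i) := fun i => by
    rw [map_pow, map_neg, hx, op₁_pow, map_neg]
  have hy'' : ∀ i, e ((-y) ^ i) = op₂ ((-A) ^ i) := fun i => by
    rw [map_pow, map_neg, hy, op₂_pow, map_neg]
  have hz'' : ∀ i, e ((-z) ^ i) = op₃ ((-A) ^ i) := fun i => by
    rw [map_pow, map_neg, hz, op₃_pow, map_neg]
  have d₁ : ∀ U V W : 𝔤, triple B (b₁ (U ⊗ₜ[ℂ] (V ⊗ₜ[ℂ] W))) =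
      B (pdel f A A (LieAlgebra.ad ℂ 𝔤 U) V) W := fun U V W =>
    ha.triple_del hf hq hqq hinv hb₁ fun i j => by
      rw [map_mul, hy', hz'', Module.End.mul_apply, op₃_tmul, op₂_tmul, triple_tmul]
  have d₂ : ∀ U V W : 𝔤, triple B (b₂ (U ⊗ₜ[ℂ] (V ⊗ₜ[ℂ] W))) =
      B (pdel f A A (LieAlgebra.ad ℂ 𝔤 V) W) U := fun U V W =>
    ha.triple_del hf hq hqq hinv hb₂ fun i j => by
      rw [map_mul, hz', hx'', Module.End.mul_apply, op₁_tmul, op₃_tmul, triple_tmul,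
        form_cyclic hsymm hinv]
  have d₃ : ∀ U V W : 𝔤, triple B (b₃ (U ⊗ₜ[ℂ] (V ⊗ₜ[ℂ] W))) =
      B (pdel f A A (LieAlgebra.ad ℂ 𝔤 W) U) V := fun U V W =>
    ha.triple_del hf hq hqq hinv hb₃ fun i j => by
      rw [map_mul, hx', hy'', Module.End.mul_apply, op₂_tmul, op₁_tmul, triple_tmul,
        form_cyclic hsymm hinv, form_cyclic hsymm hinv]
  have h := key.hasSum_apply (triple B) (X ⊗ₜ[ℂ] (Y ⊗ₜ[ℂ] Z))
  simp only [LinearMap.sub_apply, LinearMap.add_apply, Module.End.mul_apply, op₁_tmul, op₂_tmul,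
    op₃_tmul, map_sub, map_add, d₁, d₂, d₃, triple_tmul, Module.algebraMap_end_apply, map_smul,
    smul_eq_mul] at h
  rwa [form_cyclic hsymm hinv _ _ ((psum f A : Module.End ℂ 𝔤) _),
    ← form_cyclic hsymm hinv ((psum f A : Module.End ℂ 𝔤) _)] at h

end Form

/-! ### A nonzero adjoint eigenvalue. -/

section Engel

/-- If every root of the minimal polynomial is `0`, it is a power of the variable, so `f` is
nilpotent. -/
lemma exists_eigenvalue_ne_zero {V : Type*} [AddCommGroup V] [Module ℂ V] [FiniteDimensional ℂ V]
    {f : Module.End ℂ V} (hf : ¬IsNilpotent f) : ∃ c, c ≠ 0 ∧ f.HasEigenvalue c := by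
  by_contra! h
  have h1 : ∀ c ∈ (minpoly ℂ f).roots, c = 0 := fun c hc => by
    by_contra h0
    exact h c h0 (Module.End.hasEigenvalue_of_isRoot (Polynomial.isRoot_of_mem_roots hc))
  have h2 := (IsAlgClosed.splits (minpoly ℂ f)).eq_prod_roots_of_monic
    (minpoly.monic (Algebra.IsIntegral.isIntegral f))
  rw [Multiset.eq_replicate_card.mpr h1, Multiset.map_replicate, Multiset.prod_replicate, map_zero,
    sub_zero] at h2
  exact hf ⟨_, by rw [← Polynomial.aeval_X_pow (R := ℂ) f, ← h2, minpoly.aeval]⟩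

/-- A simple Lie algebra has an element with a nonzero adjoint eigenvalue. -/
lemma exists_ad_hasEigenvalue_ne_zero (𝔤 : Type*) [LieRing 𝔤] [LieAlgebra ℂ 𝔤]
    [FiniteDimensional ℂ 𝔤] [LieAlgebra.IsSimple ℂ 𝔤] :
    ∃ (ω : 𝔤) (c : ℂ), c ≠ 0 ∧ (LieAlgebra.ad ℂ 𝔤 ω).HasEigenvalue c := by
  by_contra! h
  -- By Engel's theorem the algebra would be nilpotent, hence solvable and equal to its radical,
  -- which is zero.
  have h1 : LieRing.IsNilpotent 𝔤 := (LieAlgebra.isNilpotent_iff_forall (R := ℂ)).mpr fun ω => by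
    by_contra hω
    obtain ⟨c, hc, hc'⟩ := exists_eigenvalue_ne_zero hω
    exact h ω c hc hc'
  have h2 : LieAlgebra.IsSolvable 𝔤 := inferInstance
  have h3 : LieAlgebra.radical ℂ 𝔤 = ⊤ := LieAlgebra.radical_eq_top_of_isSolvable ℂ 𝔤
  rw [LieAlgebra.HasTrivialRadical.radical_eq_bot] at h3
  refine LieAlgebra.IsSimple.non_abelian (R := ℂ) (L := 𝔤) ⟨fun x y => ?_⟩
  have h4 : ⁅x, y⁆ ∈ (⊥ : LieIdeal ℂ 𝔤) := h3 ▸ LieSubmodule.mem_top _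
  simpa using h4

/-- Invariance gives `⟨[X, Y], ω⟩ = ⟨[ω, X], Y⟩ = c ⟨X, Y⟩`, and nondegeneracy provides a suitable
`Y`. -/
lemma exists_form_lie_ne_zero {𝔤 : Type*} [LieRing 𝔤] [LieAlgebra ℂ 𝔤]
    [FiniteDimensional ℂ 𝔤] [LieAlgebra.IsSimple ℂ 𝔤] {B : LinearMap.BilinForm ℂ 𝔤}
    (hnondeg : B.Nondegenerate)
    (hinv : ∀ x y z : 𝔤, B ⁅x, y⁆ z = B x ⁅y, z⁆) :
    ∃ (ω X Y : 𝔤) (c : ℂ), c ≠ 0 ∧ ⁅ω, X⁆ = c • X ∧ B ⁅X, Y⁆ ω ≠ 0 := by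
  obtain ⟨ω, c, hc, h⟩ := exists_ad_hasEigenvalue_ne_zero 𝔤
  obtain ⟨X, hX⟩ := h.exists_hasEigenvector
  obtain ⟨Y, hY⟩ : ∃ Y, B X Y ≠ 0 := by
    by_contra! h
    exact hX.2 (hnondeg.1 X h)
  have h1 : ⁅ω, X⁆ = c • X := hX.apply_eq_smul
  refine ⟨ω, X, Y, c, hc, h1, ?_⟩
  have h2 := form_ad_left hinv ω X Y
  rw [← map_neg, lie_skew, ← hinv, h1, map_smul, LinearMap.smul_apply, smul_eq_mul] at h2
  rw [← h2]
  exact mul_ne_zero hc hY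

end Engel

/-- The coefficient of `t ^ k` is homogeneous of degree `k` in `x, y, z`. Thus the values at `(z,
-z, 0)` come from one power series, the one at `(1, -1, 0)`. -/
lemma rescale_plSeries {S : Type*} [CommRing S] [Algebra ℂ S] (f : ℂ⟦X⟧) (μ : ℂ) (c x y z : S) :
    rescale c (plSeries f μ x y z) = plSeries f μ (c * x) (c * y) (c * z) := by
  simp only [plSeries, map_sub, map_add, map_mul, rescale_ser, rescale_del, mul_neg]
  congr 2
  ext k
  rw [coeff_rescale, coeff_C]
  split_ifs with h <;> simp [h]

/-! ### The PL-CDYBE as a condition on the Taylor series. -/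

section Lie

variable {𝔤 : Type*} [LieRing 𝔤] [LieAlgebra ℂ 𝔤] {n : ℕ}
  {ρ : 𝔤 →ₗ⁅ℂ⁆ Matrix (Fin n) (Fin n) ℂ} [TopologicalSpace 𝔤]
  {U : Set 𝔤} {F : ℂ → ℂ} {R : linGroup ρ → Module.End ℂ 𝔤} {B : LinearMap.BilinForm ℂ 𝔤}

lemma IsDPlus.unique [T2Space 𝔤] {Ω : linGroup ρ} {X : 𝔤} {D D' : Module.End ℂ 𝔤}
    (h : IsDPlus ρ R Ω X D) (h' : IsDPlus ρ R Ω X D') : D = D' :=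
  LinearMap.ext fun Y => (h Y).unique (h' Y)

variable [FiniteDimensional ℂ 𝔤] [IsTopologicalAddGroup 𝔤] [ContinuousSMul ℂ 𝔤] [T2Space 𝔤]

/-- `D` is built with the inverse of `σ(ad_ω)`. Its linearity in `X` serves the contraction with
dual bases, its form as a divided difference the proof of skewness. -/
lemma IsAnsatz.exists_isDPlus [Nontrivial 𝔤] (hR : IsAnsatz ρ U F R) (hU : IsExpDomain ρ U)
    (hρ : Function.Injective ρ) (hF : AnalyticAt ℂ F 0) {ω : 𝔤} (hω : ω ∈ U) :
    ∃ D : 𝔤 →ₗ[ℂ] Module.End ℂ 𝔤, (∀ X, IsDPlus ρ R (expG ρ ω) X (D X)) ∧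
      ∀ X, ∃ W, D X = pdel (taylor F) (LieAlgebra.ad ℂ 𝔤 ω) (LieAlgebra.ad ℂ 𝔤 ω)
        (LieAlgebra.ad ℂ 𝔤 W) := by
  have hs := hU.surjective_sigma hω
  let s := LinearEquiv.ofBijective _ ⟨LinearMap.injective_iff_surjective.mpr hs, hs⟩
  refine ⟨(pdel (taylor F) (LieAlgebra.ad ℂ 𝔤 ω) (LieAlgebra.ad ℂ 𝔤 ω)).toLinearMap ∘ₗ
    (LieAlgebra.ad ℂ 𝔤 : 𝔤 →ₗ[ℂ] Module.End ℂ 𝔤) ∘ₗ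
    ((2 : ℂ) • (psum (coshS (1 / 2)) (LieAlgebra.ad ℂ 𝔤 ω) : Module.End ℂ 𝔤)) ∘ₗ
    s.symm.toLinearMap, fun X => ?_, fun X => ⟨_, rfl⟩⟩
  have h := hR.isDPlus hU hρ hF hω (s.symm X)
  rwa [show (psum sigmaS (LieAlgebra.ad ℂ 𝔤 ω) : Module.End ℂ 𝔤) (s.symm X) = X from
    s.apply_symm_apply X] at h

/-- The left-hand side of the PL-CDYBE in operator form. -/
def plOperator (B : LinearMap.BilinForm ℂ 𝔤) (A : Module.End ℂ 𝔤) (D : 𝔤 → Module.End ℂ 𝔤)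
    (X Y Z : 𝔤) : ℂ :=
  B (⁅A X, A Y⁆ - (1 / 2 : ℂ) • D X Y) Z + B (⁅A Y, A Z⁆ - (1 / 2 : ℂ) • D Y Z) X +
    B (⁅A Z, A X⁆ - (1 / 2 : ℂ) • D Z X) Y

/-- The PL-CDYBE at `e^ω` in terms of the preimages of the arguments under `σ(ad_ω)`. -/
lemma plOperator_eq_iff [Nontrivial 𝔤] (hR : IsAnsatz ρ U F R) (hU : IsExpDomain ρ U)
    (hρ : Function.Injective ρ) (hF : AnalyticAt ℂ F 0) (μ : ℂ) {ω : 𝔤} (hω : ω ∈ U)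
    {D : 𝔤 → Module.End ℂ 𝔤} (hD : ∀ X, IsDPlus ρ R (expG ρ ω) X (D X)) :
    (∀ X Y Z, plOperator B (R (expG ρ ω)) D X Y Z = μ * B ⁅X, Y⁆ Z) ↔
      ∀ X Y Z, plForm B (taylor F) μ ω X Y Z = 0 := by
  have key : ∀ X Y Z : 𝔤, plForm B (taylor F) μ ω X Y Z =
      let s : Module.End ℂ 𝔤 := psum sigmaS (LieAlgebra.ad ℂ 𝔤 ω)
      plOperator B (R (expG ρ ω)) D (s X) (s Y) (s Z) - μ * B ⁅s X, s Y⁆ (s Z) := by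
    intro X Y Z
    have hD' : ∀ W, D ((psum sigmaS (LieAlgebra.ad ℂ 𝔤 ω) : Module.End ℂ 𝔤) W) =
        (2 : ℂ) • pdel (taylor F) (LieAlgebra.ad ℂ 𝔤 ω) (LieAlgebra.ad ℂ 𝔤 ω) (LieAlgebra.ad ℂ 𝔤
          ((psum (coshS (1 / 2)) (LieAlgebra.ad ℂ 𝔤 ω) : Module.End ℂ 𝔤) W)) := fun W => by
      rw [(hD _).unique (hR.isDPlus hU hρ hF hω W), map_smul, map_smul]
    simp only [plForm, plOperator, hD', hR.eq_psum hU.isOpen hF hω, LinearMap.smul_apply, smul_smul]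
    norm_num
  constructor
  · intro h X Y Z
    rw [key]
    exact sub_eq_zero.mpr (h _ _ _)
  · intro h X Y Z
    choose W hW using hU.surjective_sigma hω
    have h1 := (key (W X) (W Y) (W Z)).symm.trans (h _ _ _)
    simp only [hW] at h1
    exact sub_eq_zero.mp h1

lemma solves_iff [Nontrivial 𝔤] (hR : IsAnsatz ρ U F R) (hU : IsExpDomain ρ U)
    (hρ : Function.Injective ρ) (hF : AnalyticAt ℂ F 0) (μ : ℂ) :
    SolvesPLCDYBE B ρ U R μ ↔ ∀ ω ∈ U, ∀ X Y Z, plForm B (taylor F) μ ω X Y Z = 0 := by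
  constructor
  · intro h ω hω
    obtain ⟨D, hD, hD'⟩ := h _ ⟨ω, hω, rfl⟩
    exact (plOperator_eq_iff hR hU hρ hF μ hω hD).mp hD'
  · rintro h _ ⟨ω, hω, rfl⟩
    obtain ⟨D, hD, -⟩ := hR.exists_isDPlus hU hρ hF hω
    exact ⟨D, hD, (plOperator_eq_iff hR hU hρ hF μ hω hD).mpr (h ω hω)⟩

/-- The formal identity requires `z = -x - y`, which fails for the three actions on the tensor
product but holds under the invariant form, by `apply_substSum`. -/
lemma plForm_eq_zero [Nontrivial 𝔤] (hR : IsAnsatz ρ U F R) (hU : IsOpen U)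
    (hF : AnalyticAt ℂ F 0) (hodd : ∀ᶠ z in 𝓝 (0 : ℂ), F (-z) = -F z)
    (hsymm : ∀ x y : 𝔤, B x y = B y x) (hinv : ∀ x y z : 𝔤, B ⁅x, y⁆ z = B x ⁅y, z⁆) {ν : ℂ}
    (hν : IsFnuSeries (taylor F) ν) {ω : 𝔤} (hω : ω ∈ U) (X Y Z : 𝔤) :
    plForm B (taylor F) (1 / 4 - ν ^ 2) ω X Y Z = 0 := by
  obtain ⟨q, q', C, hq, hqq, hf, hb⟩ := hR.exists_powBound hU hF hω
  obtain ⟨e, h0, h1, h2⟩ := exists_algHom_tensor (LieAlgebra.ad ℂ 𝔤 ω)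
  have h := hb.self_of_nhds.hasSum_plSeries hf hq hqq hsymm hinv (1 / 4 - ν ^ 2) h0 h1 h2 X Y Z
  have h3 : PowerSeries.map (substSum : MvPolynomial (Fin 3) ℂ →+* MvPolynomial (Fin 3) ℂ)
      (plSeries (taylor F) (1 / 4 - ν ^ 2) (MvPolynomial.X 0) (MvPolynomial.X 1)
        (MvPolynomial.X 2)) = 0 := by
    have e0 : substSum (MvPolynomial.X 0) = MvPolynomial.X 0 := by simp [substSum]
    have e1 : substSum (MvPolynomial.X 1) = MvPolynomial.X 1 := by simp [substSum]
    have e2 : substSum (MvPolynomial.X 2) = -MvPolynomial.X 0 - MvPolynomial.X 1 := by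
      simp [substSum]
    rw [map_plSeries, e0, e1, e2]
    refine plSeries_eq_zero (coeff_taylor_even hF hodd) hν (MvPolynomial.X_ne_zero 0)
      (MvPolynomial.X_ne_zero 1) fun h => ?_
    have := congrArg (MvPolynomial.aeval ![(1 : ℂ), 0, 0]) h
    simp at this
  refine h.unique (hasSum_zero.congr_fun fun k => ?_)
  rw [apply_substSum h0 h1 h2 (triple_invariant hinv ω)]
  have h4 := congrArg (coeff k) h3
  rw [coeff_map] at h4
  have h5 : substSum (coeff k (plSeries (taylor F) (1 / 4 - ν ^ 2)
      (MvPolynomial.X 0) (MvPolynomial.X 1) (MvPolynomial.X 2))) = 0 := h4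
  rw [h5]
  simp

/-- Along the line `ω = (z / c) ω₀`, with third argument `ω₀` and first argument an eigenvector, the
three actions take the values `z, -z, 0`. Since `⟨[X, Y], ω₀⟩ ≠ 0`, the series in `z` itself must
vanish. -/
lemma isFnuSeries_of_plForm [LieAlgebra.IsSimple ℂ 𝔤] [Nontrivial 𝔤] (hR : IsAnsatz ρ U F R)
    (hU : IsExpDomain ρ U)
    (hF : AnalyticAt ℂ F 0) (hodd : ∀ᶠ z in 𝓝 (0 : ℂ), F (-z) = -F z)
    (hsymm : ∀ x y : 𝔤, B x y = B y x) (hnondeg : B.Nondegenerate)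
    (hinv : ∀ x y z : 𝔤, B ⁅x, y⁆ z = B x ⁅y, z⁆) {μ ν : ℂ} (hμ : μ = 1 / 4 - ν ^ 2)
    (h : ∀ ω ∈ U, ∀ X Y Z, plForm B (taylor F) μ ω X Y Z = 0) : IsFnuSeries (taylor F) ν := by
  obtain ⟨ω₀, X, Y, c, hc, hX, hne⟩ := exists_form_lie_ne_zero hnondeg hinv
  refine isFnuSeries_of_riccati hμ (riccati_of_plSeries (coeff_taylor_even hF hodd) ?_)
  have hz : ∀ᶠ z in 𝓝 (0 : ℂ), (z / c) • ω₀ ∈ U := by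
    have hcont : Continuous fun z : ℂ => (z / c) • ω₀ := by fun_prop
    exact hcont.continuousAt.eventually (hU.isOpen.mem_nhds (by simpa using hU.zero_mem))
  have hrep : Rep (fun _ => 0) (plSeries (taylor F) μ (1 : ℂ) (-1) 0) := by
    refine rep_iff_hasSum.mpr (hz.mono fun z hz => ?_)
    obtain ⟨q, q', C, hq, hqq, hf, hb⟩ := hR.exists_powBound hU.isOpen hF hz
    obtain ⟨e, h0, h1, h2⟩ := exists_algHom_tensor (LieAlgebra.ad ℂ 𝔤 ((z / c) • ω₀))
    have h3 := hb.self_of_nhds.hasSum_plSeries hf hq hqq hsymm hinv μ h0 h1 h2 X Y ω₀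
    rw [h _ hz] at h3
    have hX' : LieAlgebra.ad ℂ 𝔤 ((z / c) • ω₀) X = z • X := by
      rw [LieAlgebra.ad_apply, smul_lie, hX, smul_smul, div_mul_cancel₀ _ hc]
    have hω : LieAlgebra.ad ℂ 𝔤 ((z / c) • ω₀) ω₀ = 0 := by
      rw [LieAlgebra.ad_apply, smul_lie, lie_self, smul_zero]
    simp only [apply_eigenvector h0 h1 h2 (triple_invariant hinv _) hX' hω] at h3
    have h4 := h3.div_const (triple B (X ⊗ₜ[ℂ] (Y ⊗ₜ[ℂ] ω₀)))
    rw [zero_div] at h4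
    refine h4.congr_fun fun k => ?_
    rw [mul_div_cancel_right₀ _ (by rwa [triple_tmul])]
    have h5 : PowerSeries.map ((MvPolynomial.aeval ![z, -z, 0] : MvPolynomial (Fin 3) ℂ →ₐ[ℂ] ℂ) :
        MvPolynomial (Fin 3) ℂ →+* ℂ)
        (plSeries (taylor F) μ (MvPolynomial.X 0) (MvPolynomial.X 1) (MvPolynomial.X 2)) =
        rescale z (plSeries (taylor F) μ 1 (-1) 0) := by
      rw [map_plSeries, rescale_plSeries]
      simp
    have h6 := congrArg (coeff k) h5
    rw [coeff_map, coeff_rescale, mul_comm] at h6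
    exact h6.symm
  refine hrep.unique ?_
  simpa using rep_const 0

end Lie

/-! ### The equation at the identity, and skewness of the derivative. -/

section Origin

variable {𝓐 : Type*} [NormedRing 𝓐] [NormedAlgebra ℂ 𝓐]

lemma psum_zero (f : ℂ⟦X⟧) : psum f (0 : 𝓐) = coeff 0 f • 1 := by
  rw [psum, tsum_eq_single 0 fun k hk => by rw [zero_pow hk, smul_zero], pow_zero]

lemma pdel_zero_apply (f : ℂ⟦X⟧) (v : 𝓐) : pdel f 0 0 v = coeff 1 f • v := by
  rw [pdel, tsum_eq_single 0]
  · simp [pdelTerm]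
  · intro k hk
    rw [pdelTerm, Finset.sum_eq_zero, smul_zero]
    intro ij hij
    have h : ij.1 ≠ 0 ∨ ij.2 ≠ 0 := by
      have := Finset.HasAntidiagonal.mem_antidiagonal.mp hij
      omega
    ext u
    rcases h with h | h <;> simp [h]

variable {𝔤 : Type*} [LieRing 𝔤] [LieAlgebra ℂ 𝔤] {B : LinearMap.BilinForm ℂ 𝔤}
  [FiniteDimensional ℂ 𝔤]

/-- At `ω = 0` the brackets vanish with `f(0)`, and each of the three derivative terms contributes
`-f'(0) ⟨[X, Y], Z⟩`. -/
lemma plForm_origin (hsymm : ∀ x y : 𝔤, B x y = B y x)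
    (hinv : ∀ x y z : 𝔤, B ⁅x, y⁆ z = B x ⁅y, z⁆) {f : ℂ⟦X⟧} (hf : coeff 0 f = 0) (X Y Z : 𝔤) :
    plForm B f (-3 * coeff 1 f) 0 X Y Z = 0 := by
  have h1 : coeff 0 sigmaS = 1 := by
    rw [coeff_zero_eq_constantCoeff_apply, constantCoeff_sigmaS]
  have h2 : coeff 0 (coshS (1 / 2)) = 1 := by
    rw [coeff_zero_eq_constantCoeff_apply, constantCoeff_coshS]
  simp only [plForm, map_zero, psum_zero, pdel_zero_apply, hf, h1, h2, zero_smul, one_smul,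
    LinearMap.zero_apply, Module.End.one_apply, zero_lie, LinearMap.smul_apply, map_smul,
    LieAlgebra.ad_apply, smul_eq_mul]
  rw [← form_cyclic hsymm hinv X Y Z, form_cyclic hsymm hinv Z X Y]
  ring

/-- The adjoint of `A ^ i * ad W * A ^ j` is `(-1) ^ (i + j + 1)` times `A ^ j * ad W * A ^ i`, and
for odd `f` only even `i + j` occur. -/
lemma PowBound.form_pdel_skew {ω : 𝔤} {C q q' : ℝ} {f : ℂ⟦X⟧}
    (ha : PowBound C q (LieAlgebra.ad ℂ 𝔤 ω)) (hf : CoeffBound f q') (hq : 0 ≤ q) (hqq : q < q')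
    (hinv : ∀ x y z : 𝔤, B ⁅x, y⁆ z = B x ⁅y, z⁆) (hodd : ∀ k, Even k → coeff k f = 0)
    (W X Y : 𝔤) :
    B (pdel f (LieAlgebra.ad ℂ 𝔤 ω) (LieAlgebra.ad ℂ 𝔤 ω) (LieAlgebra.ad ℂ 𝔤 W) X) Y =
      -B X (pdel f (LieAlgebra.ad ℂ 𝔤 ω) (LieAlgebra.ad ℂ 𝔤 ω) (LieAlgebra.ad ℂ 𝔤 W) Y) := by
  have h := (ha.hasSum_pdel ha hf hq hqq)
  have h1 := h.mapL ((LinearMap.toContinuousLinearMap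
    (B.flip Y ∘ₗ LinearMap.applyₗ X : Module.End ℂ 𝔤 →ₗ[ℂ] ℂ)).comp
      (ContinuousLinearMap.apply ℂ (Module.End ℂ 𝔤) (LieAlgebra.ad ℂ 𝔤 W)))
  have h2 := h.mapL ((LinearMap.toContinuousLinearMap
    (B X ∘ₗ LinearMap.applyₗ Y : Module.End ℂ 𝔤 →ₗ[ℂ] ℂ)).comp
      (ContinuousLinearMap.apply ℂ (Module.End ℂ 𝔤) (LieAlgebra.ad ℂ 𝔤 W)))
  refine h1.unique (h2.neg.congr_fun fun k => ?_)
  change B (pdelTerm f (LieAlgebra.ad ℂ 𝔤 ω) (LieAlgebra.ad ℂ 𝔤 ω) k (LieAlgebra.ad ℂ 𝔤 W) X) Y =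
    -B X (pdelTerm f (LieAlgebra.ad ℂ 𝔤 ω) (LieAlgebra.ad ℂ 𝔤 ω) k (LieAlgebra.ad ℂ 𝔤 W) Y)
  rcases Nat.even_or_odd k with hk | hk
  · have e : ∀ i j : ℕ, i + j = k → B (((LieAlgebra.ad ℂ 𝔤 ω) ^ i * LieAlgebra.ad ℂ 𝔤 W *
        (LieAlgebra.ad ℂ 𝔤 ω) ^ j) X) Y = -B X (((LieAlgebra.ad ℂ 𝔤 ω) ^ j *
          LieAlgebra.ad ℂ 𝔤 W * (LieAlgebra.ad ℂ 𝔤 ω) ^ i) Y) := fun i j hij => by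
      have hs : (-1 : ℂ) ^ j * (-1) ^ i = 1 := by
        rw [← pow_add, add_comm, hij, hk.neg_one_pow]
      rw [Module.End.mul_apply, Module.End.mul_apply, form_ad_pow hinv, LieAlgebra.ad_apply,
        form_ad_left hinv, form_ad_pow hinv, ← neg_one_smul ℂ (LieAlgebra.ad ℂ 𝔤 ω), smul_pow,
        smul_pow]
      simp only [LinearMap.smul_apply, map_smul, lie_smul, smul_eq_mul, Module.End.mul_apply,
        LieAlgebra.ad_apply]
      linear_combination
        (-B X (((LieAlgebra.ad ℂ 𝔤 ω) ^ j) ⁅W, ((LieAlgebra.ad ℂ 𝔤 ω) ^ i) Y⁆)) * hs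
    have e1 : ∀ V, pdelTerm f (LieAlgebra.ad ℂ 𝔤 ω) (LieAlgebra.ad ℂ 𝔤 ω) k
        (LieAlgebra.ad ℂ 𝔤 W) V =
        coeff (k + 1) f • ∑ ij ∈ Finset.HasAntidiagonal.antidiagonal k,
          ((LieAlgebra.ad ℂ 𝔤 ω) ^ ij.1 * LieAlgebra.ad ℂ 𝔤 W *
            (LieAlgebra.ad ℂ 𝔤 ω) ^ ij.2) V := by
      intro V
      simp [pdelTerm]
    rw [e1, e1, map_smul, map_smul, LinearMap.smul_apply, ← smul_neg, map_sum, map_sum,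
      LinearMap.sum_apply, ← Finset.sum_neg_distrib,
      ← Finset.Nat.sum_antidiagonal_swap (f := fun ij => -B X _)]
    congr 1
    exact Finset.sum_congr rfl fun ij hij =>
      e _ _ (Finset.HasAntidiagonal.mem_antidiagonal.mp hij)
  · rw [pdelTerm, hodd _ hk.add_one]
    simp

end Origin

/-! ### Comparison of the tensor form and the operator form. -/

section Pairing

variable {𝔤 : Type*} [LieRing 𝔤] [LieAlgebra ℂ 𝔤] {B : LinearMap.BilinForm ℂ 𝔤}
  {ι : Type*} [Fintype ι] [DecidableEq ι] {T T' : Module.Basis ι ℂ 𝔤}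

/-- The functional `x ⊗ y ⊗ z ↦ ⟨X, x⟩ ⟨Y, y⟩ ⟨Z, z⟩`. -/
def pairing (B : LinearMap.BilinForm ℂ 𝔤) (X Y Z : 𝔤) : 𝔤 ⊗[ℂ] (𝔤 ⊗[ℂ] 𝔤) →ₗ[ℂ] ℂ :=
  LinearMap.mul' ℂ ℂ ∘ₗ TensorProduct.map (B X)
    (LinearMap.mul' ℂ ℂ ∘ₗ TensorProduct.map (B Y) (B Z))

lemma pairing_tmul (X Y Z x y z : 𝔤) :
    pairing B X Y Z (x ⊗ₜ[ℂ] (y ⊗ₜ[ℂ] z)) = B X x * (B Y y * B Z z) := rfl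

lemma repr_eq_form (hdual : ∀ a b : ι, B (T a) (T' b) = if a = b then 1 else 0) (a : ι) (x : 𝔤) :
    T'.repr x a = B (T a) x := by
  conv_rhs => rw [← T'.sum_repr x, map_sum]
  simp only [map_smul, hdual, smul_eq_mul]
  rw [Finset.sum_eq_single a] <;> simp +contextual [eq_comm]

lemma sum_form_smul (hsymm : ∀ x y : 𝔤, B x y = B y x)
    (hdual : ∀ a b : ι, B (T a) (T' b) = if a = b then 1 else 0) (x : 𝔤) :
    ∑ a, B x (T' a) • T a = x := by
  conv_rhs => rw [← T.sum_repr x]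
  refine Finset.sum_congr rfl fun a _ => ?_
  congr 1
  exact (repr_eq_form (fun a b => by rw [hsymm, hdual]; simp only [eq_comm]) a x).symm ▸ hsymm _ _

/-- Pairings with the `T a` are the coordinates in the basis built from the dual basis `T'`. -/
lemma eq_of_pairing (hdual : ∀ a b : ι, B (T a) (T' b) = if a = b then 1 else 0)
    {t t' : 𝔤 ⊗[ℂ] (𝔤 ⊗[ℂ] 𝔤)} (h : ∀ X Y Z, pairing B X Y Z t = pairing B X Y Z t') : t = t' := by
  let b := T'.tensorProduct (T'.tensorProduct T')
  have hb : ∀ i : ι × ι × ι, b.coord i = pairing B (T i.1) (T i.2.1) (T i.2.2) := fun i => by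
    refine tensor_ext fun X Y Z => ?_
    rw [pairing_tmul, ← repr_eq_form hdual, ← repr_eq_form hdual, ← repr_eq_form hdual]
    obtain ⟨i, j, k⟩ := i
    change b.repr _ (i, j, k) = _
    rw [Module.Basis.tensorProduct_repr_tmul_apply, Module.Basis.tensorProduct_repr_tmul_apply,
      smul_eq_mul, smul_eq_mul]
    ring
  refine b.ext_elem fun i => ?_
  change b.coord i t = b.coord i t'
  rw [hb, h]

lemma pairing_cyc (X Y Z : 𝔤) (t : 𝔤 ⊗[ℂ] (𝔤 ⊗[ℂ] 𝔤)) :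
    pairing B Z X Y (cyc t) = pairing B Y Z X t := by
  refine LinearMap.congr_fun (f := pairing B Z X Y ∘ₗ cyc) (tensor_ext fun x y z => ?_) t
  change B Z y * (B X z * B Y x) = B Y x * (B Z y * B X z)
  ring

lemma sum_sum_form_mul (hsymm : ∀ x y : 𝔤, B x y = B y x)
    (hdual : ∀ a b : ι, B (T a) (T' b) = if a = b then 1 else 0) (β : 𝔤 →ₗ[ℂ] 𝔤 →ₗ[ℂ] ℂ)
    (X Y : 𝔤) : ∑ a, ∑ b, B X (T' a) * (B Y (T' b) * β (T a) (T b)) = β X Y := by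
  conv_rhs => rw [← sum_form_smul hsymm hdual X, map_sum, LinearMap.sum_apply]
  refine Finset.sum_congr rfl fun a _ => ?_
  conv_rhs => rw [map_smul, LinearMap.smul_apply, ← sum_form_smul hsymm hdual Y, map_sum,
    smul_eq_mul, Finset.mul_sum]
  refine Finset.sum_congr rfl fun b _ => ?_
  rw [map_smul, smul_eq_mul]

lemma pairing_structureTensor (hsymm : ∀ x y : 𝔤, B x y = B y x)
    (hinv : ∀ x y z : 𝔤, B ⁅x, y⁆ z = B x ⁅y, z⁆)
    (hdual : ∀ a b : ι, B (T a) (T' b) = if a = b then 1 else 0) (X Y Z : 𝔤) :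
    pairing B Z X Y (structureTensor T T') = B ⁅X, Y⁆ Z := by
  rw [form_cyclic hsymm hinv, form_cyclic hsymm hinv, hsymm]
  simp only [structureTensor, map_sum, pairing_tmul]
  exact sum_sum_form_mul hsymm hdual
    ((LieAlgebra.ad ℂ 𝔤 : 𝔤 →ₗ[ℂ] 𝔤 →ₗ[ℂ] 𝔤).compr₂ (B Y)) Z X

lemma pairing_plTensor (hsymm : ∀ x y : 𝔤, B x y = B y x)
    (hdual : ∀ a b : ι, B (T a) (T' b) = if a = b then 1 else 0) (A : Module.End ℂ 𝔤)
    (D : 𝔤 →ₗ[ℂ] Module.End ℂ 𝔤) (X Y Z : 𝔤) :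
    pairing B Z X Y (plTensor T T' A D) = B Z ⁅A X, A Y⁆ + (1 / 2 : ℂ) * B Z (D Y X) := by
  have h1 := sum_sum_form_mul hsymm hdual
    (((LieAlgebra.ad ℂ 𝔤 : 𝔤 →ₗ[ℂ] 𝔤 →ₗ[ℂ] 𝔤).compl₁₂ A A).compr₂ (B Z)) X Y
  have h2 := sum_sum_form_mul hsymm hdual
    ((D : 𝔤 →ₗ[ℂ] 𝔤 →ₗ[ℂ] 𝔤).compr₂ (B Z)) Y X
  simp only [plTensor, map_add, map_sum, map_smul, pairing_tmul, smul_eq_mul]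
  refine congrArg₂ (· + ·) (Eq.trans ?_ h1) (congrArg _ (Eq.trans ?_ h2))
  · refine Finset.sum_congr rfl fun a _ => Finset.sum_congr rfl fun b _ => ?_
    change B Z ⁅A (T a), A (T b)⁆ * _ = _ * (_ * B Z ⁅A (T a), A (T b)⁆)
    ring
  · refine Finset.sum_congr rfl fun a _ => Finset.sum_congr rfl fun b _ => ?_
    change B Z (D (T a) (T b)) * _ = _ * (_ * B Z (D (T a) (T b)))
    ring

/-- The cyclic sum of the tensors of the tensor form is the left-hand side of the operator form. -/
lemma pairing_plTensor_cyc (hsymm : ∀ x y : 𝔤, B x y = B y x)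
    (hdual : ∀ a b : ι, B (T a) (T' b) = if a = b then 1 else 0) {A : Module.End ℂ 𝔤}
    {D : 𝔤 →ₗ[ℂ] Module.End ℂ 𝔤} (hD : ∀ X Y Z, B (D X Y) Z = -B Y (D X Z)) (X Y Z : 𝔤) :
    pairing B Z X Y (plTensor T T' A D + cyc (plTensor T T' A D) +
      cyc (cyc (plTensor T T' A D))) = plOperator B A D X Y Z := by
  rw [map_add, map_add, pairing_cyc, pairing_cyc, pairing_cyc, pairing_plTensor hsymm hdual,
    pairing_plTensor hsymm hdual, pairing_plTensor hsymm hdual, plOperator]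
  -- Skewness of `D X` turns the `+1/2` of the tensor form into the `-1/2` of the operator form.
  simp only [map_sub, map_smul, LinearMap.sub_apply, LinearMap.smul_apply, smul_eq_mul, hD]
  rw [hsymm Z ⁅A X, A Y⁆, hsymm Y ⁅A Z, A X⁆, hsymm X ⁅A Y, A Z⁆]
  rw [hsymm Z, hsymm Y, hsymm X, hD, hD, hD]
  ring

/-- The tensor form of the PL-CDYBE with right-hand side `μ f` is the operator form with constant
`μ`. -/
lemma plTensor_cyc_eq_smul_iff (hsymm : ∀ x y : 𝔤, B x y = B y x)
    (hinv : ∀ x y z : 𝔤, B ⁅x, y⁆ z = B x ⁅y, z⁆)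
    (hdual : ∀ a b : ι, B (T a) (T' b) = if a = b then 1 else 0)
    {A : Module.End ℂ 𝔤} {D : 𝔤 →ₗ[ℂ] Module.End ℂ 𝔤}
    (hD : ∀ X Y Z, B (D X Y) Z = -B Y (D X Z)) (μ : ℂ) :
    plTensor T T' A D + cyc (plTensor T T' A D) + cyc (cyc (plTensor T T' A D)) =
      μ • structureTensor T T' ↔ ∀ X Y Z, plOperator B A D X Y Z = μ * B ⁅X, Y⁆ Z := by
  constructor
  · intro h X Y Z
    rw [← pairing_plTensor_cyc hsymm hdual hD, h, map_smul,
      pairing_structureTensor hsymm hinv hdual, smul_eq_mul]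
  · intro h
    refine eq_of_pairing hdual fun Z X Y => ?_
    rw [pairing_plTensor_cyc hsymm hdual hD, h, map_smul,
      pairing_structureTensor hsymm hinv hdual, smul_eq_mul]

end Pairing

/-! ### The three assertions for a simple Lie algebra. -/

section Solutions

variable {𝔤 : Type*} [LieRing 𝔤] [LieAlgebra ℂ 𝔤] [FiniteDimensional ℂ 𝔤] [LieAlgebra.IsSimple ℂ 𝔤]
  [TopologicalSpace 𝔤] [T2Space 𝔤]
  {B : LinearMap.BilinForm ℂ 𝔤} {n : ℕ} {ρ : 𝔤 →ₗ⁅ℂ⁆ Matrix (Fin n) (Fin n) ℂ} {U : Set 𝔤}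
  {F : ℂ → ℂ} {R : linGroup ρ → Module.End ℂ 𝔤}

lemma nontrivial_of_isSimple (𝔤 : Type*) [LieRing 𝔤] [LieAlgebra ℂ 𝔤] [LieAlgebra.IsSimple ℂ 𝔤] :
    Nontrivial 𝔤 := by
  by_contra h
  rw [not_nontrivial_iff_subsingleton] at h
  exact LieAlgebra.IsSimple.non_abelian (R := ℂ) (L := 𝔤) ⟨fun x y => Subsingleton.elim _ _⟩

lemma SolvesPLCDYBE.unique (hnondeg : B.Nondegenerate)
    (hinv : ∀ x y z : 𝔤, B ⁅x, y⁆ z = B x ⁅y, z⁆) (hU : IsExpDomain ρ U) {μ μ' : ℂ}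
    (h : SolvesPLCDYBE B ρ U R μ) (h' : SolvesPLCDYBE B ρ U R μ') : μ = μ' := by
  obtain ⟨ω, X, Y, c, -, -, hne⟩ := exists_form_lie_ne_zero hnondeg hinv
  obtain ⟨D, hD, e⟩ := h _ ⟨0, hU.zero_mem, rfl⟩
  obtain ⟨D', hD', e'⟩ := h' _ ⟨0, hU.zero_mem, rfl⟩
  obtain rfl : D = D' := funext fun X => (hD X).unique (hD' X)
  exact mul_right_cancel₀ hne ((e X Y ω).symm.trans (e' X Y ω))

variable [IsTopologicalAddGroup 𝔤] [ContinuousSMul ℂ 𝔤]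

lemma solvesTensor_iff (hsymm : ∀ x y : 𝔤, B x y = B y x)
    (hinv : ∀ x y z : 𝔤, B ⁅x, y⁆ z = B x ⁅y, z⁆)
    {ι : Type*} [Fintype ι] [DecidableEq ι] {T T' : Module.Basis ι ℂ 𝔤}
    (hdual : ∀ a b : ι, B (T a) (T' b) = if a = b then 1 else 0)
    (hρ : Function.Injective ρ) (hU : IsExpDomain ρ U) (hF : AnalyticAt ℂ F 0)
    (hodd : ∀ᶠ z in 𝓝 (0 : ℂ), F (-z) = -F z) (hR : IsAnsatz ρ U F R)
    (I : 𝔤 ⊗[ℂ] (𝔤 ⊗[ℂ] 𝔤)) : SolvesTensorPLCDYBE T T' ρ U R I ↔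
      ∃ μ : ℂ, I = μ • structureTensor T T' ∧ SolvesPLCDYBE B ρ U R μ := by
  have := nontrivial_of_isSimple 𝔤
  have hf := coeff_taylor_even hF hodd
  have key : ∀ ω ∈ U, ∃ D : 𝔤 →ₗ[ℂ] Module.End ℂ 𝔤, (∀ X, IsDPlus ρ R (expG ρ ω) X (D X)) ∧
      (∀ X Y Z, B (D X Y) Z = -B Y (D X Z)) := fun ω hω => by
    obtain ⟨D, hD, hD'⟩ := hR.exists_isDPlus hU hρ hF hω
    obtain ⟨q, q', C, hq, hqq, hb, hA⟩ := hR.exists_powBound hU.isOpen hF hω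
    refine ⟨D, hD, fun X Y Z => ?_⟩
    obtain ⟨W, hW⟩ := hD' X
    rw [hW, hA.self_of_nhds.form_pdel_skew hb hq hqq hinv hf]
  constructor
  · intro h
    -- The equation at `Ω = 1` determines the constant tensor `I` for all `Ω`.
    have h0 : I = (-3 * PowerSeries.coeff 1 (taylor F)) • structureTensor T T' := by
      obtain ⟨D, hD, hD'⟩ := key 0 hU.zero_mem
      obtain ⟨D₁, hD₁, hI⟩ := h _ ⟨0, hU.zero_mem, rfl⟩
      obtain rfl : D₁ = D := funext fun X => (hD₁ X).unique (hD X)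
      rw [← hI]
      exact (plTensor_cyc_eq_smul_iff hsymm hinv hdual hD' _).mpr
        ((plOperator_eq_iff hR hU hρ hF _ hU.zero_mem hD).mpr
          (plForm_origin hsymm hinv (hf 0 Even.zero)))
    refine ⟨_, h0, ?_⟩
    rintro _ ⟨ω, hω, rfl⟩
    obtain ⟨D, hD, hD'⟩ := key ω hω
    obtain ⟨D₁, hD₁, hI⟩ := h _ ⟨ω, hω, rfl⟩
    obtain rfl : D₁ = D := funext fun X => (hD₁ X).unique (hD X)
    exact ⟨D, hD, (plTensor_cyc_eq_smul_iff hsymm hinv hdual hD' _).mp (hI.trans h0)⟩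
  · rintro ⟨μ, rfl, h⟩ _ ⟨ω, hω, rfl⟩
    obtain ⟨D, hD, hD'⟩ := key ω hω
    obtain ⟨D₁, hD₁, e⟩ := h _ ⟨ω, hω, rfl⟩
    obtain rfl : D₁ = D := funext fun X => (hD₁ X).unique (hD X)
    exact ⟨D, hD, (plTensor_cyc_eq_smul_iff hsymm hinv hdual hD' _).mpr e⟩

lemma solves_of_isFnuSeries (hsymm : ∀ x y : 𝔤, B x y = B y x)
    (hinv : ∀ x y z : 𝔤, B ⁅x, y⁆ z = B x ⁅y, z⁆) (hρ : Function.Injective ρ)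
    (hU : IsExpDomain ρ U) (hF : AnalyticAt ℂ F 0)
    (hodd : ∀ᶠ z in 𝓝 (0 : ℂ), F (-z) = -F z) (hR : IsAnsatz ρ U F R) {ν : ℂ}
    (hν : IsFnuSeries (taylor F) ν) : SolvesPLCDYBE B ρ U R (1 / 4 - ν ^ 2) := by
  have := nontrivial_of_isSimple 𝔤
  exact (solves_iff hR hU hρ hF _).mpr fun ω hω X Y Z =>
    plForm_eq_zero hR hU.isOpen hF hodd hsymm hinv hν hω X Y Z

lemma SolvesPLCDYBE.exists_isFnuSeries (hsymm : ∀ x y : 𝔤, B x y = B y x)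
    (hnondeg : B.Nondegenerate)
    (hinv : ∀ x y z : 𝔤, B ⁅x, y⁆ z = B x ⁅y, z⁆) (hρ : Function.Injective ρ)
    (hU : IsExpDomain ρ U) (hF : AnalyticAt ℂ F 0)
    (hodd : ∀ᶠ z in 𝓝 (0 : ℂ), F (-z) = -F z) (hR : IsAnsatz ρ U F R) {μ : ℂ}
    (h : SolvesPLCDYBE B ρ U R μ) : ∃ ν, IsFnuSeries (taylor F) ν := by
  have := nontrivial_of_isSimple 𝔤
  -- `ν` is either square root of `1/4 - μ`.
  obtain ⟨ν, hν⟩ := IsAlgClosed.exists_pow_nat_eq (1 / 4 - μ) two_pos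
  exact ⟨ν, isFnuSeries_of_plForm hR hU hF hodd hsymm hnondeg hinv (by rw [hν]; ring)
    ((solves_iff hR hU hρ hF _).mp h)⟩

end Solutions

end PLDyn

end

theorem proposition2 {𝔤 : Type*} [LieRing 𝔤] [LieAlgebra ℂ 𝔤]
    [FiniteDimensional ℂ 𝔤] [LieAlgebra.IsSimple ℂ 𝔤]
    [TopologicalSpace 𝔤] [IsTopologicalAddGroup 𝔤] [ContinuousSMul ℂ 𝔤] [T2Space 𝔤]
    -- an invariant scalar product on the Lie algebra, and dual bases
    (B : LinearMap.BilinForm ℂ 𝔤) (hsymm : ∀ x y : 𝔤, B x y = B y x)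
    (hnondeg : B.Nondegenerate) (hinv : ∀ x y z : 𝔤, B ⁅x, y⁆ z = B x ⁅y, z⁆)
    {ι : Type*} [Fintype ι] [DecidableEq ι] (T T' : Module.Basis ι ℂ 𝔤)
    (hdual : ∀ a b : ι, B (T a) (T' b) = if a = b then 1 else 0)
    -- a connected complex Lie group with this Lie algebra, realized by matrices
    {n : ℕ} (ρ : 𝔤 →ₗ⁅ℂ⁆ Matrix (Fin n) (Fin n) ℂ) (hρ : Function.Injective ρ)
    -- a domain on which the exponential map is a diffeomorphism
    (U : Set 𝔤) (hU : PLDyn.IsExpDomain ρ U)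
    -- an odd function, holomorphic near zero, and the ansatz
    (F : ℂ → ℂ) (hF : AnalyticAt ℂ F 0) (hodd : ∀ᶠ z in 𝓝 (0 : ℂ), F (-z) = -F z)
    (R : PLDyn.linGroup ρ → Module.End ℂ 𝔤) (hR : PLDyn.IsAnsatz ρ U F R) :
    ((∃ μ : ℂ, PLDyn.SolvesPLCDYBE B ρ U R μ) ↔
      ∃ ν : ℂ, ∀ᶠ z in 𝓝 (0 : ℂ), F z = PLDyn.Fnu ν z) ∧
    (∀ ν : ℂ, (∀ᶠ z in 𝓝 (0 : ℂ), F z = PLDyn.Fnu ν z) →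
      ∀ μ : ℂ, PLDyn.SolvesPLCDYBE B ρ U R μ ↔ μ = 1 / 4 - ν ^ 2) ∧
    (∀ I : 𝔤 ⊗[ℂ] (𝔤 ⊗[ℂ] 𝔤), PLDyn.SolvesTensorPLCDYBE T T' ρ U R I ↔
      ∃ μ : ℂ, I = μ • PLDyn.structureTensor T T' ∧ PLDyn.SolvesPLCDYBE B ρ U R μ) := by
  have h0 : F 0 = 0 := by
    have h := hodd.self_of_nhds
    rw [neg_zero] at h
    exact self_eq_neg.mp h
  have hsuff : ∀ ν : ℂ, (∀ᶠ z in 𝓝 (0 : ℂ), F z = PLDyn.Fnu ν z) →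
      PLDyn.SolvesPLCDYBE B ρ U R (1 / 4 - ν ^ 2) := fun ν hν =>
    PLDyn.solves_of_isFnuSeries hsymm hinv hρ hU hF hodd hR
      ((PLDyn.eventually_eq_Fnu_iff hF h0 ν).mp hν)
  refine ⟨⟨?_, fun ⟨ν, hν⟩ => ⟨_, hsuff ν hν⟩⟩, fun ν hν μ => ⟨fun h => ?_, ?_⟩,
    PLDyn.solvesTensor_iff hsymm hinv hdual hρ hU hF hodd hR⟩
  · rintro ⟨μ, h⟩
    obtain ⟨ν, hν⟩ := h.exists_isFnuSeries hsymm hnondeg hinv hρ hU hF hodd hR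
    exact ⟨ν, (PLDyn.eventually_eq_Fnu_iff hF h0 ν).mpr hν⟩
  · exact h.unique hnondeg hinv hU (hsuff ν hν)
  · rintro rfl
    exact hsuff ν hν
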